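/- **Definitions.** For a C*-algebra $A$ and $a,b\in A_+$ write $a\lesssim b$ if there is a sequence $(x_n)$ in $A$ with $\lim_n\|x_n^*bx_n-a\|=0$. For an integer $d\ge 0$ let $\mathcal I_d$ be the class of C*-algebras of the form $PM_r(C(X))P$, where $r\ge 1$, $X$ is a compact subset of a finite CW complex $Y$ of covering dimension at most $d$, and $P=Q|_X$ for some projection $Q\in M_r(C(Y))$ (these are exactly the quotients of algebras $QM_r(C(Y))Q$). A unital simple C*-algebra $A$ is in $\mathcal C_1$ if for every finite subset $\mathcal F\subset A$, all $\epsilon>0$ and $\eta>0$, and every $a\in A_+\setminus\{0\}$ there are a nonzero projection $p\in A$, an integer $d\ge 0$ and a C*-subalgebra $C\subset A$ with unit $1_C=p$ and with $C\cong PM_r(C(X))P\in\mathcal I_d$ such that (i) $\|pf-fp\|<\epsilon$ for all $f\in\mathcal F$; (ii) $\mathrm{dist}(pfp,C)<\epsilon$ for all $f\in\mathcal F$; (iii) $\operatorname{rank}P(x)>0$ and $\frac{d+1}{\operatorname{rank}P(x)}<\frac{\eta}{2}$ for all $x\in X$; (iv) $1-p\lesssim a$. Let $K_0(A)$ be the Grothendieck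 group of the semigroup of Murray–von Neumann classes of projections in $M_\infty(A)=\bigcup_n M_n(A)$, with positive cone $K_0(A)_+=\{[p]: p\in M_\infty(A)\text{ a projection}\}$, and write $x\le y$ if $y-x\in K_0(A)_+$, and $x>0$ if $x\ge 0$ and $x\ne 0$. **Theorem.** Let $A$ be a unital separable simple C*-algebra in $\mathcal C_1$. Then $K_0(A)$ is a weakly unperforated Riesz group. That is: (1) $(K_0(A),K_0(A)_+)$ is an ordered group: $K_0(A)_+\cap(-K_0(A)_+)=\{0\}$ and $K_0(A)=K_0(A)_+-K_0(A)_+$; (2) (Riesz decomposition) if $x,y_1,y_2\in K_0(A)_+$ and $x\le y_1+y_2$, then $x=x_1+x_2$ with $0\le x_1\le y_1$ and $0\le x_2\le y_2$; (3) (weak unperforation) if $x\in K_0(A)$ and $nx>0$ for some integer $n\ge 1$, then $x>0$. -/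

import Mathlib

/-! ### Murray–von Neumann equivalence and the ordered group `K₀` -/

section MurrayVonNeumann

open scoped Matrix

/-- Murray–von Neumann equivalence of square matrices `p`, `q` (of possibly different sizes) over
a `*`-ring: `p = v v*` and `q = v* v` for a rectangular matrix `v`. -/
def MvNEquiv {A : Type*} [Ring A] [StarRing A] {m n : Type*} [Fintype m] [Fintype n]
    (p : Matrix m m A) (q : Matrix n n A) : Prop :=
  ∃ v : Matrix m n A, v * vᴴ = p ∧ vᴴ * v = q

theorem MvNEquiv.refl {A : Type*} [Ring A] [StarRing A] {m : Type*} [Fintype m]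
    {p : Matrix m m A} (hp : IsStarProjection p) : MvNEquiv p p := by
  have hs : pᴴ = p := hp.isSelfAdjoint
  have hi : p * p = p := hp.isIdempotentElem
  exact ⟨p, by rw [hs, hi], by rw [hs, hi]⟩

theorem MvNEquiv.symm {A : Type*} [Ring A] [StarRing A] {m n : Type*} [Fintype m] [Fintype n]
    {p : Matrix m m A} {q : Matrix n n A} (h : MvNEquiv p q) : MvNEquiv q p := by
  obtain ⟨v, h1, h2⟩ := h
  exact ⟨vᴴ, by simpa using h2, by simpa using h1⟩

theorem MvNEquiv.trans {A : Type*} [Ring A] [StarRing A] {m n k : Type*} [Fintype m] [Fintype n]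
    [Fintype k] {p : Matrix m m A} {q : Matrix n n A} {r : Matrix k k A}
    (hp : IsStarProjection p) (hr : IsStarProjection r)
    (h : MvNEquiv p q) (h' : MvNEquiv q r) : MvNEquiv p r := by
  have hpi : p * p = p := hp.isIdempotentElem
  have hri : r * r = r := hr.isIdempotentElem
  obtain ⟨v, h1, h2⟩ := h
  obtain ⟨w, h3, h4⟩ := h'
  refine ⟨v * w, ?_, ?_⟩
  · calc (v * w) * (v * w)ᴴ = v * (w * wᴴ) * vᴴ := by
          simp only [Matrix.conjTranspose_mul, Matrix.mul_assoc]
      _ = (v * vᴴ) * (v * vᴴ) := by rw [h3, ← h2]; simp only [Matrix.mul_assoc]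
      _ = p := by rw [h1, hpi]
  · calc (v * w)ᴴ * (v * w) = wᴴ * (vᴴ * v) * w := by
          simp only [Matrix.conjTranspose_mul, Matrix.mul_assoc]
      _ = (wᴴ * w) * (wᴴ * w) := by rw [h2, ← h3]; simp only [Matrix.mul_assoc]
      _ = r := by rw [h4, hri]

theorem IsStarProjection.matrix_reindex {A : Type*} [Ring A] [StarRing A] {m n : Type*}
    [Fintype m] [Fintype n] {p : Matrix m m A} (hp : IsStarProjection p) (e : m ≃ n) :
    IsStarProjection (Matrix.reindex e e p) := by
  have hs : pᴴ = p := hp.isSelfAdjoint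
  have hi : p * p = p := hp.isIdempotentElem
  refine ⟨?_, ?_⟩
  · change Matrix.reindex e e p * Matrix.reindex e e p = _
    simp only [Matrix.reindex_apply]
    rw [Matrix.submatrix_mul_equiv, hi]
  · change (Matrix.reindex e e p)ᴴ = _
    rw [Matrix.conjTranspose_reindex, hs]

theorem IsStarProjection.matrix_fromBlocks {A : Type*} [Ring A] [StarRing A] {m n : Type*}
    [Fintype m] [Fintype n] {p : Matrix m m A} {q : Matrix n n A} (hp : IsStarProjection p)
    (hq : IsStarProjection q) : IsStarProjection (Matrix.fromBlocks p 0 0 q) := by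
  have hs : pᴴ = p := hp.isSelfAdjoint
  have hi : p * p = p := hp.isIdempotentElem
  have hs' : qᴴ = q := hq.isSelfAdjoint
  have hi' : q * q = q := hq.isIdempotentElem
  refine ⟨?_, ?_⟩
  · change Matrix.fromBlocks p 0 0 q * Matrix.fromBlocks p 0 0 q = _
    simp [Matrix.fromBlocks_multiply, hi, hi']
  · change (Matrix.fromBlocks p 0 0 q)ᴴ = _
    simp [Matrix.fromBlocks_conjTranspose, hs, hs']

theorem MvNEquiv.of_reindex {A : Type*} [Ring A] [StarRing A] {m n : Type*}
    [Fintype m] [Fintype n] {p : Matrix m m A} (hp : IsStarProjection p) (e : m ≃ n) :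
    MvNEquiv p (Matrix.reindex e e p) := by
  have hs : pᴴ = p := hp.isSelfAdjoint
  have hi : p * p = p := hp.isIdempotentElem
  refine ⟨p.submatrix id e.symm, ?_, ?_⟩
  · rw [Matrix.conjTranspose_submatrix, Matrix.submatrix_mul_equiv, hs, hi, Matrix.submatrix_id_id]
  · rw [Matrix.conjTranspose_submatrix, hs, Matrix.reindex_apply]
    conv_rhs => rw [← hi]
    exact (Matrix.submatrix_mul p p e.symm id e.symm Function.bijective_id).symm

theorem MvNEquiv.fromBlocks {A : Type*} [Ring A] [StarRing A] {m n m' n' : Type*}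
    [Fintype m] [Fintype n] [Fintype m'] [Fintype n']
    {p : Matrix m m A} {q : Matrix n n A} {p' : Matrix m' m' A} {q' : Matrix n' n' A}
    (h : MvNEquiv p p') (h' : MvNEquiv q q') :
    MvNEquiv (Matrix.fromBlocks p 0 0 q) (Matrix.fromBlocks p' 0 0 q') := by
  obtain ⟨v, h1, h2⟩ := h
  obtain ⟨w, h3, h4⟩ := h'
  exact ⟨Matrix.fromBlocks v 0 0 w,
    by simp [Matrix.fromBlocks_conjTranspose, Matrix.fromBlocks_multiply, h1, h3],
    by simp [Matrix.fromBlocks_conjTranspose, Matrix.fromBlocks_multiply, h2, h4]⟩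

/-- Projections in `M_∞(A) = ⋃ₙ Mₙ(A)`: a size together with a projection of that size. -/
def MatrixProj (A : Type*) [Ring A] [StarRing A] : Type _ :=
  Σ n : ℕ, {p : Matrix (Fin n) (Fin n) A // IsStarProjection p}

/-- The diagonal sum `diag(p, q)` of two projections. -/
def MatrixProj.dsum {A : Type*} [Ring A] [StarRing A] (x y : MatrixProj A) : MatrixProj A :=
  ⟨x.1 + y.1, Matrix.reindex finSumFinEquiv finSumFinEquiv (Matrix.fromBlocks x.2.1 0 0 y.2.1),
    (x.2.2.matrix_fromBlocks y.2.2).matrix_reindex _⟩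

instance MatrixProj.instSetoid (A : Type*) [Ring A] [StarRing A] : Setoid (MatrixProj A) where
  r x y := MvNEquiv x.2.1 y.2.1
  iseqv := ⟨fun x => MvNEquiv.refl x.2.2, MvNEquiv.symm,
    fun {x _ z} h h' => MvNEquiv.trans x.2.2 z.2.2 h h'⟩

theorem MatrixProj.dsum_equiv {A : Type*} [Ring A] [StarRing A] (x y : MatrixProj A) :
    MvNEquiv (x.dsum y).2.1 (Matrix.fromBlocks x.2.1 0 0 y.2.1) :=
  (MvNEquiv.of_reindex (x.2.2.matrix_fromBlocks y.2.2) finSumFinEquiv).symm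

/-- The Murray–von Neumann semigroup `V(A)`: equivalence classes of projections in `M_∞(A)`. -/
def MvNSemigroup (A : Type*) [Ring A] [StarRing A] : Type _ :=
  Quotient (MatrixProj.instSetoid A)

/-- The class `[p]` of a projection in `M_∞(A)`. -/
def MvNSemigroup.mk {A : Type*} [Ring A] [StarRing A] (x : MatrixProj A) : MvNSemigroup A :=
  Quotient.mk _ x

/-- Addition on `V(A)` is `[p] + [q] = [diag(p, q)]`. -/
instance MvNSemigroup.instAdd (A : Type*) [Ring A] [StarRing A] : Add (MvNSemigroup A) where
  add := Quotient.map₂ MatrixProj.dsum (by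
    intro x x' hx y y' hy
    exact MvNEquiv.trans (x.dsum y).2.2 (x'.dsum y').2.2 (x.dsum_equiv y)
      (MvNEquiv.trans (x.2.2.matrix_fromBlocks y.2.2) (x'.dsum y').2.2
        (MvNEquiv.fromBlocks hx hy) (x'.dsum_equiv y').symm))

instance MvNSemigroup.instZero (A : Type*) [Ring A] [StarRing A] : Zero (MvNSemigroup A) where
  zero := MvNSemigroup.mk ⟨0, 0, ⟨by simp [IsIdempotentElem], by simp [IsSelfAdjoint]⟩⟩

theorem MvNSemigroup.mk_add_mk {A : Type*} [Ring A] [StarRing A] (x y : MatrixProj A) :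
    MvNSemigroup.mk x + MvNSemigroup.mk y = MvNSemigroup.mk (x.dsum y) := rfl

protected theorem MvNSemigroup.add_comm {A : Type*} [Ring A] [StarRing A]
    (a b : MvNSemigroup A) : a + b = b + a := by
  induction a using Quotient.inductionOn with | _ x
  induction b using Quotient.inductionOn with | _ y
  refine Quotient.sound (?_ : MvNEquiv (x.dsum y).2.1 (y.dsum x).2.1)
  refine MvNEquiv.trans (x.dsum y).2.2 (y.dsum x).2.2 (x.dsum_equiv y) ?_
  have h := MvNEquiv.of_reindex (x.2.2.matrix_fromBlocks y.2.2) (Equiv.sumComm _ _)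
  have e : Matrix.reindex (Equiv.sumComm _ _) (Equiv.sumComm _ _)
      (Matrix.fromBlocks x.2.1 0 0 y.2.1) = Matrix.fromBlocks y.2.1 0 0 x.2.1 := by
    ext i j; rcases i with i | i <;> rcases j with j | j <;> rfl
  rw [e] at h
  exact MvNEquiv.trans (x.2.2.matrix_fromBlocks y.2.2) (y.dsum x).2.2 h (y.dsum_equiv x).symm

protected theorem MvNSemigroup.add_assoc {A : Type*} [Ring A] [StarRing A]
    (a b c : MvNSemigroup A) : a + b + c = a + (b + c) := by
  induction a using Quotient.inductionOn with | _ x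
  induction b using Quotient.inductionOn with | _ y
  induction c using Quotient.inductionOn with | _ z
  refine Quotient.sound (?_ : MvNEquiv ((x.dsum y).dsum z).2.1 (x.dsum (y.dsum z)).2.1)
  have hz := MvNEquiv.refl z.2.2
  have hx := MvNEquiv.refl x.2.2
  have pl := (x.2.2.matrix_fromBlocks y.2.2).matrix_fromBlocks z.2.2
  have pr := x.2.2.matrix_fromBlocks (y.2.2.matrix_fromBlocks z.2.2)
  have pL := ((x.dsum y).dsum z).2.2
  have pR := (x.dsum (y.dsum z)).2.2
  have hl : MvNEquiv ((x.dsum y).dsum z).2.1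
      (Matrix.fromBlocks (Matrix.fromBlocks x.2.1 0 0 y.2.1) 0 0 z.2.1) :=
    MvNEquiv.trans pL pl ((x.dsum y).dsum_equiv z) (MvNEquiv.fromBlocks (x.dsum_equiv y) hz)
  have hr : MvNEquiv (x.dsum (y.dsum z)).2.1
      (Matrix.fromBlocks x.2.1 0 0 (Matrix.fromBlocks y.2.1 0 0 z.2.1)) :=
    MvNEquiv.trans pR pr (x.dsum_equiv (y.dsum z)) (MvNEquiv.fromBlocks hx (y.dsum_equiv z))
  have h := MvNEquiv.of_reindex pl (Equiv.sumAssoc _ _ _)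
  have e : Matrix.reindex (Equiv.sumAssoc _ _ _) (Equiv.sumAssoc _ _ _)
      (Matrix.fromBlocks (Matrix.fromBlocks x.2.1 0 0 y.2.1) 0 0 z.2.1) =
      Matrix.fromBlocks x.2.1 0 0 (Matrix.fromBlocks y.2.1 0 0 z.2.1) := by
    ext i j
    rcases i with i | i | i <;> rcases j with j | j | j <;> rfl
  rw [e] at h
  exact MvNEquiv.trans pL pR hl (MvNEquiv.trans pl pR h hr.symm)

protected theorem MvNSemigroup.add_zero {A : Type*} [Ring A] [StarRing A]
    (a : MvNSemigroup A) : a + 0 = a := by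
  induction a using Quotient.inductionOn with | _ x
  have p0 : IsStarProjection (0 : Matrix (Fin 0) (Fin 0) A) :=
    ⟨by simp [IsIdempotentElem], by simp [IsSelfAdjoint]⟩
  refine Quotient.sound (?_ : MvNEquiv (x.dsum ⟨0, 0, p0⟩).2.1 x.2.1)
  refine MvNEquiv.trans (x.dsum ⟨0, 0, p0⟩).2.2 x.2.2 (x.dsum_equiv ⟨0, 0, p0⟩) ?_
  have h := MvNEquiv.of_reindex (x.2.2.matrix_fromBlocks p0) (Equiv.sumEmpty _ _)
  have e : Matrix.reindex (Equiv.sumEmpty _ _) (Equiv.sumEmpty _ _)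
      (Matrix.fromBlocks x.2.1 0 0 (0 : Matrix (Fin 0) (Fin 0) A)) = x.2.1 := by
    ext i j; rfl
  rw [e] at h
  exact h

instance MvNSemigroup.instAddCommMonoid (A : Type*) [Ring A] [StarRing A] :
    AddCommMonoid (MvNSemigroup A) where
  add_assoc := MvNSemigroup.add_assoc
  add_comm := MvNSemigroup.add_comm
  add_zero := MvNSemigroup.add_zero
  zero_add a := by rw [MvNSemigroup.add_comm, MvNSemigroup.add_zero]
  nsmul := nsmulRec

/-- `K₀(A)` of a unital C*-algebra: the Grothendieck group of `V(A)`. -/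
abbrev K0 (A : Type*) [Ring A] [StarRing A] : Type _ :=
  Algebra.GrothendieckAddGroup (MvNSemigroup A)

/-- The positive cone `K₀(A)₊`: the classes of projections in `M_∞(A)`. -/
def K0.positiveCone (A : Type*) [Ring A] [StarRing A] : AddSubmonoid (K0 A) :=
  AddMonoidHom.mrange (Algebra.GrothendieckAddGroup.of (M := MvNSemigroup A))

end MurrayVonNeumann

/-! ### Order properties of an abelian group with a cone `P`, where `x ≤ y` means `y - x ∈ P` -/

/-- `(G, P)` is an ordered abelian group: `P ∩ (-P) = {0}` and `P - P = G`. -/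
structure IsOrderedGroupCone {G : Type*} [AddCommGroup G] (P : AddSubmonoid G) : Prop where
  eq_zero : ∀ x ∈ P, -x ∈ P → x = 0
  generates : ∀ x : G, ∃ y ∈ P, ∃ z ∈ P, x = y - z

/-- `(G, P)` is a Riesz group: an ordered group with the Riesz decomposition property
(if `0 ≤ x ≤ y₁ + y₂` with `y₁, y₂ ≥ 0` then `x = x₁ + x₂` with `0 ≤ xᵢ ≤ yᵢ`). -/
structure IsRieszGroup {G : Type*} [AddCommGroup G] (P : AddSubmonoid G) : Prop
    extends IsOrderedGroupCone P where
  decomposition : ∀ x ∈ P, ∀ y₁ ∈ P, ∀ y₂ ∈ P, y₁ + y₂ - x ∈ P →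
    ∃ x₁ ∈ P, ∃ x₂ ∈ P, x = x₁ + x₂ ∧ y₁ - x₁ ∈ P ∧ y₂ - x₂ ∈ P

/-- `(G, P)` is weakly unperforated: `n x > 0` for some `n ≥ 1` implies `x > 0`. -/
def IsWeaklyUnperforated {G : Type*} [AddCommGroup G] (P : AddSubmonoid G) : Prop :=
  ∀ (x : G) (n : ℕ), 1 ≤ n → n • x ∈ P → n • x ≠ 0 → x ∈ P ∧ x ≠ 0

/-! ### Simple C*-algebras and the Cuntz relation -/

/-- A C*-algebra is simple: it is nonzero and its only closed two-sided ideals are `0` and `A`. -/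
def IsSimpleCStar (A : Type*) [CStarAlgebra A] : Prop :=
  Nontrivial A ∧ ∀ I : TwoSidedIdeal A, IsClosed (I : Set A) → I = ⊥ ∨ I = ⊤

/-- The Cuntz relation `a ≲ b`: there are `xₙ` with `xₙ* b xₙ → a`. -/
def CuntzLE {A : Type*} [CStarAlgebra A] (a b : A) : Prop :=
  ∃ x : ℕ → A, Filter.Tendsto (fun n => star (x n) * b * x n) Filter.atTop (nhds a)

/-! ### The homogeneous algebras `P M_r(C(X)) P` -/

/-- Covering dimension at most `d`: every finite open cover has an open refinement such that each
point lies in at most `d + 1` of its members. -/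
def CoveringDimLE (Y : Type*) [TopologicalSpace Y] (d : ℕ) : Prop :=
  ∀ 𝒰 : Set (Set Y), 𝒰.Finite → (∀ U ∈ 𝒰, IsOpen U) → ⋃₀ 𝒰 = Set.univ →
    ∃ 𝒱 : Set (Set Y), (∀ V ∈ 𝒱, IsOpen V) ∧ ⋃₀ 𝒱 = Set.univ ∧
      (∀ V ∈ 𝒱, ∃ U ∈ 𝒰, V ⊆ U) ∧ ∀ y : Y, {V ∈ 𝒱 | y ∈ V}.encard ≤ d + 1

/-- A Hausdorff space that admits the structure of a finite CW complex. -/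
def IsFiniteCWComplex (Y : Type*) [TopologicalSpace Y] : Prop :=
  T2Space Y ∧ ∃ _ : Topology.CWComplex (Set.univ : Set Y),
    Topology.RelCWComplex.Finite (Set.univ : Set Y)

/-- The corner `P R P = {a | P a = a = a P}` of a complex `*`-algebra `R` at a projection `P`. -/
def starCorner {R : Type*} [Ring R] [StarRing R] [Algebra ℂ R] [StarModule ℂ R]
    (P : R) (hP : IsStarProjection P) : NonUnitalStarSubalgebra ℂ R where
  carrier := {a | P * a = a ∧ a * P = a}
  add_mem' := fun {a b} ha hb => ⟨by rw [mul_add, ha.1, hb.1], by rw [add_mul, ha.2, hb.2]⟩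
  zero_mem' := ⟨mul_zero P, zero_mul P⟩
  mul_mem' := fun {a b} ha hb => ⟨by rw [← mul_assoc, ha.1], by rw [mul_assoc, hb.2]⟩
  smul_mem' := fun c {a} ha => ⟨by rw [mul_smul_comm, ha.1], by rw [smul_mul_assoc, ha.2]⟩
  star_mem' := fun {a} ha => by
    have hs : star P = P := hP.isSelfAdjoint
    refine ⟨?_, ?_⟩
    · have h := congrArg star ha.2
      rwa [star_mul, hs] at h
    · have h := congrArg star ha.1
      rwa [star_mul, hs] at h

/-- Restriction of a matrix of continuous functions to a subspace. -/
noncomputable def restrictMatrix {Y : Type*} [TopologicalSpace Y] {r : ℕ} (X : Set Y)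
    (Q : Matrix (Fin r) (Fin r) C(Y, ℂ)) : Matrix (Fin r) (Fin r) C(X, ℂ) :=
  Q.map (fun f => f.restrict X)

theorem IsStarProjection.restrictMatrix {Y : Type*} [TopologicalSpace Y] {r : ℕ} (X : Set Y)
    {Q : Matrix (Fin r) (Fin r) C(Y, ℂ)} (hQ : IsStarProjection Q) :
    IsStarProjection (restrictMatrix X Q) := by
  have hs : star Q = Q := hQ.isSelfAdjoint
  have hi : Q * Q = Q := hQ.isIdempotentElem
  refine ⟨?_, ?_⟩
  · change _root_.restrictMatrix X Q * _root_.restrictMatrix X Q = _root_.restrictMatrix X Q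
    ext i j x
    have h := congrArg (fun f : C(Y, ℂ) => f x) (congrFun (congrFun hi i) j)
    simpa [_root_.restrictMatrix, Matrix.mul_apply, ContinuousMap.sum_apply] using h
  · change star (_root_.restrictMatrix X Q) = _root_.restrictMatrix X Q
    ext i j x
    have h := congrArg (fun f : C(Y, ℂ) => f x) (congrFun (congrFun hs i) j)
    simpa [_root_.restrictMatrix, Matrix.star_apply] using h

/-- The data presenting an algebra of the class `I_d` (quotients of algebras `Q M_r(C(Y)) Q` with
`Y` a finite CW complex of covering dimension at most `d`): such a `Y`, a compact subset `X`, and a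
projection `Q ∈ M_r(C(Y))`. The algebra is `P M_r(C(X)) P` with `P = Q|_X`. As a finite CW complex
has at most continuum many points, it is no restriction to take `Y : Type`. -/
structure HomogeneousData (d : ℕ) where
  Y : Type
  [top : TopologicalSpace Y]
  isFiniteCW : IsFiniteCWComplex Y
  dim_le : CoveringDimLE Y d
  X : Set Y
  isCompact : IsCompact X
  r : ℕ
  one_le : 1 ≤ r
  Q : Matrix (Fin r) (Fin r) C(Y, ℂ)
  isProj : IsStarProjection Q

attribute [instance] HomogeneousData.top

/-- The projection `P = Q|_X`. -/
noncomputable def HomogeneousData.P {d : ℕ} (D : HomogeneousData d) : Matrix (Fin D.r) (Fin D.r) C(D.X, ℂ) :=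
  restrictMatrix D.X D.Q

/-- The `*`-algebra `P M_r(C(X)) P`. -/
noncomputable def HomogeneousData.algebra {d : ℕ} (D : HomogeneousData d) :
    NonUnitalStarSubalgebra ℂ (Matrix (Fin D.r) (Fin D.r) C(D.X, ℂ)) :=
  starCorner D.P (D.isProj.restrictMatrix D.X)

/-- The rank of the complex matrix `P(x)`. -/
noncomputable def HomogeneousData.rankAt {d : ℕ} (D : HomogeneousData d) (x : D.X) : ℕ :=
  (D.P.map (fun f => f x)).rank

/-! ### The classes `C_g` and `C_1` -/

/-- The approximation property that defines the class `C_g`: for all finite `F ⊆ A`, `ε, η > 0`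
and nonzero `a ≥ 0` there are a nonzero projection `p` and a C*-subalgebra `C` with unit `p`,
`C ≅ P M_r(C(X)) P ∈ I_d`, satisfying the four displayed conditions. -/
def InClassCg (g : ℕ → ℕ) (A : Type*) [CStarAlgebra A] [PartialOrder A] [StarOrderedRing A] :
    Prop :=
  ∀ (F : Finset A) (ε η : ℝ), 0 < ε → 0 < η → ∀ a : A, 0 ≤ a → a ≠ 0 →
    ∃ (p : A) (C : NonUnitalStarSubalgebra ℂ A) (d : ℕ) (D : HomogeneousData d),
      IsStarProjection p ∧ p ≠ 0 ∧
      IsClosed (C : Set A) ∧ p ∈ C ∧ (∀ c ∈ C, p * c = c ∧ c * p = c) ∧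
      Nonempty (C ≃⋆ₐ[ℂ] D.algebra) ∧
      (∀ f ∈ F, ‖p * f - f * p‖ < ε) ∧
      (∀ f ∈ F, Metric.infDist (p * f * p) (C : Set A) < ε) ∧
      (∀ x : D.X, 0 < D.rankAt x ∧ ((d : ℝ) + 1) / (D.rankAt x : ℝ) < η / ((g d : ℝ) + 1)) ∧
      CuntzLE (1 - p) a

/-- The class `C_1`, i.e. `C_g` for the constant function `g = 1`. -/
def InClassC1 (A : Type*) [CStarAlgebra A] [PartialOrder A] [StarOrderedRing A] : Prop :=
  InClassCg (fun _ => 1) A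

/-! The argument takes place in the semigroup V(A), where cancellation is not available: two classes
agree in K₀ exactly when they agree after adding some class r. The theorem thus reduces to three
facts about V(A), each carrying such an r: `InClassC1.eq_zero_of_add_eq` (the cone is proper),
`InClassC1.exists_decomposition` (Riesz decomposition for nonzero classes) and
`InClassC1.exists_eq_add_of_nsmul` (unperforation).

The topological input is that over a compact Hausdorff space of covering dimension at most d, ranks
decide comparison of bundles up to an error of d + 1. A generic section of a bundle of rank at least
d + 1 vanishes nowhere, so a trivial line splits off. A section that is generic with respect to two
trivial lines at once shows that their complements are isomorphic, so a trivial line can be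
cancelled (`add_unit_cancel`). Adding a complement of the smaller bundle then yields
`exists_eq_add_of_rk_le`, and a suitable choice of ranks yields `exists_decomposition_of_rk`.

The operator algebraic input transfers finitely many classes of V(A) to bundles (`LocalModel`).
Representing projections, together with the partial isometries that witness the additive relations
among them, nearly commute with the unit of a homogeneous subalgebra and are nearly contained in it
after compression. Hence each class is a bundle class pushed into V(A) plus a remainder. Ranks are
stable under small perturbation, so they satisfy the given relations exactly; being integers they
cancel, and r disappears. Simplicity makes every nonzero class an order unit, so the large rank of
the subalgebra's unit, relative to d + 1, passes to all nonzero classes considered.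

The remainders are controlled by 1 - p, which can be made smaller than any prescribed nonzero class.
Before localizing, a nonzero class φ is therefore split off from the given data
(`InClassC1.exists_nsmul_le`); it provides the room in which the one harmful remainder is absorbed.
-/

/-! ### Projections and their classes in V(A) -/

section SemigroupOfProjections

variable {A : Type*} [Ring A] [StarRing A]

theorem IsStarProjection.conjTranspose_eq {m : Type*} [Fintype m] {e : Matrix m m A}
    (he : IsStarProjection e) : e.conjTranspose = e := he.isSelfAdjoint

theorem IsStarProjection.sub_of_mul_eq {R : Type*} [NonUnitalRing R] [StarRing R] {e f : R}
    (he : IsStarProjection e) (hf : IsStarProjection f) (h : f * e = e) :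
    IsStarProjection (f - e) ∧ e * (f - e) = 0 := by
  have hs : star e = e := he.isSelfAdjoint
  have hs' : star f = f := hf.isSelfAdjoint
  have hi : e * e = e := he.isIdempotentElem
  have hi' : f * f = f := hf.isIdempotentElem
  have h' : e * f = e := by simpa [hs, hs'] using congrArg star h
  refine ⟨⟨?_, ?_⟩, ?_⟩
  · change (f - e) * (f - e) = f - e
    rw [mul_sub, sub_mul, sub_mul, hi, hi', h, h']; abel
  · change star (f - e) = f - e
    rw [star_sub, hs, hs']
  · rw [mul_sub, h', hi, sub_self]

theorem IsStarProjection.add_of_mul_eq_zero {R : Type*} [NonUnitalRing R] [StarRing R] {e f : R}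
    (he : IsStarProjection e) (hf : IsStarProjection f) (h : e * f = 0) :
    IsStarProjection (e + f) ∧ f * e = 0 := by
  have hs : star e = e := he.isSelfAdjoint
  have hs' : star f = f := hf.isSelfAdjoint
  have hi : e * e = e := he.isIdempotentElem
  have hi' : f * f = f := hf.isIdempotentElem
  have h' : f * e = 0 := by simpa [hs, hs'] using congrArg star h
  refine ⟨⟨?_, ?_⟩, h'⟩
  · change (e + f) * (e + f) = e + f
    rw [mul_add, add_mul, add_mul, hi, hi', h, h']; abel
  · change star (e + f) = e + f
    rw [star_add, hs, hs']

/-- A projection over an arbitrary finite index type, as an element of `M_∞(A)`. -/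
noncomputable def MatrixProj.ofMatrix {m : Type*} [Fintype m] (e : Matrix m m A)
    (he : IsStarProjection e) : MatrixProj A :=
  ⟨Fintype.card m, Matrix.reindex (Fintype.equivFin m) (Fintype.equivFin m) e,
    he.matrix_reindex _⟩

namespace MvNSemigroup

open Matrix

/-- The class of a projection over an arbitrary finite index type. -/
noncomputable def cl {m : Type*} [Fintype m] (e : Matrix m m A) (he : IsStarProjection e) :
    MvNSemigroup A :=
  mk (MatrixProj.ofMatrix e he)

theorem mk_eq_mk {x y : MatrixProj A} : mk x = mk y ↔ MvNEquiv x.2.1 y.2.1 :=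
  ⟨fun h => Quotient.exact h, fun h => Quotient.sound h⟩

variable {m n : Type*} [Fintype m] [Fintype n]

theorem cl_eq_cl {e : Matrix m m A} {f : Matrix n n A} {he : IsStarProjection e}
    {hf : IsStarProjection f} : cl e he = cl f hf ↔ MvNEquiv e f := by
  have h1 := MvNEquiv.of_reindex he (Fintype.equivFin m)
  have h2 := MvNEquiv.of_reindex hf (Fintype.equivFin n)
  refine mk_eq_mk.trans ⟨fun h => ?_, fun h => ?_⟩
  · exact MvNEquiv.trans he hf h1 (MvNEquiv.trans (he.matrix_reindex _) hf h h2.symm)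
  · exact MvNEquiv.trans (he.matrix_reindex _) (hf.matrix_reindex _) h1.symm
      (MvNEquiv.trans he (hf.matrix_reindex _) h h2)

theorem mk_eq_cl (x : MatrixProj A) : mk x = cl x.2.1 x.2.2 :=
  mk_eq_mk.2 (MvNEquiv.of_reindex x.2.2 _)

theorem cl_fromBlocks {e : Matrix m m A} {f : Matrix n n A} (he : IsStarProjection e)
    (hf : IsStarProjection f) :
    cl (Matrix.fromBlocks e 0 0 f) (he.matrix_fromBlocks hf) = cl e he + cl f hf := by
  unfold cl
  rw [mk_add_mk, mk_eq_mk]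
  have h1 := MvNEquiv.of_reindex he (Fintype.equivFin m)
  have h2 := MvNEquiv.of_reindex hf (Fintype.equivFin n)
  refine MvNEquiv.trans ((he.matrix_fromBlocks hf).matrix_reindex _) (MatrixProj.dsum _ _).2.2
    (MvNEquiv.of_reindex (he.matrix_fromBlocks hf) _).symm ?_
  exact MvNEquiv.trans (he.matrix_fromBlocks hf) (MatrixProj.dsum _ _).2.2
    (MvNEquiv.fromBlocks h1 h2)
    (MatrixProj.dsum_equiv (MatrixProj.ofMatrix e he) (MatrixProj.ofMatrix f hf)).symm

theorem cl_congr {e f : Matrix m m A} (he : IsStarProjection e) (hf : IsStarProjection f)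
    (h : e = f) : cl e he = cl f hf := by
  subst h; rfl

theorem cl_eq_zero_iff {e : Matrix m m A} (he : IsStarProjection e) : cl e he = 0 ↔ e = 0 := by
  have p0 : IsStarProjection (0 : Matrix (Fin 0) (Fin 0) A) :=
    ⟨by simp [IsIdempotentElem], by simp [IsSelfAdjoint]⟩
  have h0 : (0 : MvNSemigroup A) = cl (0 : Matrix (Fin 0) (Fin 0) A) p0 :=
    mk_eq_cl ⟨0, 0, p0⟩
  rw [h0, cl_eq_cl]
  constructor
  · rintro ⟨v, h1, -⟩
    rw [← h1]
    ext i j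
    simp [Matrix.mul_apply]
  · rintro rfl
    exact ⟨0, by simp, by ext i; exact i.elim0⟩

theorem isStarProjection_zero : IsStarProjection (0 : Matrix m m A) :=
  ⟨by simp [IsIdempotentElem], by simp [IsSelfAdjoint]⟩

/-- The row `(e f)` is a partial isometry from the block sum to `e + f`. -/
theorem cl_add {e f : Matrix m m A} (he : IsStarProjection e) (hf : IsStarProjection f)
    (h : e * f = 0) (hef : IsStarProjection (e + f)) :
    cl (e + f) hef = cl e he + cl f hf := by
  rw [← cl_fromBlocks, cl_eq_cl]
  have h' := (IsStarProjection.add_of_mul_eq_zero he hf h).2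
  have hi : e * e = e := he.isIdempotentElem
  have hi' : f * f = f := hf.isIdempotentElem
  refine ⟨Matrix.fromCols e f, ?_, ?_⟩
  · rw [Matrix.conjTranspose_fromCols_eq_fromRows_conjTranspose, Matrix.fromCols_mul_fromRows,
      he.conjTranspose_eq, hf.conjTranspose_eq, hi, hi']
  · rw [Matrix.conjTranspose_fromCols_eq_fromRows_conjTranspose, Matrix.fromRows_mul_fromCols,
      he.conjTranspose_eq, hf.conjTranspose_eq, hi, hi', h, h']

theorem cl_of_mul_eq {e f : Matrix m m A} (he : IsStarProjection e) (hf : IsStarProjection f)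
    (h : f * e = e) : ∃ γ, cl f hf = cl e he + γ := by
  obtain ⟨h1, h2⟩ := IsStarProjection.sub_of_mul_eq he hf h
  refine ⟨cl (f - e) h1, ?_⟩
  rw [← cl_add he h1 h2 (by simpa using hf)]
  exact cl_congr _ _ (by simp)

theorem isStarProjection_conj {v : Matrix m n A} {f g : Matrix n n A} (hg : IsStarProjection g)
    (hv : vᴴ * v = f) (hfg : f * g = g) : IsStarProjection (v * g * vᴴ) := by
  have hi : g * g = g := hg.isIdempotentElem
  refine ⟨?_, ?_⟩
  · change v * g * vᴴ * (v * g * vᴴ) = _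
    calc v * g * vᴴ * (v * g * vᴴ) = v * (g * ((vᴴ * v) * g)) * vᴴ := by
          simp only [Matrix.mul_assoc]
      _ = _ := by rw [hv, hfg, hi]
  · change (v * g * vᴴ)ᴴ = _
    simp [Matrix.conjTranspose_mul, hg.conjTranspose_eq, Matrix.mul_assoc]

theorem cl_conj {v : Matrix m n A} {f g : Matrix n n A} (hg : IsStarProjection g)
    (hv : vᴴ * v = f) (hfg : f * g = g) :
    cl (v * g * vᴴ) (isStarProjection_conj hg hv hfg) = cl g hg := by
  have hi : g * g = g := hg.isIdempotentElem
  rw [cl_eq_cl]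
  refine ⟨v * g, ?_, ?_⟩
  · rw [Matrix.conjTranspose_mul, hg.conjTranspose_eq]
    calc v * g * (g * vᴴ) = v * (g * g) * vᴴ := by simp only [Matrix.mul_assoc]
      _ = _ := by rw [hi]
  · rw [Matrix.conjTranspose_mul, hg.conjTranspose_eq]
    calc g * vᴴ * (v * g) = g * ((vᴴ * v) * g) := by simp only [Matrix.mul_assoc]
      _ = _ := by rw [hv, hfg, hi]

theorem exists_cl_eq (α : MvNSemigroup A) :
    ∃ (n : ℕ) (e : Matrix (Fin n) (Fin n) A) (he : IsStarProjection e), cl e he = α := by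
  induction α using Quotient.inductionOn with | _ x
  exact ⟨x.1, x.2.1, x.2.2, (mk_eq_cl x).symm⟩

/-- A class is represented by a projection of every sufficiently large size. -/
theorem exists_cl_eq_of_le (α : MvNSemigroup A) :
    ∃ n₀ : ℕ, ∀ n, n₀ ≤ n → ∃ (e : Matrix (Fin n) (Fin n) A) (he : IsStarProjection e),
      cl e he = α := by
  obtain ⟨k, e, he, rfl⟩ := exists_cl_eq α
  refine ⟨k, fun n hn => ?_⟩
  obtain ⟨l, rfl⟩ := Nat.exists_eq_add_of_le hn
  have h0 := isStarProjection_zero (A := A) (m := Fin l)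
  refine ⟨Matrix.reindex finSumFinEquiv finSumFinEquiv (Matrix.fromBlocks e 0 0 (0 : Matrix (Fin l) (Fin l) A)),
    (he.matrix_fromBlocks h0).matrix_reindex _, ?_⟩
  have h1 : cl (Matrix.fromBlocks e 0 0 (0 : Matrix (Fin l) (Fin l) A))
      (he.matrix_fromBlocks h0) = cl e he := by
    rw [cl_fromBlocks he h0, (cl_eq_zero_iff h0).2 rfl, add_zero]
  rw [← h1, cl_eq_cl]
  exact (MvNEquiv.of_reindex (he.matrix_fromBlocks h0) _).symm

/-- A decomposition of the class of `e` is induced by a decomposition of `e`. -/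
theorem exists_add_eq_of_cl_eq_add {e : Matrix m m A} (he : IsStarProjection e)
    {α β : MvNSemigroup A} (h : cl e he = α + β) :
    ∃ (e₁ e₂ : Matrix m m A) (h₁ : IsStarProjection e₁) (h₂ : IsStarProjection e₂),
      e₁ + e₂ = e ∧ e₁ * e₂ = 0 ∧ cl e₁ h₁ = α ∧ cl e₂ h₂ = β := by
  obtain ⟨k, a, ha, rfl⟩ := exists_cl_eq α
  obtain ⟨l, b, hb, rfl⟩ := exists_cl_eq β
  rw [← cl_fromBlocks, cl_eq_cl] at h
  obtain ⟨v, h1, h2⟩ := h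
  have hia : a * a = a := ha.isIdempotentElem
  have hib : b * b = b := hb.isIdempotentElem
  have hie : e * e = e := he.isIdempotentElem
  have z1 := isStarProjection_zero (A := A) (m := Fin k)
  have z2 := isStarProjection_zero (A := A) (m := Fin l)
  have pa := ha.matrix_fromBlocks z2
  have pb := z1.matrix_fromBlocks hb
  have ga : Matrix.fromBlocks a 0 0 b * Matrix.fromBlocks a 0 0 0 = Matrix.fromBlocks a 0 0 0 := by
    simp [Matrix.fromBlocks_multiply, hia]
  have gb : Matrix.fromBlocks a 0 0 b * Matrix.fromBlocks 0 0 0 b = Matrix.fromBlocks 0 0 0 b := by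
    simp [Matrix.fromBlocks_multiply, hib]
  obtain ⟨a', ha'⟩ : ∃ a' : Matrix (Fin k ⊕ Fin l) (Fin k ⊕ Fin l) A,
    a' = Matrix.fromBlocks a 0 0 0 := ⟨_, rfl⟩
  obtain ⟨b', hb'⟩ : ∃ b' : Matrix (Fin k ⊕ Fin l) (Fin k ⊕ Fin l) A,
    b' = Matrix.fromBlocks 0 0 0 b := ⟨_, rfl⟩
  have ea : cl a' (ha' ▸ pa) = cl a ha := by
    subst ha'
    rw [cl_fromBlocks ha z2, (cl_eq_zero_iff z2).2 rfl, add_zero]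
  have eb : cl b' (hb' ▸ pb) = cl b hb := by
    subst hb'
    rw [cl_fromBlocks z1 hb, (cl_eq_zero_iff z1).2 rfl, zero_add]
  have hab : a' + b' = vᴴ * v := by rw [h2, ha', hb', Matrix.fromBlocks_add]; simp
  have hab' : a' * b' = 0 := by rw [ha', hb']; simp [Matrix.fromBlocks_multiply]
  rw [← ha'] at pa ga
  rw [← hb'] at pb gb
  refine ⟨v * a' * vᴴ, v * b' * vᴴ,
    isStarProjection_conj pa h2 ga, isStarProjection_conj pb h2 gb, ?_, ?_, ?_, ?_⟩
  · rw [← Matrix.add_mul, ← Matrix.mul_add, hab]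
    calc v * (vᴴ * v) * vᴴ = (v * vᴴ) * (v * vᴴ) := by simp only [Matrix.mul_assoc]
      _ = e := by rw [h1, hie]
  · calc v * a' * vᴴ * (v * b' * vᴴ) = v * (a' * ((vᴴ * v) * b')) * vᴴ := by
          simp only [Matrix.mul_assoc]
      _ = 0 := by rw [h2, gb, hab']; simp
  · rw [cl_conj pa h2 ga, ea]
  · rw [cl_conj pb h2 gb, eb]

theorem eq_zero_of_add_eq_zero {α β : MvNSemigroup A} (h : α + β = 0) : α = 0 := by
  have z := isStarProjection_zero (A := A) (m := Fin 0)
  obtain ⟨e₁, e₂, h₁, h₂, -, -, rfl, -⟩ :=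
    exists_add_eq_of_cl_eq_add z (((cl_eq_zero_iff z).2 rfl).trans h.symm)
  rw [cl_eq_zero_iff]
  ext i; exact i.elim0

end MvNSemigroup

end SemigroupOfProjections

/-! ### General position in a finite-dimensional space -/

section Generic

open Module Submodule

/-- A finite family in a finite-dimensional space can be perturbed to general position. -/
theorem exists_perturb_linearIndepOn {V : Type*} [NormedAddCommGroup V] [NormedSpace ℂ V]
    [FiniteDimensional ℂ V] {m : ℕ} (hm : m ≤ finrank ℂ V) {I : Type*} [Finite I]
    (y : I → V) {ε : ℝ} (hε : 0 < ε) :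
    ∃ y' : I → V, (∀ i, ‖y' i - y i‖ < ε) ∧
      ∀ s : Finset I, s.card ≤ m → LinearIndepOn ℂ y' (s : Set I) := by
  classical
  cases nonempty_fintype I
  suffices H : ∀ t : Finset I, ∃ y' : I → V, (∀ i, ‖y' i - y i‖ < ε) ∧
      ∀ s : Finset I, s ⊆ t → s.card ≤ m → LinearIndepOn ℂ y' (s : Set I) by
    obtain ⟨y', h1, h2⟩ := H Finset.univ
    exact ⟨y', h1, fun s => h2 s (Finset.subset_univ s)⟩
  intro t
  induction t using Finset.induction_on with
  | empty =>
    refine ⟨y, fun i => by simpa using hε, fun s hs _ => ?_⟩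
    obtain rfl := Finset.subset_empty.1 hs
    simp
  | insert a t ha ih =>
    obtain ⟨y', h1, h2⟩ := ih
    -- The new vector has to avoid every span of fewer than m of the vectors already treated. Since
    -- m is at most the dimension, these are finitely many proper closed subspaces, and the
    -- intersection of their complements is dense.
    have hd : Dense (⋂ s ∈ {s : Finset I | s.card < m},
        ((span ℂ (y' '' (s : Set I)) : Submodule ℂ V) : Set V)ᶜ) := by
      refine dense_biInter_of_isOpen (fun s _ => ?_) (Set.to_countable _) (fun s hs => ?_)
      · exact (Submodule.closed_of_finiteDimensional _).isOpen_compl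
      · rw [← interior_eq_empty_iff_dense_compl]
        by_contra hne
        have htop := Submodule.eq_top_of_nonempty_interior' _ (Set.nonempty_iff_ne_empty.2 hne)
        have h3 : finrank ℂ (span ℂ (y' '' (s : Set I))) ≤ s.card := by
          rw [← Finset.coe_image]
          exact (finrank_span_finset_le_card _).trans Finset.card_image_le
        rw [htop, finrank_top] at h3
        have : s.card < m := hs
        omega
    obtain ⟨z, hz1, hz2⟩ := hd.exists_dist_lt (y a) hε
    refine ⟨Function.update y' a z, fun i => ?_, fun s hs hsm => ?_⟩
    · by_cases h : i = a
      · subst h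
        rw [Function.update_self, ← dist_eq_norm, dist_comm]
        exact hz2
      · rw [Function.update_of_ne h]
        exact h1 i
    · have hcongr : ∀ s' : Finset I, a ∉ s' →
          Set.EqOn (Function.update y' a z) y' (s' : Set I) := fun s' h i hi =>
        Function.update_of_ne (fun e => h (by rw [← e]; exact hi)) _ _
      by_cases has : a ∈ s
      · have hs' : s.erase a ⊆ t := by
          intro i hi
          rw [Finset.mem_erase] at hi
          exact (Finset.mem_insert.1 (hs hi.2)).resolve_left hi.1
        have hcard : (s.erase a).card < m := by
          rw [Finset.card_erase_of_mem has]
          have := Finset.card_pos.2 ⟨a, has⟩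
          omega
        have hni : a ∉ s.erase a := Finset.notMem_erase a s
        have hli := h2 _ hs' hcard.le
        rw [← linearIndepOn_congr (hcongr _ hni)] at hli
        rw [← Finset.insert_erase has, Finset.coe_insert]
        refine hli.insert ?_
        rw [Set.image_congr (hcongr _ hni), Function.update_self]
        have := Set.mem_iInter₂.1 hz1 (s.erase a) hcard
        exact this
      · rw [linearIndepOn_congr (hcongr _ has)]
        refine h2 s (fun i hi => ?_) hsm
        exact (Finset.mem_insert.1 (hs hi)).resolve_left (fun e => has (e ▸ hi))

end Generic

/-! ### Pointwise evaluation and rank functions over C(X) -/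

section Eval

open Matrix

variable {X : Type*} [TopologicalSpace X]

/-- Evaluation at a point of a matrix of continuous functions. -/
noncomputable def evalMatrix {m n : Type*} (x : X) (F : Matrix m n C(X, ℂ)) : Matrix m n ℂ :=
  F.map (fun f => f x)

variable {k m n : Type*}

theorem evalMatrix_mul [Fintype m] (x : X) (F : Matrix k m C(X, ℂ)) (G : Matrix m n C(X, ℂ)) :
    evalMatrix x (F * G) = evalMatrix x F * evalMatrix x G := by
  ext i j
  simp [evalMatrix, Matrix.mul_apply]

theorem evalMatrix_conjTranspose (x : X) (F : Matrix m n C(X, ℂ)) :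
    evalMatrix x Fᴴ = (evalMatrix x F)ᴴ := by
  ext i j
  simp [evalMatrix]

theorem evalMatrix_add (x : X) (F G : Matrix m n C(X, ℂ)) :
    evalMatrix x (F + G) = evalMatrix x F + evalMatrix x G := by
  ext i j
  simp [evalMatrix]

theorem evalMatrix_one [DecidableEq n] (x : X) :
    evalMatrix x (1 : Matrix n n C(X, ℂ)) = 1 := by
  ext i j
  by_cases h : i = j
  · subst h; simp [evalMatrix]
  · simp [evalMatrix, h]

theorem continuous_evalMatrix (F : Matrix m n C(X, ℂ)) : Continuous fun x => evalMatrix x F :=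
  continuous_matrix fun i j => (F i j).continuous

variable [Fintype m] [Fintype n]

theorem IsStarProjection.evalMatrix {F : Matrix n n C(X, ℂ)} (hF : IsStarProjection F) (x : X) :
    IsStarProjection (evalMatrix x F) := by
  have hi : F * F = F := hF.isIdempotentElem
  refine ⟨?_, ?_⟩
  · change _root_.evalMatrix x F * _root_.evalMatrix x F = _
    rw [← evalMatrix_mul, hi]
  · change (_root_.evalMatrix x F)ᴴ = _
    rw [← evalMatrix_conjTranspose, hF.conjTranspose_eq]

theorem trace_eq_rank_of_isIdempotentElem {e : Matrix n n ℂ} (he : e * e = e) :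
    e.trace = e.rank := by
  classical
  have h : IsIdempotentElem (Matrix.toLin' e) := by
    change Matrix.toLin' e * Matrix.toLin' e = _
    rw [Module.End.mul_eq_comp, ← Matrix.toLin'_mul, he]
  have h2 := (LinearMap.IsIdempotentElem.isProj_range _ h).trace
  rw [Matrix.trace_toLin'_eq] at h2
  rw [h2]
  rfl

/-- The rank of a projection is its trace, which depends continuously on the point and takes integer
values. -/
theorem isLocallyConstant_rank {F : Matrix n n C(X, ℂ)} (hF : IsStarProjection F) :
    IsLocallyConstant fun x => (evalMatrix x F).rank := by
  rw [IsLocallyConstant.iff_continuous]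
  have h : Continuous fun x => (((evalMatrix x F).rank : ℕ) : ℝ) := by
    have h1 : (fun x => (((evalMatrix x F).rank : ℕ) : ℝ)) =
        fun x => (evalMatrix x F).trace.re := by
      ext x
      rw [trace_eq_rank_of_isIdempotentElem (hF.evalMatrix x).isIdempotentElem]
      simp
    rw [h1]
    exact Complex.continuous_re.comp (continuous_evalMatrix F).matrix_trace
  exact Nat.isClosedEmbedding_coe_real.isInducing.continuous_iff.2 h

open scoped ComplexOrder in
theorem MvNEquiv.rank_eq {F : Matrix m m C(X, ℂ)} {G : Matrix n n C(X, ℂ)}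
    (h : MvNEquiv F G) (x : X) : (evalMatrix x F).rank = (evalMatrix x G).rank := by
  obtain ⟨v, rfl, rfl⟩ := h
  rw [evalMatrix_mul, evalMatrix_mul, evalMatrix_conjTranspose, Matrix.rank_self_mul_conjTranspose,
    Matrix.rank_conjTranspose_mul_self]

theorem rank_fromBlocks {F : Matrix m m C(X, ℂ)} {G : Matrix n n C(X, ℂ)}
    (hF : IsStarProjection F) (hG : IsStarProjection G) (x : X) :
    (evalMatrix x (Matrix.fromBlocks F 0 0 G)).rank =
      (evalMatrix x F).rank + (evalMatrix x G).rank := by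
  have h1 := trace_eq_rank_of_isIdempotentElem
    ((hF.matrix_fromBlocks hG).evalMatrix x).isIdempotentElem
  have h2 := trace_eq_rank_of_isIdempotentElem (hF.evalMatrix x).isIdempotentElem
  have h3 := trace_eq_rank_of_isIdempotentElem (hG.evalMatrix x).isIdempotentElem
  have h4 : (evalMatrix x (Matrix.fromBlocks F 0 0 G)).trace =
      (evalMatrix x F).trace + (evalMatrix x G).trace := by
    simp [Matrix.trace, evalMatrix]
  rw [h1, h2, h3] at h4
  exact_mod_cast h4

namespace MvNSemigroup

/-- The rank function of a class of projections over `C(X)`. -/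
noncomputable def rk : MvNSemigroup C(X, ℂ) →+ (X → ℕ) where
  toFun := Quotient.lift (fun p : MatrixProj C(X, ℂ) => fun x => (evalMatrix x p.2.1).rank)
    (fun _ _ h => funext fun x => MvNEquiv.rank_eq h x)
  map_zero' := by
    change (fun x => (evalMatrix x (0 : Matrix (Fin 0) (Fin 0) C(X, ℂ))).rank) = 0
    ext x
    exact Nat.le_zero.1 ((Matrix.rank_le_card_width _).trans (by simp))
  map_add' a b := by
    induction a using Quotient.inductionOn with | _ a
    induction b using Quotient.inductionOn with | _ b
    ext x
    change (evalMatrix x (a.dsum b).2.1).rank = _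
    rw [(a.dsum_equiv b).rank_eq, rank_fromBlocks a.2.2 b.2.2]
    rfl

theorem rk_cl {F : Matrix n n C(X, ℂ)} (hF : IsStarProjection F) (x : X) :
    rk (cl F hF) x = (evalMatrix x F).rank :=
  ((MvNEquiv.of_reindex hF (Fintype.equivFin n)).rank_eq x).symm

theorem isLocallyConstant_rk (α : MvNSemigroup C(X, ℂ)) : IsLocallyConstant (rk α) := by
  obtain ⟨n, F, hF, rfl⟩ := exists_cl_eq α
  rw [show rk (cl F hF) = fun x => (evalMatrix x F).rank from funext (rk_cl hF)]
  exact isLocallyConstant_rank hF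

end MvNSemigroup

end Eval

/-! ### Nowhere vanishing sections -/

section Sections

open Matrix Topology

variable {X : Type*} [TopologicalSpace X] {n : Type*} [Fintype n]

/-- `s` is a section of the vector bundle that is the range of the projection `F`. -/
def IsSectionOf (F : Matrix n n C(X, ℂ)) (s : C(X, n → ℂ)) : Prop :=
  ∀ x, evalMatrix x F *ᵥ s x = s x

theorem exists_norm_evalMatrix_mulVec_le [CompactSpace X] (F : Matrix n n C(X, ℂ)) :
    ∃ M : ℝ, 0 < M ∧ ∀ (x : X) (v : n → ℂ), ‖evalMatrix x F *ᵥ v‖ ≤ M * ‖v‖ := by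
  refine ⟨1 + ∑ i, ∑ j, ‖F i j‖, by positivity, fun x v => ?_⟩
  rw [pi_norm_le_iff_of_nonneg (by positivity)]
  intro i
  calc ‖(evalMatrix x F *ᵥ v) i‖ ≤ ∑ j, ‖evalMatrix x F i j * v j‖ := norm_sum_le _ _
    _ ≤ ∑ j, ‖F i j‖ * ‖v‖ := by
        refine Finset.sum_le_sum fun j _ => ?_
        rw [norm_mul]
        exact mul_le_mul ((F i j).norm_coe_le_norm x) (norm_le_pi_norm v j) (norm_nonneg _)
          (norm_nonneg _)
    _ = (∑ j, ‖F i j‖) * ‖v‖ := by rw [Finset.sum_mul]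
    _ ≤ (1 + ∑ i, ∑ j, ‖F i j‖) * ‖v‖ := by
        refine mul_le_mul_of_nonneg_right ?_ (norm_nonneg _)
        have := Finset.single_le_sum (f := fun i => ∑ j, ‖F i j‖)
          (fun i _ => Finset.sum_nonneg fun j _ => norm_nonneg _) (Finset.mem_univ i)
        linarith

/-- Near a point, sections of a bundle of rank greater than the covering dimension can be
perturbed to be nonvanishing. -/
theorem exists_perturb_ne_zero_nhds [CompactSpace X] [T2Space X] {d : ℕ}
    (hX : CoveringDimLE X d) {F : Matrix n n C(X, ℂ)} (hF : IsStarProjection F) (x₀ : X)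
    (hr : d + 1 ≤ (evalMatrix x₀ F).rank) :
    ∃ W ∈ 𝓝 x₀, IsClosed W ∧ ∀ s : C(X, n → ℂ), IsSectionOf F s → ∀ ε > 0,
      ∃ s' : C(X, n → ℂ), IsSectionOf F s' ∧ (∀ x, ‖s' x - s x‖ ≤ ε) ∧ ∀ x ∈ W, s' x ≠ 0 := by
  classical
  set F₀ := evalMatrix x₀ F with hF₀
  have hi₀ : F₀ * F₀ = F₀ := (hF.evalMatrix x₀).isIdempotentElem
  have hi : ∀ x, evalMatrix x F * evalMatrix x F = evalMatrix x F :=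
    fun x => (hF.evalMatrix x).isIdempotentElem
  have hFc := continuous_evalMatrix F
  -- The usual intertwiner of two nearby projections: it satisfies F(x) Z(x) = F(x) F₀ = Z(x) F₀ and
  -- is 1 at x₀, so near x₀ it is invertible and F(x) maps the fibre V₀ bijectively onto the fibre
  -- at x. The neighbourhood W is fixed before the section and ε, so that finitely many such
  -- neighbourhoods can be treated in succession.
  let Z : X → Matrix n n ℂ := fun x => evalMatrix x F * F₀ + (1 - evalMatrix x F) * (1 - F₀)
  have hZ : Continuous fun x => (Z x).det := by
    refine Continuous.matrix_det ?_
    exact (hFc.matrix_mul continuous_const).add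
      ((continuous_const.sub hFc).matrix_mul continuous_const)
  have hZ₀ : (Z x₀).det ≠ 0 := by
    have : Z x₀ = 1 := by
      change F₀ * F₀ + (1 - F₀) * (1 - F₀) = 1
      rw [mul_sub, sub_mul, sub_mul, hi₀]; simp
    rw [this, Matrix.det_one]; exact one_ne_zero
  obtain ⟨W, hW, hWc, hWZ⟩ := exists_mem_nhds_isClosed_subset
    ((isOpen_ne.preimage hZ).mem_nhds hZ₀)
  refine ⟨W, hW, hWc, fun s hs ε hε => ?_⟩
  have hFZ : ∀ x, evalMatrix x F * Z x = evalMatrix x F * F₀ := fun x => by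
    change _ * (_ + _) = _
    rw [mul_add, ← mul_assoc, ← mul_assoc, mul_sub (evalMatrix x F) 1, hi]; simp
  have hZF : ∀ x, Z x * F₀ = evalMatrix x F * F₀ := fun x => by
    change (_ + _) * _ = _
    rw [add_mul, mul_assoc, mul_assoc, sub_mul 1 F₀, hi₀]; simp
  let V₀ : Submodule ℂ (n → ℂ) := LinearMap.range F₀.mulVecLin
  have hV₀ : ∀ v : V₀, F₀ *ᵥ v.1 = v.1 := by
    rintro ⟨_, v, rfl⟩
    simp [hi₀]
  have hinj : ∀ x ∈ W, ∀ v : V₀, evalMatrix x F *ᵥ v.1 = 0 → v = 0 := by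
    intro x hx v hv
    have h1 : Z x *ᵥ v.1 = 0 := by
      rw [← hV₀ v, Matrix.mulVec_mulVec, hZF, ← Matrix.mulVec_mulVec, hV₀, hv]
    exact Subtype.ext (Matrix.eq_zero_of_mulVec_eq_zero (hWZ hx) h1)
  have hsurj : ∀ x ∈ W, ∃ v : V₀, evalMatrix x F *ᵥ v.1 = s x := by
    intro x hx
    refine ⟨⟨F₀ *ᵥ ((Z x)⁻¹ *ᵥ s x), ⟨_, rfl⟩⟩, ?_⟩
    change evalMatrix x F *ᵥ (F₀ *ᵥ ((Z x)⁻¹ *ᵥ s x)) = s x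
    rw [Matrix.mulVec_mulVec, ← hFZ, ← Matrix.mulVec_mulVec, Matrix.mulVec_mulVec _ (Z x),
      Matrix.mul_nonsing_inv _ (isUnit_iff_ne_zero.2 (hWZ hx)), Matrix.one_mulVec, hs]
  have hcont : ∀ v : n → ℂ, Continuous fun x => evalMatrix x F *ᵥ v :=
    fun v => hFc.matrix_mulVec continuous_const
  choose! y hy using hsurj
  let U : X → Set X := fun x => {z | ‖evalMatrix z F *ᵥ (y x).1 - s z‖ < ε / 2}
  have hUo : ∀ x, IsOpen (U x) := fun x =>
    isOpen_lt ((hcont _).sub s.continuous).norm continuous_const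
  have hU : ∀ x ∈ W, x ∈ U x := fun x hx => by
    change ‖_‖ < _
    rw [hy x hx, sub_self, norm_zero]; linarith
  obtain ⟨t, ht⟩ := hWc.isCompact.elim_nhds_subcover' (fun x _ => U x)
    (fun x hx => (hUo x).mem_nhds (hU x hx))
  -- Adding the complement of W gives a finite cover of all of X. Refining sets that are only known
  -- to lie in this complement carry no nonvanishing requirement.
  obtain ⟨𝒱, h𝒱o, h𝒱c, h𝒱r, h𝒱d⟩ := hX (insert Wᶜ ((fun x : W => U x) '' (t : Set W)))
    ((t.finite_toSet.image _).insert _) (by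
      rintro _ (rfl | ⟨x, -, rfl⟩)
      · exact hWc.isOpen_compl
      · exact hUo _) (by
      refine Set.eq_univ_of_forall fun x => ?_
      by_cases hx : x ∈ W
      · obtain ⟨z, hz, hxz⟩ := Set.mem_iUnion₂.1 (ht hx)
        exact ⟨U z, Or.inr ⟨z, hz, rfl⟩, hxz⟩
      · exact ⟨Wᶜ, Or.inl rfl, hx⟩)
  obtain ⟨𝒲, h𝒲s, h𝒲f, h𝒲c⟩ := isCompact_univ.elim_finite_subcover_image (b := 𝒱) (c := id)
    (fun V hV => h𝒱o V hV) (by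
      rw [← h𝒱c, Set.sUnion_eq_biUnion]; exact subset_rfl)
  have : Finite 𝒲 := h𝒲f
  cases nonempty_fintype 𝒲
  obtain ⟨h, hh⟩ := PartitionOfUnity.exists_isSubordinate isClosed_univ
    (fun V : 𝒲 => (V : Set X)) (fun V => h𝒱o V (h𝒲s V.2)) (by
      intro x hx
      obtain ⟨V, hV, hxV⟩ := Set.mem_iUnion₂.1 (h𝒲c hx)
      exact Set.mem_iUnion.2 ⟨⟨V, hV⟩, hxV⟩)
  have hmem : ∀ (V : 𝒲) (x : X), h V x ≠ 0 → x ∈ (V : Set X) := fun V x hx =>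
    hh V (subset_tsupport _ hx)
  have hsum : ∀ x, ∑ V, h V x = 1 := fun x => by
    rw [← finsum_eq_sum_of_fintype]
    exact h.sum_eq_one (Set.mem_univ x)
  let good : 𝒲 → Prop := fun V => ∃ x : W, x ∈ t ∧ (V : Set X) ⊆ U x
  have hbad : ∀ V : 𝒲, ¬ good V → (V : Set X) ⊆ Wᶜ := by
    intro V hV
    obtain ⟨u, hu, hVu⟩ := h𝒱r V (h𝒲s V.2)
    rcases hu with rfl | ⟨x, hx, rfl⟩
    · exact hVu
    · exact absurd ⟨x, hx, hVu⟩ hV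
  have hpt : ∀ V : 𝒲, ∃ v : V₀, good V → ∀ z ∈ (V : Set X),
      ‖evalMatrix z F *ᵥ v.1 - s z‖ < ε / 2 := by
    intro V
    by_cases hV : good V
    · obtain ⟨x, -, hVx⟩ := hV
      exact ⟨y x, fun _ z hz => hVx hz⟩
    · exact ⟨0, fun h => absurd h hV⟩
  choose p hp using hpt
  obtain ⟨M, hM, hMF⟩ := exists_norm_evalMatrix_mulVec_le F
  -- At each point at most d + 1 members of the partition of unity are nonzero, so any d + 1 of the
  -- approximating vectors should be independent in V₀. A combination of independent vectors with
  -- weights summing to 1 cannot vanish. Division by M compensates for the norm of F(x).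
  obtain ⟨q, hq1, hq2⟩ := exists_perturb_linearIndepOn (V := V₀) (m := d + 1) hr p
    (ε := ε / 2 / M) (by positivity)
  -- On the members that miss W the original section is kept, so that s' stays close to s on all of
  -- X.
  let s' : C(X, n → ℂ) := ⟨fun x => ∑ V, ((h V x : ℝ) : ℂ) •
      (if good V then evalMatrix x F *ᵥ (q V).1 else s x), by
    refine continuous_finsetSum _ fun V _ => ?_
    refine (Complex.continuous_ofReal.comp (h V).continuous).smul ?_
    split_ifs
    · exact hcont _
    · exact s.continuous⟩
  have hs'a : ∀ x, s' x = ∑ V, ((h V x : ℝ) : ℂ) •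
      (if good V then evalMatrix x F *ᵥ (q V).1 else s x) := fun x => rfl
  refine ⟨s', fun x => ?_, fun x => ?_, fun x hx h0 => ?_⟩
  · rw [hs'a, Matrix.mulVec_sum]
    refine Finset.sum_congr rfl fun V _ => ?_
    rw [Matrix.mulVec_smul]
    split_ifs
    · rw [Matrix.mulVec_mulVec, hi]
    · rw [hs]
  · have e1 : s' x - s x = ∑ V, ((h V x : ℝ) : ℂ) •
        ((if good V then evalMatrix x F *ᵥ (q V).1 else s x) - s x) := by
      simp only [smul_sub, Finset.sum_sub_distrib, ← Finset.sum_smul, hs'a]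
      rw [← Complex.ofReal_sum, hsum]; simp
    rw [e1]
    calc ‖∑ V, ((h V x : ℝ) : ℂ) •
          ((if good V then evalMatrix x F *ᵥ (q V).1 else s x) - s x)‖
        ≤ ∑ V, h V x * ε := by
          refine (norm_sum_le _ _).trans (Finset.sum_le_sum fun V _ => ?_)
          rw [norm_smul, Complex.norm_real, Real.norm_of_nonneg (h.nonneg V x)]
          by_cases hV : h V x = 0
          · simp [hV]
          refine mul_le_mul_of_nonneg_left ?_ (h.nonneg V x)
          split_ifs with hg
          · have e2 : evalMatrix x F *ᵥ (q V).1 - s x =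
                evalMatrix x F *ᵥ (q V - p V : V₀).1 +
                  (evalMatrix x F *ᵥ (p V).1 - s x) := by
              rw [Submodule.coe_sub, Matrix.mulVec_sub]; abel
            rw [e2]
            have e3 := hp V hg x (hmem V x hV)
            have e4 := hMF x (q V - p V : V₀).1
            have e5 : ‖(q V - p V : V₀).1‖ < ε / 2 / M := hq1 V
            have e6 : M * ‖(q V - p V : V₀).1‖ ≤ ε / 2 := by
              have := mul_le_mul_of_nonneg_left e5.le hM.le
              rwa [mul_div_cancel₀ _ hM.ne'] at this
            have := norm_add_le (evalMatrix x F *ᵥ (q V - p V : V₀).1)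
              (evalMatrix x F *ᵥ (p V).1 - s x)
            linarith
          · simpa using hε.le
      _ = ε := by rw [← Finset.sum_mul, hsum, one_mul]
  · have hgood : ∀ V : 𝒲, h V x ≠ 0 → good V := by
      intro V hV
      by_contra hg
      exact hbad V hg (hmem V x hV) hx
    have e1 : s' x = evalMatrix x F *ᵥ (∑ V, ((h V x : ℝ) : ℂ) • q V : V₀).1 := by
      rw [hs'a, Submodule.coe_sum, Matrix.mulVec_sum]
      refine Finset.sum_congr rfl fun V _ => ?_
      rw [Submodule.coe_smul, Matrix.mulVec_smul]
      by_cases hV : h V x = 0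
      · simp [hV]
      · rw [if_pos (hgood V hV)]
    rw [e1] at h0
    have e2 := hinj x hx _ h0
    let S : Finset 𝒲 := Finset.univ.filter fun V => h V x ≠ 0
    have hS : S.card ≤ d + 1 := by
      have h3 : ((S.map ⟨Subtype.val, Subtype.val_injective⟩ : Finset (Set X)) : Set (Set X)) ⊆
          {V ∈ 𝒱 | x ∈ V} := by
        intro V hV
        simp only [Finset.coe_map, Set.mem_image, Finset.mem_coe] at hV
        obtain ⟨V, hV, rfl⟩ := hV
        exact ⟨h𝒲s V.2, hmem V x (Finset.mem_filter.1 hV).2⟩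
      have h4 := (Set.encard_le_encard h3).trans (h𝒱d x)
      rw [Set.encard_coe_eq_coe_finsetCard, Finset.card_map] at h4
      exact_mod_cast h4
    have hli := hq2 S hS
    have e3 : ∑ V ∈ S, ((h V x : ℝ) : ℂ) • q V = 0 := by
      rw [← e2]
      refine Finset.sum_subset (Finset.subset_univ _) fun V _ hV => ?_
      have : h V x = 0 := by simpa [S] using hV
      simp [this]
    have e4 := linearIndepOn_finset_iff.1 hli _ e3
    have e5 : ∀ V, h V x = 0 := by
      intro V
      by_contra hV
      have := e4 V (by simp [S, hV])
      exact hV (by exact_mod_cast this)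
    have := hsum x
    simp [e5] at this

/-- Nonvanishing sections of a bundle of rank greater than the covering dimension are dense. -/
theorem exists_perturb_ne_zero [CompactSpace X] [T2Space X] {d : ℕ}
    (hX : CoveringDimLE X d) {F : Matrix n n C(X, ℂ)} (hF : IsStarProjection F)
    (hr : ∀ x, d + 1 ≤ (evalMatrix x F).rank) (s : C(X, n → ℂ)) (hs : IsSectionOf F s)
    {ε : ℝ} (hε : 0 < ε) :
    ∃ s' : C(X, n → ℂ), IsSectionOf F s' ∧ (∀ x, ‖s' x - s x‖ ≤ ε) ∧ ∀ x, s' x ≠ 0 := by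
  classical
  choose W hW hWc hWp using fun x => exists_perturb_ne_zero_nhds hX hF x (hr x)
  obtain ⟨t, -, ht⟩ := isCompact_univ.elim_nhds_subcover W (fun x _ => hW x)
  suffices H : ∀ t : Finset X, ∃ s' : C(X, n → ℂ), IsSectionOf F s' ∧ (∀ x, ‖s' x - s x‖ ≤ ε) ∧
      ∀ x ∈ ⋃ i ∈ t, W i, s' x ≠ 0 by
    obtain ⟨s', h1, h2, h3⟩ := H t
    exact ⟨s', h1, h2, fun x => h3 x (ht (Set.mem_univ x))⟩
  clear ht t
  intro t
  induction t using Finset.induction_on generalizing ε with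
  | empty => exact ⟨s, hs, fun x => by simpa using hε.le, fun x hx => by simp at hx⟩
  | insert a t ha ih =>
    obtain ⟨s₁, h1, h2, h3⟩ := ih (half_pos hε)
    have hc : IsCompact (⋃ i ∈ t, W i) := t.isCompact_biUnion fun i _ => (hWc i).isCompact
    obtain ⟨δ, hδ, hδs⟩ : ∃ δ > 0, ∀ x ∈ ⋃ i ∈ t, W i, δ ≤ ‖s₁ x‖ := by
      rcases (⋃ i ∈ t, W i).eq_empty_or_nonempty with he | hne
      · exact ⟨1, one_pos, fun x hx => by rw [he] at hx; exact absurd hx (Set.notMem_empty x)⟩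
      · obtain ⟨z, hz, hzm⟩ := hc.exists_isMinOn hne s₁.continuous.norm.continuousOn
        exact ⟨‖s₁ z‖, norm_pos_iff.2 (h3 z hz), fun x hx => hzm hx⟩
    -- On the compact set already treated the section has norm at least δ; moving it by at most δ/2
    -- does not create zeros there.
    obtain ⟨s₂, h4, h5, h6⟩ := hWp a s₁ h1 (min (ε / 2) (δ / 2)) (by positivity)
    refine ⟨s₂, h4, fun x => ?_, fun x hx => ?_⟩
    · have := norm_add_le (s₂ x - s₁ x) (s₁ x - s x)
      rw [sub_add_sub_cancel] at this
      have := h5 x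
      have := h2 x
      have := min_le_left (ε / 2) (δ / 2)
      linarith
    · rw [Finset.set_biUnion_insert] at hx
      rcases hx with hx | hx
      · exact h6 x hx
      · intro h0
        have e1 := h5 x
        rw [h0, zero_sub, norm_neg] at e1
        have := hδs x hx
        have := min_le_right (ε / 2) (δ / 2)
        linarith

end Sections

/-! ### The class of the unit and the splitting off of trivial lines -/

section UnitClass

open Matrix

namespace MvNSemigroup

variable {A : Type*} [Ring A] [StarRing A] {m : Type*} [Fintype m]

/-- The class of the unit of `A`. -/
noncomputable def unit (A : Type*) [Ring A] [StarRing A] : MvNSemigroup A :=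
  cl (1 : Matrix (Fin 1) (Fin 1) A) (.one _)

theorem cl_one (n : ℕ) :
    cl (1 : Matrix (Fin n) (Fin n) A) (.one _) = n • unit A := by
  induction n with
  | zero =>
    rw [zero_smul, cl_eq_zero_iff]
    ext i; exact i.elim0
  | succ n ih =>
    rw [succ_nsmul, ← ih, unit, ← cl_fromBlocks, cl_eq_cl]
    have h := MvNEquiv.of_reindex
      (IsStarProjection.matrix_fromBlocks (A := A) (m := Fin n) (n := Fin 1) (.one _) (.one _))
      finSumFinEquiv
    have e : Matrix.reindex finSumFinEquiv finSumFinEquiv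
        (Matrix.fromBlocks (1 : Matrix (Fin n) (Fin n) A) 0 0 (1 : Matrix (Fin 1) (Fin 1) A)) =
        1 := by
      rw [Matrix.fromBlocks_one]; simp
    rw [e] at h
    exact h.symm

theorem unit_split {E : Matrix m m A} (hE : IsStarProjection E) {v : Matrix m (Fin 1) A}
    (hv : vᴴ * v = 1) (hEv : E * v = v) :
    ∃ h : IsStarProjection (E - v * vᴴ), cl E hE = cl (E - v * vᴴ) h + unit A := by
  have hp : IsStarProjection (v * vᴴ) := by
    have := isStarProjection_conj (v := v) (f := 1) (g := 1) (.one _) hv (mul_one 1)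
    rwa [Matrix.mul_one] at this
  have hcl : cl (v * vᴴ) hp = unit A := by
    rw [unit, cl_eq_cl]
    exact ⟨v, rfl, hv⟩
  have h1 : E * (v * vᴴ) = v * vᴴ := by rw [← Matrix.mul_assoc, hEv]
  obtain ⟨h2, h3⟩ := IsStarProjection.sub_of_mul_eq hp hE h1
  refine ⟨h2, ?_⟩
  rw [← hcl, add_comm, ← cl_add hp h2 h3 (by simpa using hE)]
  exact cl_congr _ _ (by simp)

theorem exists_of_cl_eq_add_unit {E : Matrix m m A} (hE : IsStarProjection E)
    {α : MvNSemigroup A} (h : cl E hE = α + unit A) :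
    ∃ v : Matrix m (Fin 1) A, vᴴ * v = 1 ∧ E * v = v ∧
      ∃ h : IsStarProjection (E - v * vᴴ), cl (E - v * vᴴ) h = α := by
  obtain ⟨e₁, e₂, h₁, h₂, h3, h4, h5, h6⟩ := exists_add_eq_of_cl_eq_add hE h
  rw [unit, cl_eq_cl] at h6
  obtain ⟨v, hv1, hv2⟩ := h6
  have h7 : e₂ * v = v := by rw [← hv1, Matrix.mul_assoc, hv2, Matrix.mul_one]
  have h8 : E * v = v := by
    rw [← h3, Matrix.add_mul, h7, ← h7, ← Matrix.mul_assoc, h4]; simp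
  have h9 : E - v * vᴴ = e₁ := by rw [hv1, ← h3]; simp
  refine ⟨v, hv2, h8, h9 ▸ h₁, ?_⟩
  rw [← h5]
  exact cl_congr _ _ h9

end MvNSemigroup

end UnitClass

/-! ### Two independent lines have equivalent complements -/

section Columns

open Matrix

namespace MvNSemigroup

variable {R : Type*} [CommRing R] [StarRing R] {m : Type*} [Fintype m]

/-- Gram–Schmidt: p = vv* + uu*, where u is the part of c orthogonal to v, rescaled by k to length
one. The clause on q says that p lies under whatever fixes v and c, which characterizes p
symmetrically in the two columns. -/
theorem exists_span_projection {E : Matrix m m R}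
    {v c : Matrix m (Fin 1) R} (hv : vᴴ * v = 1) (hEv : E * v = v)
    (hEc : E * c = c) {k : R} (hk : star k = k)
    (hkc : (k * k) • ((c - v * (vᴴ * c))ᴴ * (c - v * (vᴴ * c))) = 1)
    (h₁ : IsStarProjection (E - v * vᴴ)) :
    ∃ (p : Matrix m m R) (h : IsStarProjection (E - p)), pᴴ = p ∧ p * v = v ∧ p * c = c ∧
      (∀ q : Matrix m m R, q * v = v → q * c = c → q * p = p) ∧
      cl (E - v * vᴴ) h₁ = cl (E - p) h + unit R := by
  obtain ⟨w, hw⟩ : ∃ w, w = c - v * (vᴴ * c) := ⟨_, rfl⟩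
  rw [← hw] at hkc
  have hvw : vᴴ * w = 0 := by
    rw [hw, Matrix.mul_sub, ← Matrix.mul_assoc, hv, Matrix.one_mul, sub_self]
  have hwv : wᴴ * v = 0 := by
    have := congrArg Matrix.conjTranspose hvw
    simpa [Matrix.conjTranspose_mul] using this
  have hwc : wᴴ * c = wᴴ * w := by
    have hcw : c = w + v * (vᴴ * c) := by rw [hw]; abel
    conv_lhs => rw [hcw]
    rw [Matrix.mul_add, ← Matrix.mul_assoc, hwv, Matrix.zero_mul, add_zero]
  obtain ⟨u, hu⟩ : ∃ u, u = k • w := ⟨_, rfl⟩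
  have huH : uᴴ = k • wᴴ := by rw [hu, Matrix.conjTranspose_smul, hk]
  have huu : uᴴ * u = 1 := by
    rw [huH, hu, Matrix.smul_mul, Matrix.mul_smul, smul_smul, hkc]
  have hEw : E * w = w := by
    rw [hw, Matrix.mul_sub, ← Matrix.mul_assoc, hEv, hEc]
  have hEu : (E - v * vᴴ) * u = u := by
    rw [hu, Matrix.mul_smul, Matrix.sub_mul, hEw, Matrix.mul_assoc, hvw, Matrix.mul_zero, sub_zero]
  obtain ⟨h2, h3⟩ := unit_split h₁ huu hEu
  have e : E - v * vᴴ - u * uᴴ = E - (v * vᴴ + u * uᴴ) := by abel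
  refine ⟨v * vᴴ + u * uᴴ, e ▸ h2, ?_, ?_, ?_, ?_, ?_⟩
  · simp [Matrix.conjTranspose_mul]
  · rw [Matrix.add_mul, Matrix.mul_assoc, hv, Matrix.mul_assoc, huH, Matrix.smul_mul, hwv]
    simp
  · rw [Matrix.add_mul, Matrix.mul_assoc, Matrix.mul_assoc, huH, Matrix.smul_mul, hwc, hu,
      Matrix.smul_mul, Matrix.mul_smul, smul_smul, ← Matrix.mul_smul, hkc, Matrix.mul_one, hw]
    abel
  · intro q hqv hqc
    have hqw : q * w = w := by rw [hw, Matrix.mul_sub, ← Matrix.mul_assoc, hqv, hqc]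
    rw [Matrix.mul_add, ← Matrix.mul_assoc, hqv, ← Matrix.mul_assoc, hu, Matrix.mul_smul, hqw]
  · rw [h3]
    congr 1
    exact cl_congr _ _ e

/-- Both sides equal the complement of the span of v and c plus a trivial line. The squared length
of the part of c orthogonal to v is 1 - (c*v)(v*c); as 1 × 1 matrices over a commutative ring
commute, it is the same with v and c exchanged, so one k serves for both. -/
theorem cl_sub_eq_cl_sub {E : Matrix m m R}
    {v c : Matrix m (Fin 1) R} (hv : vᴴ * v = 1) (hc : cᴴ * c = 1) (hEv : E * v = v)
    (hEc : E * c = c) {k : R} (hk : star k = k)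
    (hkc : (k * k) • ((c - v * (vᴴ * c))ᴴ * (c - v * (vᴴ * c))) = 1)
    (h₁ : IsStarProjection (E - v * vᴴ)) (h₂ : IsStarProjection (E - c * cᴴ)) :
    cl (E - v * vᴴ) h₁ = cl (E - c * cᴴ) h₂ := by
  have hcomm : ∀ a b : Matrix (Fin 1) (Fin 1) R, a * b = b * a := by
    intro a b
    ext i j
    fin_cases i; fin_cases j
    simp [Matrix.mul_apply, mul_comm]
  have expand : ∀ a b : Matrix m (Fin 1) R, aᴴ * a = 1 → bᴴ * b = 1 →
      (b - a * (aᴴ * b))ᴴ * (b - a * (aᴴ * b)) = 1 - (bᴴ * a) * (aᴴ * b) := by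
    intro a b ha hb
    have e1 : (b - a * (aᴴ * b))ᴴ = bᴴ - (bᴴ * a) * aᴴ := by
      simp [Matrix.conjTranspose_mul]
    have e2 : aᴴ * (b - a * (aᴴ * b)) = 0 := by
      rw [Matrix.mul_sub, ← Matrix.mul_assoc, ha, Matrix.one_mul, sub_self]
    rw [e1, Matrix.sub_mul, Matrix.mul_assoc, e2, Matrix.mul_zero, sub_zero, Matrix.mul_sub, hb,
      ← Matrix.mul_assoc]
  have hkv : (k * k) • ((v - c * (cᴴ * v))ᴴ * (v - c * (cᴴ * v))) = 1 := by
    rw [expand c v hc hv, hcomm, ← expand v c hv hc, hkc]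
  obtain ⟨p, hp, hps, hpv, hpc, hpq, hcl⟩ :=
    exists_span_projection hv hEv hEc hk hkc h₁
  obtain ⟨p', hp', hps', hpc', hpv', hpq', hcl'⟩ :=
    exists_span_projection hc hEc hEv hk hkv h₂
  have h1 := hpq p' hpv' hpc'
  have h2 := hpq' p hpc hpv
  have h3 : p = p' := by
    rw [← hps, ← h1, Matrix.conjTranspose_mul, hps, hps', h2]
  subst h3
  rw [hcl, hcl']

end MvNSemigroup

end Columns

/-! ### Splitting, cancellation and comparison of bundles -/

section ContinuousColumns

open Matrix

variable {X : Type*} [TopologicalSpace X] {n : Type*}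

/-- A vector valued function as a column of functions. -/
noncomputable def colOf (s : C(X, n → ℂ)) : Matrix n (Fin 1) C(X, ℂ) :=
  fun i _ => ⟨fun x => s x i, (continuous_apply i).comp s.continuous⟩

theorem evalMatrix_colOf_eq_zero_iff {s : C(X, n → ℂ)} {x : X} :
    evalMatrix x (colOf s) = 0 ↔ s x = 0 := by
  constructor
  · intro h
    ext i
    exact congrFun (congrFun h i) 0
  · intro h
    ext i j
    exact congrFun h i

theorem evalMatrix_smul (k : C(X, ℂ)) {m : Type*} (t : Matrix n m C(X, ℂ)) (x : X) :
    evalMatrix x (k • t) = k x • evalMatrix x t := by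
  ext i j
  simp [evalMatrix]

variable [Fintype n]

theorem exists_normalizer (t : Matrix n (Fin 1) C(X, ℂ)) (ht : ∀ x, evalMatrix x t ≠ 0) :
    ∃ k : C(X, ℂ), star k = k ∧ (k * k) • (tᴴ * t) = 1 := by
  have hpos : ∀ x, 0 < ∑ i, ‖t i 0 x‖ ^ 2 := by
    intro x
    by_contra h
    refine ht x ?_
    have h0 : ∑ i, ‖t i 0 x‖ ^ 2 = 0 :=
      le_antisymm (not_lt.1 h) (Finset.sum_nonneg fun i _ => by positivity)
    rw [Finset.sum_eq_zero_iff_of_nonneg (fun i _ => by positivity)] at h0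
    ext i j
    fin_cases j
    simpa [evalMatrix] using h0 i (Finset.mem_univ i)
  have hc : Continuous fun x => (Real.sqrt (∑ i, ‖t i 0 x‖ ^ 2))⁻¹ := by
    refine Continuous.inv₀ (Real.continuous_sqrt.comp (by fun_prop)) fun x => ?_
    exact (Real.sqrt_pos.2 (hpos x)).ne'
  refine ⟨⟨fun x => (((Real.sqrt (∑ i, ‖t i 0 x‖ ^ 2))⁻¹ : ℝ) : ℂ),
    Complex.continuous_ofReal.comp hc⟩, ?_, ?_⟩
  · ext x
    simp
  · ext i j x
    fin_cases i; fin_cases j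
    have h1 : ∑ i, star (t i 0 x) * t i 0 x = ((∑ i, ‖t i 0 x‖ ^ 2 : ℝ) : ℂ) := by
      push_cast
      exact Finset.sum_congr rfl fun i _ => Complex.conj_mul' _
    have h2 := Real.mul_self_sqrt (hpos x).le
    have h3 := (Real.sqrt_pos.2 (hpos x)).ne'
    have h4 : (((Real.sqrt (∑ i, ‖t i 0 x‖ ^ 2))⁻¹ : ℝ) : ℂ) *
        (((Real.sqrt (∑ i, ‖t i 0 x‖ ^ 2))⁻¹ : ℝ) : ℂ) *
        ∑ i, star (t i 0 x) * t i 0 x = 1 := by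
      rw [h1]
      norm_cast
      nth_rewrite 3 [← h2]
      field_simp
    simpa [Matrix.mul_apply, ContinuousMap.sum_apply] using h4

theorem mul_colOf_eq_iff (F : Matrix n n C(X, ℂ)) (s s' : C(X, n → ℂ)) :
    F * colOf s = colOf s' ↔ ∀ x, evalMatrix x F *ᵥ s x = s' x := by
  constructor
  · intro h x
    ext i
    have := congrArg (fun f : C(X, ℂ) => f x) (congrFun (congrFun h i) 0)
    simpa [Matrix.mul_apply, colOf, evalMatrix, Matrix.mulVec, dotProduct,
      ContinuousMap.sum_apply] using this
  · intro h
    ext i j x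
    have := congrFun (h x) i
    simpa [Matrix.mul_apply, colOf, evalMatrix, Matrix.mulVec, dotProduct,
      ContinuousMap.sum_apply] using this

/-- A matrix of continuous functions acts on vector valued functions. -/
noncomputable def mulSection (F : Matrix n n C(X, ℂ)) (s : C(X, n → ℂ)) : C(X, n → ℂ) :=
  ⟨fun x => evalMatrix x F *ᵥ s x, (continuous_evalMatrix F).matrix_mulVec s.continuous⟩

theorem IsSectionOf.mulSection {F : Matrix n n C(X, ℂ)} (hF : IsStarProjection F)
    (s : C(X, n → ℂ)) : IsSectionOf F (mulSection F s) := fun x => by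
  have hi : evalMatrix x F * evalMatrix x F = evalMatrix x F :=
    (hF.evalMatrix x).isIdempotentElem
  change evalMatrix x F *ᵥ (evalMatrix x F *ᵥ s x) = evalMatrix x F *ᵥ s x
  rw [Matrix.mulVec_mulVec, hi]

theorem normalizer_ne_zero {t : Matrix n (Fin 1) C(X, ℂ)} {k : C(X, ℂ)}
    (h : (k * k) • (tᴴ * t) = 1) (x : X) : k x ≠ 0 := by
  intro h0
  have := congrArg (fun f : C(X, ℂ) => f x) (congrFun (congrFun h 0) 0)
  simp [h0] at this

namespace MvNSemigroup

theorem rk_unit (x : X) : rk (unit C(X, ℂ)) x = 1 := by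
  rw [unit, rk_cl, evalMatrix_one, Matrix.rank_one]
  simp

/-- Every bounded locally constant function is a rank function. -/
theorem exists_rk_eq (m : X → ℕ) (hm : IsLocallyConstant m) (M : ℕ) (hM : ∀ x, m x ≤ M) :
    ∃ α : MvNSemigroup C(X, ℂ), rk α = m := by
  classical
  let f : Fin M → C(X, ℂ) := fun j => ⟨fun x => if (j : ℕ) < m x then 1 else 0,
    (hm.comp fun k => if (j : ℕ) < k then (1 : ℂ) else 0).continuous⟩
  have hf : ∀ j x, f j x = if (j : ℕ) < m x then 1 else 0 := fun _ _ => rfl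
  have hF : IsStarProjection (Matrix.diagonal f) := by
    refine ⟨?_, ?_⟩
    · change Matrix.diagonal f * Matrix.diagonal f = _
      rw [Matrix.diagonal_mul_diagonal]
      congr 1
      ext j x
      simp [hf]
    · change (Matrix.diagonal f)ᴴ = _
      rw [Matrix.diagonal_conjTranspose]
      congr 1
      ext j x
      simp only [Pi.star_apply, ContinuousMap.star_apply, hf]
      split_ifs <;> simp
  refine ⟨cl _ hF, ?_⟩
  ext x
  rw [rk_cl]
  have h1 := trace_eq_rank_of_isIdempotentElem (hF.evalMatrix x).isIdempotentElem
  have h2 : (evalMatrix x (Matrix.diagonal f)).trace = (m x : ℂ) := by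
    simp only [Matrix.trace, Matrix.diag_apply, evalMatrix, Matrix.map_apply,
      Matrix.diagonal_apply_eq, hf]
    rw [Finset.sum_boole]
    congr 1
    rw [Fin.card_filter_val_lt]
    exact min_eq_right (hM x)
  rw [h1] at h2
  exact_mod_cast h2

variable [CompactSpace X] [T2Space X] {d : ℕ}

/-- A perturbation of the zero section vanishes nowhere; rescaled to length one it spans a trivial
line. -/
theorem exists_eq_add_unit (hX : CoveringDimLE X d) {α : MvNSemigroup C(X, ℂ)}
    (hα : ∀ x, d + 1 ≤ rk α x) : ∃ β, α = β + unit C(X, ℂ) := by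
  obtain ⟨n, F, hF, rfl⟩ := exists_cl_eq α
  simp only [rk_cl] at hα
  obtain ⟨s, hs, -, hs0⟩ := exists_perturb_ne_zero hX hF hα 0 (fun x => by simp) one_pos
  obtain ⟨k, hk, hkk⟩ := exists_normalizer (colOf s)
    (fun x h => hs0 x (evalMatrix_colOf_eq_zero_iff.1 h))
  have hFs := (mul_colOf_eq_iff F s s).2 hs
  obtain ⟨h1, h2⟩ := unit_split hF (v := k • colOf s)
    (by rw [Matrix.conjTranspose_smul, hk, Matrix.smul_mul, Matrix.mul_smul, smul_smul, hkk])
    (by rw [Matrix.mul_smul, hFs])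
  exact ⟨_, h2⟩

/-- Cancellation of a trivial line bundle. -/
theorem add_unit_cancel (hX : CoveringDimLE X d) {α β : MvNSemigroup C(X, ℂ)}
    (hα : ∀ x, d + 1 ≤ rk α x) (h : α + unit C(X, ℂ) = β + unit C(X, ℂ)) : α = β := by
  have hβ : ∀ x, d + 1 ≤ rk β x := by
    intro x
    have h1 := congrFun (congrArg rk h) x
    simp only [map_add, Pi.add_apply] at h1
    have := hα x
    omega
  -- One bundle E carries both decompositions: α and β are the complements in E of the trivial lines
  -- spanned by v and w. It suffices to find a unit section of E that is independent of v at every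
  -- point and also of w at every point.
  obtain ⟨n, E, hE, hcl⟩ := exists_cl_eq (α + unit C(X, ℂ))
  obtain ⟨v, hv, hEv, hv', hclv⟩ := exists_of_cl_eq_add_unit hE hcl
  obtain ⟨w, hw, hEw, hw', hclw⟩ := exists_of_cl_eq_add_unit hE (hcl.trans h)
  rw [← hclv] at hα
  rw [← hclw] at hβ
  simp only [rk_cl] at hα hβ
  obtain ⟨a, ha, -, ha0⟩ := exists_perturb_ne_zero hX hv' hα 0 (fun x => by simp) one_pos
  obtain ⟨δ, hδ, hδa⟩ : ∃ δ > 0, ∀ x, δ ≤ ‖a x‖ := by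
    rcases isEmpty_or_nonempty X with he | hne
    · exact ⟨1, one_pos, fun x => he.elim x⟩
    · obtain ⟨z, -, hzm⟩ := isCompact_univ.exists_isMinOn Set.univ_nonempty
        a.continuous.norm.continuousOn
      exact ⟨‖a z‖, norm_pos_iff.2 (ha0 z), fun x => hzm (Set.mem_univ x)⟩
  obtain ⟨M, hM, hMF⟩ := exists_norm_evalMatrix_mulVec_le (E - v * vᴴ)
  have hEi : E * E = E := hE.isIdempotentElem
  have hEV : E * (E - v * vᴴ) = E - v * vᴴ := by
    rw [Matrix.mul_sub, hEi, ← Matrix.mul_assoc, hEv]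
  have hEW : E * (E - w * wᴴ) = E - w * wᴴ := by
    rw [Matrix.mul_sub, hEi, ← Matrix.mul_assoc, hEw]
  obtain ⟨g, hg, hga, hg0⟩ := exists_perturb_ne_zero hX hw' hβ
    (mulSection (E - w * wᴴ) a) (IsSectionOf.mulSection hw' a) (ε := δ / 2 / M) (by positivity)
  have sect : ∀ (F : Matrix (Fin n) (Fin n) C(X, ℂ)) (s : C(X, Fin n → ℂ)), E * F = F →
      IsSectionOf F s → ∀ x, evalMatrix x E *ᵥ s x = s x := by
    intro F s hF hs x
    rw [← hs x, Matrix.mulVec_mulVec, ← evalMatrix_mul, hF]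
  -- The correction term makes the part of t orthogonal to w equal to g, which vanishes nowhere. The
  -- correction is at most δ / (2M), so the part of t orthogonal to v differs from a by at most δ/2,
  -- whereas a has norm at least δ.
  let t : C(X, Fin n → ℂ) := a + (g - mulSection (E - w * wᴴ) a)
  have ht : ∀ x, t x = a x + (g x - mulSection (E - w * wᴴ) a x) := fun x => rfl
  have hEt : IsSectionOf E t := by
    intro x
    rw [ht, Matrix.mulVec_add, Matrix.mulVec_sub, sect _ _ hEV ha,
      sect _ _ hEW hg, sect _ _ hEW (IsSectionOf.mulSection hw' a)]
  have hvt : ∀ x, evalMatrix x (E - v * vᴴ) *ᵥ t x ≠ 0 := by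
    intro x h0
    rw [ht, Matrix.mulVec_add, ha x] at h0
    have h1 := hMF x (g x - mulSection (E - w * wᴴ) a x)
    have h2 := hga x
    have h3 := hδa x
    have h4 : M * ‖g x - mulSection (E - w * wᴴ) a x‖ ≤ δ / 2 := by
      have := mul_le_mul_of_nonneg_left h2 hM.le
      rwa [mul_div_cancel₀ _ hM.ne'] at this
    rw [eq_neg_of_add_eq_zero_left h0, norm_neg] at h3
    linarith
  have hwt : ∀ x, evalMatrix x (E - w * wᴴ) *ᵥ t x ≠ 0 := by
    intro x
    rw [ht, Matrix.mulVec_add, Matrix.mulVec_sub, hg x, IsSectionOf.mulSection hw' a x]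
    change mulSection (E - w * wᴴ) a x + _ ≠ 0
    rw [add_sub_cancel]
    exact hg0 x
  have ht0 : ∀ x, t x ≠ 0 := fun x h0 => hwt x (by rw [h0, Matrix.mulVec_zero])
  obtain ⟨k, hk, hkk⟩ := exists_normalizer (colOf t)
    (fun x h => ht0 x (evalMatrix_colOf_eq_zero_iff.1 h))
  have hEc : E * (k • colOf t) = k • colOf t := by
    rw [Matrix.mul_smul, (mul_colOf_eq_iff E t t).2 hEt]
  have hcc : (k • colOf t)ᴴ * (k • colOf t) = 1 := by
    rw [Matrix.conjTranspose_smul, hk, Matrix.smul_mul, Matrix.mul_smul, smul_smul, hkk]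
  obtain ⟨hc', -⟩ := unit_split hE hcc hEc
  have key : ∀ (z : Matrix (Fin n) (Fin 1) C(X, ℂ)) (hz : zᴴ * z = 1) (hEz : E * z = z)
      (hz' : IsStarProjection (E - z * zᴴ)),
      (∀ x, evalMatrix x (E - z * zᴴ) *ᵥ t x ≠ 0) →
      cl (E - z * zᴴ) hz' = cl (E - k • colOf t * (k • colOf t)ᴴ) hc' := by
    intro z hz hEz hz' hzt
    have e1 : k • colOf t - z * (zᴴ * (k • colOf t)) =
        k • colOf (mulSection (E - z * zᴴ) t) := by
      rw [← (mul_colOf_eq_iff (E - z * zᴴ) t (mulSection (E - z * zᴴ) t)).2 (fun x => rfl), ← Matrix.mul_smul,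
        Matrix.sub_mul, hEc, Matrix.mul_assoc]
    obtain ⟨l, hl, hll⟩ := exists_normalizer (k • colOf t - z * (zᴴ * (k • colOf t))) (by
      intro x h0
      rw [e1, evalMatrix_smul, smul_eq_zero] at h0
      rcases h0 with h0 | h0
      · exact normalizer_ne_zero hkk x h0
      · exact hzt x (evalMatrix_colOf_eq_zero_iff.1 h0))
    exact cl_sub_eq_cl_sub hz hcc hEz hEc hl hll hz' hc'
  rw [← hclv, ← hclw, key v hv hEv hv' hvt, key w hw hEw hw' hwt]

theorem exists_eq_add_nsmul_unit (hX : CoveringDimLE X d) (k : ℕ) {α : MvNSemigroup C(X, ℂ)}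
    (hα : ∀ x, k + d ≤ rk α x) : ∃ β, α = β + k • unit C(X, ℂ) := by
  induction k generalizing α with
  | zero => exact ⟨α, by simp⟩
  | succ k ih =>
    obtain ⟨β, rfl⟩ := exists_eq_add_unit hX (α := α) (fun x => by have := hα x; omega)
    obtain ⟨γ, rfl⟩ := ih (α := β) (fun x => by
      have := hα x
      simp only [map_add, Pi.add_apply, rk_unit] at this
      omega)
    exact ⟨γ, by rw [succ_nsmul, add_assoc]⟩

theorem add_nsmul_unit_cancel (hX : CoveringDimLE X d) (k : ℕ) {α β : MvNSemigroup C(X, ℂ)}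
    (hα : ∀ x, d + 1 ≤ rk α x) (h : α + k • unit C(X, ℂ) = β + k • unit C(X, ℂ)) : α = β := by
  induction k with
  | zero => simpa using h
  | succ k ih =>
    rw [succ_nsmul, ← add_assoc, ← add_assoc] at h
    refine ih (add_unit_cancel hX (fun x => ?_) h)
    have := hα x
    simp only [map_add, Pi.add_apply]
    omega

/-- Comparison of vector bundles whose ranks differ by more than the covering dimension. -/
theorem exists_eq_add_of_rk_le (hX : CoveringDimLE X d) {α β : MvNSemigroup C(X, ℂ)}
    (h : ∀ x, rk α x + (d + 1) ≤ rk β x) : ∃ γ, β = α + γ := by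
  obtain ⟨n, E, hE, rfl⟩ := exists_cl_eq α
  obtain ⟨δ, hδ⟩ := cl_of_mul_eq hE (.one _) (one_mul E)
  rw [cl_one] at hδ
  have hr : ∀ x, n = rk (cl E hE) x + rk δ x := by
    intro x
    have := congrFun (congrArg rk hδ) x
    simpa [rk_unit] using this
  -- The class δ is a complement of α in the trivial bundle of rank n, so β + δ has rank at least n
  -- + d + 1 and n trivial lines split off. Adding α to both sides and cancelling n trivial lines
  -- gives β = α + γ.
  obtain ⟨γ, hγ⟩ := exists_eq_add_nsmul_unit hX n (α := β + δ) (fun x => by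
    have := hr x
    have := h x
    simp only [map_add, Pi.add_apply]
    omega)
  refine ⟨γ, add_nsmul_unit_cancel hX n (fun x => ?_) ?_⟩
  · have := h x
    omega
  · calc β + n • unit C(X, ℂ) = (β + δ) + cl E hE := by rw [hδ]; abel
      _ = cl E hE + γ + n • unit C(X, ℂ) := by rw [hγ]; abel

/-- Riesz decomposition for vector bundles of large rank. -/
theorem exists_decomposition_of_rk (hX : CoveringDimLE X d) {ξ ζ α β : MvNSemigroup C(X, ℂ)}
    (h : ∀ x, rk ξ x + rk ζ x = rk α x + rk β x)
    (hξ : ∀ x, 2 * (d + 1) ≤ rk ξ x) (hζ : ∀ x, 2 * (d + 1) ≤ rk ζ x)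
    (hα : ∀ x, 2 * (d + 1) ≤ rk α x) (hβ : ∀ x, 2 * (d + 1) ≤ rk β x) :
    ∃ μ ν μ' ν', ξ = μ + ν ∧ α = μ + μ' ∧ β = ν + ν' := by
  -- The rank of the part of ξ placed under α: as small as possible while the rest of ξ still fits
  -- under β with a gap of d + 1. The truncated subtraction gives 0 where ξ itself fits under β. The
  -- lower bounds on the ranks of ξ, β and ζ leave the gaps needed below ξ and α.
  let m : X → ℕ := fun x => rk ξ x + (d + 1) - rk β x
  have hm : IsLocallyConstant m :=
    (((isLocallyConstant_rk ξ).prodMk (isLocallyConstant_rk β)).comp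
      fun p : ℕ × ℕ => p.1 + (d + 1) - p.2)
  obtain ⟨M, hM⟩ := hm.range_finite.bddAbove
  obtain ⟨μ, hμ⟩ := exists_rk_eq m hm M fun x => hM ⟨x, rfl⟩
  have hμx : ∀ x, rk μ x = rk ξ x + (d + 1) - rk β x := fun x => congrFun hμ x
  obtain ⟨ν, hν⟩ := exists_eq_add_of_rk_le hX (α := μ) (β := ξ) (fun x => by
    have := hμx x; have := hξ x; have := hβ x; omega)
  obtain ⟨μ', hμ'⟩ := exists_eq_add_of_rk_le hX (α := μ) (β := α) (fun x => by
    have := hμx x; have := hζ x; have := hα x; have := h x; omega)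
  obtain ⟨ν', hν'⟩ := exists_eq_add_of_rk_le hX (α := ν) (β := β) (fun x => by
    have h1 := congrFun (congrArg rk hν) x
    simp only [map_add, Pi.add_apply] at h1
    have := hμx x; have := hξ x; have := hβ x; omega)
  exact ⟨μ, ν, μ', ν', hν, hμ', hν'⟩

end MvNSemigroup

end ContinuousColumns

/-! ### Perturbation of projections in C*-algebras -/

section CStarPerturbation

variable {B : Type*} [CStarAlgebra B]

/-- The spectrum of c is positive, and s is the inverse square root from the functional calculus.
The commutation clause serves to move s past projections that commute with c. -/
theorem exists_inv_sqrt_of_norm_lt {c : B} (hc : IsSelfAdjoint c) (h : ‖1 - c‖ < 1) :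
    ∃ s : B, star s = s ∧ s * c * s = 1 ∧ ∀ b, Commute b c → Commute b s := by
  rcases subsingleton_or_nontrivial B with hB | hB
  · exact ⟨0, star_zero B, Subsingleton.elim _ _, fun b _ => Commute.zero_right b⟩
  have hpos : ∀ t ∈ spectrum ℝ c, 0 < t := by
    intro t ht
    have h1 : 1 - t ∈ spectrum ℝ (1 - c) := by
      rw [spectrum.mem_iff] at ht ⊢
      have e1 : (algebraMap ℝ B) (1 - t) - (1 - c) = -((algebraMap ℝ B) t - c) := by
        rw [map_sub, map_one]; abel
      rwa [e1, IsUnit.neg_iff]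
    have h2 := spectrum.norm_le_norm_of_mem h1
    rw [Real.norm_eq_abs] at h2
    have := le_abs_self (1 - t)
    linarith
  have hcont : ContinuousOn (fun t : ℝ => (Real.sqrt t)⁻¹) (spectrum ℝ c) :=
    Real.continuous_sqrt.continuousOn.inv₀ fun t ht => (Real.sqrt_pos.2 (hpos t ht)).ne'
  refine ⟨cfc (fun t : ℝ => (Real.sqrt t)⁻¹) c, ?_, ?_, ?_⟩
  · exact (cfc_predicate (p := IsSelfAdjoint) _ c).star_eq
  · nth_rewrite 2 [← cfc_id ℝ c hc]
    rw [← cfc_mul _ _ c hcont continuousOn_id,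
      ← cfc_mul (fun t : ℝ => (Real.sqrt t)⁻¹ * id t) _ c (hcont.mul continuousOn_id) hcont,
      ← cfc_one ℝ c hc]
    refine cfc_congr fun t ht => ?_
    have h1 := Real.sqrt_pos.2 (hpos t ht)
    have h2 := Real.mul_self_sqrt (hpos t ht).le
    simp only [id, Pi.one_apply]
    nth_rewrite 2 [← h2]
    field_simp
  · intro b hb
    exact (hb.symm.cfc_real _).symm

/-- The element c = e x*f x e + (1 - e) is within distance 1 of the unit and commutes with e. With s
its inverse square root, v = s e x* f is the polar correction of e x* f. -/
theorem exists_mul_star_eq_of_norm_lt {e f x : B} (he : IsStarProjection e)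
    (hf : IsStarProjection f) (h : ‖e - star x * f * x‖ < 1) :
    ∃ v : B, v * star v = e ∧ v * f = v := by
  have hs : star e = e := he.isSelfAdjoint
  have hs' : star f = f := hf.isSelfAdjoint
  have hi : e * e = e := he.isIdempotentElem
  have hi' : f * f = f := hf.isIdempotentElem
  have hcs : IsSelfAdjoint (e * (star x * f * x) * e + (1 - e)) := by
    change star _ = _
    simp [hs, hs', mul_assoc]
  have hn : ‖1 - (e * (star x * f * x) * e + (1 - e))‖ < 1 := by
    have e1 : 1 - (e * (star x * f * x) * e + (1 - e)) = e * (e - star x * f * x) * e := by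
      rw [mul_sub, sub_mul, hi, hi]; abel
    rw [e1]
    have h1 := he.norm_le
    calc _ ≤ ‖e‖ * ‖e - star x * f * x‖ * ‖e‖ := by
          refine (norm_mul_le _ _).trans ?_
          gcongr
          exact norm_mul_le _ _
      _ ≤ 1 * ‖e - star x * f * x‖ * 1 := by gcongr
      _ < 1 := by simpa using h
  obtain ⟨s, hss, hsc, hcomm⟩ := exists_inv_sqrt_of_norm_lt hcs hn
  have hec : e * (e * (star x * f * x) * e + (1 - e)) = e * (star x * f * x) * e := by
    rw [mul_add, ← mul_assoc, ← mul_assoc, hi, mul_sub, hi]; simp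
  have hce : (e * (star x * f * x) * e + (1 - e)) * e = e * (star x * f * x) * e := by
    rw [add_mul, mul_assoc, hi, sub_mul, hi]; simp
  have hes : e * s = s * e := hcomm e (hec.trans hce.symm)
  refine ⟨s * e * star x * f, ?_, ?_⟩
  · have e1 : s * e * star x * f * star (s * e * star x * f) =
        s * (e * (star x * (f * f) * x) * e) * s := by
      simp only [star_mul, star_star, hs, hs', hss, mul_assoc]
    rw [e1, hi', ← hec, ← mul_assoc, ← hes, mul_assoc e, mul_assoc e, hsc, mul_one]
  · rw [mul_assoc, hi']

/-- The element c = 1 - (e - f)² commutes with both projections and satisfies ec = efe and fc = fef,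
so its inverse square root turns ef into a partial isometry from f to e. -/
theorem exists_mvn_of_norm_sub_lt {e f : B} (he : IsStarProjection e)
    (hf : IsStarProjection f) (h : ‖e - f‖ < 1) :
    ∃ v : B, v * star v = e ∧ star v * v = f := by
  have hs : star e = e := he.isSelfAdjoint
  have hs' : star f = f := hf.isSelfAdjoint
  have hi : e * e = e := he.isIdempotentElem
  have hi' : f * f = f := hf.isIdempotentElem
  obtain ⟨c, hc⟩ : ∃ c, c = 1 - (e - f) * (e - f) := ⟨_, rfl⟩
  have hcs : IsSelfAdjoint c := by
    change star c = c
    simp [hc, hs, hs']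
  have hn : ‖1 - c‖ < 1 := by
    rw [hc, sub_sub_cancel]
    calc _ ≤ ‖e - f‖ * ‖e - f‖ := norm_mul_le _ _
      _ < 1 := by nlinarith [norm_nonneg (e - f)]
  have hd : (e - f) * (e - f) = e - e * f - f * e + f := by
    rw [mul_sub, sub_mul, sub_mul, hi, hi']; abel
  have hec : e * c = e * f * e := by
    rw [hc, hd, mul_sub, mul_add, mul_sub, mul_sub, ← mul_assoc e e f, hi, ← mul_assoc, mul_one]
    abel
  have hce : c * e = e * f * e := by
    rw [hc, hd, sub_mul, add_mul, sub_mul, sub_mul, mul_assoc f e e, hi, one_mul]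
    abel
  have hfc : f * c = f * e * f := by
    rw [hc, hd, mul_sub, mul_add, mul_sub, mul_sub, ← mul_assoc f f e, hi', ← mul_assoc, mul_one]
    abel
  have hcf : c * f = f * e * f := by
    rw [hc, hd, sub_mul, add_mul, sub_mul, sub_mul, mul_assoc e f f, hi', one_mul]
    abel
  obtain ⟨s, hss, hsc, hcomm⟩ := exists_inv_sqrt_of_norm_lt hcs hn
  have hes : e * s = s * e := hcomm e (hec.trans hce.symm)
  have hfs : f * s = s * f := hcomm f (hfc.trans hcf.symm)
  refine ⟨s * e * f, ?_, ?_⟩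
  · have e1 : s * e * f * star (s * e * f) = s * (e * (f * f) * e) * s := by
      simp only [star_mul, hs, hs', hss, mul_assoc]
    rw [e1, hi', ← hec, ← mul_assoc, ← hes, mul_assoc e, mul_assoc e, hsc, mul_one]
  · have e1 : star (s * e * f) * (s * e * f) = f * (e * s) * (s * e) * f := by
      simp only [star_mul, hs, hs', hss, mul_assoc]
    have e2 : f * (e * s) * (s * e) * f = s * (f * (e * e) * f) * s := by
      rw [hes, ← mul_assoc f s e, hfs, ← hes]
      simp only [mul_assoc]
      rw [← hfs]
    rw [e1, e2, hi, ← hfc, ← mul_assoc, ← hfs, mul_assoc f, mul_assoc f, hsc, mul_one]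

/-- An approximate projection is close to a projection. -/
theorem exists_isStarProjection_near {S : Type*} [NonUnitalCStarAlgebra S] {h : S}
    (hh : IsSelfAdjoint h) {δ : ℝ} (hδ : δ < 1 / 4) (hhh : ‖h * h - h‖ ≤ δ) :
    ∃ q : S, IsStarProjection q ∧ ‖q - h‖ ≤ 2 * δ ∧ ∀ c, c * h = 0 → c * q = 0 := by
  have hδ0 : 0 ≤ δ := (norm_nonneg _).trans hhh
  have hspec : ∀ t ∈ quasispectrum ℝ h, |t * t - t| ≤ δ := by
    intro t ht
    have e1 : h * h - h = cfcₙ (fun t : ℝ => t * t - t) h := by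
      rw [cfcₙ_sub _ _ h, cfcₙ_mul _ _ h, cfcₙ_id' ℝ h]
    have := norm_apply_le_norm_cfcₙ (fun t : ℝ => t * t - t) h ht
    rw [← e1, Real.norm_eq_abs] at this
    exact this.trans hhh
  -- At t = 1/2 the value |t² - t| is 1/4 > δ. The spectrum thus has a gap at 1/2, and the indicator
  -- of its upper part is continuous on it.
  have hhalf : ∀ t ∈ quasispectrum ℝ h, t ≠ 1 / 2 := by
    rintro t ht rfl
    have := hspec _ ht
    norm_num [abs_of_nonneg] at this
    linarith
  let b : quasispectrum ℝ h → Bool := fun t => decide ((t : ℝ) < 1 / 2)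
  have hclop : IsLocallyConstant b := by
    rw [IsLocallyConstant.iff_isOpen_fiber_apply]
    intro t
    by_cases h1 : (t : ℝ) < 1 / 2
    · have : b ⁻¹' {b t} = {u : quasispectrum ℝ h | (u : ℝ) < 1 / 2} := by
        ext u
        change decide _ = decide _ ↔ (u : ℝ) < 1 / 2
        rw [decide_eq_true h1, decide_eq_true_iff]
      rw [this]
      exact isOpen_lt continuous_subtype_val continuous_const
    · have : b ⁻¹' {b t} = {u : quasispectrum ℝ h | 1 / 2 < (u : ℝ)} := by
        ext u
        change decide _ = decide _ ↔ 1 / 2 < (u : ℝ)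
        rw [decide_eq_false h1, decide_eq_false_iff_not, not_lt]
        exact ⟨fun h => lt_of_le_of_ne h (hhalf u u.2).symm, le_of_lt⟩
      rw [this]
      exact isOpen_lt continuous_const continuous_subtype_val
  let f : ℝ → ℝ := fun t => if t < 1 / 2 then 0 else 1
  -- Since f(t) = t g(t) on the spectrum, the projection is h times g(h); hence it is annihilated by
  -- whatever annihilates h on the left.
  let g : ℝ → ℝ := fun t => if t < 1 / 2 then 0 else t⁻¹
  have hf : ContinuousOn f (quasispectrum ℝ h) := by
    rw [continuousOn_iff_continuous_domRestrict]
    have := (hclop.comp fun b : Bool => if b then (0 : ℝ) else 1).continuous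
    refine this.congr fun t => ?_
    change (if decide ((t : ℝ) < 1 / 2) = true then (0 : ℝ) else 1) = if _ then _ else _
    simp only [decide_eq_true_eq]
  have hg : ContinuousOn g (quasispectrum ℝ h) := by
    rw [continuousOn_iff_continuous_domRestrict]
    have h1 := (hclop.comp fun b : Bool => if b then (0 : ℝ) else 1).continuous
    have h2 : Continuous fun t : quasispectrum ℝ h => (max (t : ℝ) (1 / 2))⁻¹ := by
      refine Continuous.inv₀ (by fun_prop) fun t => ?_
      have := le_max_right (t : ℝ) (1 / 2)
      positivity
    refine (h1.mul h2).congr fun t => ?_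
    change (if decide ((t : ℝ) < 1 / 2) = true then (0 : ℝ) else 1) * (max (t : ℝ) (1 / 2))⁻¹ =
      if (t : ℝ) < 1 / 2 then 0 else (t : ℝ)⁻¹
    by_cases ht : (t : ℝ) < 1 / 2
    · rw [if_pos ht, if_pos (decide_eq_true ht), zero_mul]
    · rw [if_neg ht, if_neg (by rwa [decide_eq_true_iff]), one_mul, max_eq_left (not_lt.1 ht)]
  have hf0 : f 0 = 0 := by simp [f]
  have hg0 : g 0 = 0 := by simp [g]
  refine ⟨cfcₙ f h, ⟨?_, cfcₙ_predicate (p := IsSelfAdjoint) _ h⟩, ?_, ?_⟩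
  · change cfcₙ f h * cfcₙ f h = _
    rw [← cfcₙ_mul f f h hf hf0 hf hf0]
    refine cfcₙ_congr fun t _ => ?_
    simp only [f]; split_ifs <;> simp
  · nth_rewrite 2 [← cfcₙ_id' ℝ h]
    rw [← cfcₙ_sub _ _ h hf hf0]
    refine norm_cfcₙ_le fun t ht => ?_
    have h1 := hspec t ht
    have h2 : |t * t - t| = |t| * |t - 1| := by rw [← abs_mul]; ring_nf
    rw [h2] at h1
    rw [Real.norm_eq_abs]
    simp only [f]
    split_ifs with ht2
    · rw [zero_sub, abs_neg]
      have h3 : 1 / 2 ≤ |t - 1| := by rw [abs_of_neg (by linarith)]; linarith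
      nlinarith [abs_nonneg t]
    · rw [abs_sub_comm]
      have h3 : 1 / 2 ≤ |t| := (not_lt.1 ht2).trans (le_abs_self t)
      nlinarith [abs_nonneg (t - 1)]
  · intro c hc
    have e1 : cfcₙ f h = h * cfcₙ g h := by
      nth_rewrite 2 [← cfcₙ_id' ℝ h]
      rw [← cfcₙ_mul (fun t => t) g h continuousOn_id rfl hg hg0]
      refine cfcₙ_congr fun t ht => ?_
      simp only [f, g]
      split_ifs with ht2
      · simp
      · rw [mul_inv_cancel₀]
        intro h0; rw [h0] at ht2; norm_num at ht2
    rw [e1, ← mul_assoc, hc, zero_mul]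

end CStarPerturbation

/-! ### Stability of the rank of matrices -/

section MatrixRank

open Matrix

open scoped ComplexOrder

variable {n : Type*} [Fintype n]

/-- The rank of a complex matrix, seen in the C*-algebra of matrices. -/
noncomputable def cstarRank (e : CStarMatrix n n ℂ) : ℕ := (CStarMatrix.ofMatrix.symm e).rank

theorem cstarRank_mul_le_left (a b : CStarMatrix n n ℂ) : cstarRank (a * b) ≤ cstarRank a :=
  Matrix.rank_mul_le_left (CStarMatrix.ofMatrix.symm a) (CStarMatrix.ofMatrix.symm b)

theorem cstarRank_mul_le_right (a b : CStarMatrix n n ℂ) : cstarRank (a * b) ≤ cstarRank b :=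
  Matrix.rank_mul_le_right (CStarMatrix.ofMatrix.symm a) (CStarMatrix.ofMatrix.symm b)

theorem cstarRank_add {a b : CStarMatrix n n ℂ} (ha : IsStarProjection a)
    (hb : IsStarProjection b) (h : a * b = 0) :
    cstarRank (a + b) = cstarRank a + cstarRank b := by
  have h1 := trace_eq_rank_of_isIdempotentElem (e := CStarMatrix.ofMatrix.symm a)
    ha.isIdempotentElem
  have h2 := trace_eq_rank_of_isIdempotentElem (e := CStarMatrix.ofMatrix.symm b)
    hb.isIdempotentElem
  have h3 := trace_eq_rank_of_isIdempotentElem (e := CStarMatrix.ofMatrix.symm (a + b))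
    (IsStarProjection.add_of_mul_eq_zero ha hb h).1.isIdempotentElem
  have h4 : (CStarMatrix.ofMatrix.symm (a + b)).trace =
      (CStarMatrix.ofMatrix.symm a).trace + (CStarMatrix.ofMatrix.symm b).trace :=
    Matrix.trace_add _ _
  rw [h1, h2, h3] at h4
  exact_mod_cast h4

variable [DecidableEq n]

/-- For the invertible c = 1 - (e - exfye) one has ec = exfye, so e = exf(yec⁻¹) factors through f.
-/
theorem cstarRank_le_of_norm_lt {e f x y : CStarMatrix n n ℂ} (he : e * e = e)
    (h : ‖e * x * f * y * e - e‖ < 1) : cstarRank e ≤ cstarRank f := by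
  let c := Units.oneSub (e - e * x * f * y * e) (by rwa [norm_sub_rev])
  have hc : (c : CStarMatrix n n ℂ) = 1 - (e - e * x * f * y * e) := rfl
  have h1 : e * (c : CStarMatrix n n ℂ) = e * x * f * y * e := by
    rw [hc, mul_sub, mul_sub, mul_one, he]
    simp only [← mul_assoc, he]
    abel
  have h2 : e = e * x * f * (y * e * (↑c⁻¹ : CStarMatrix n n ℂ)) := by
    rw [← mul_assoc, ← mul_assoc, ← h1, mul_assoc, Units.mul_inv, mul_one]
  calc cstarRank e ≤ cstarRank (e * x * f) := by
        conv_lhs => rw [h2]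
        exact cstarRank_mul_le_left _ _
    _ ≤ cstarRank f := cstarRank_mul_le_right _ _

theorem cstarRank_eq_of_norm_sub_lt {e f : CStarMatrix n n ℂ} (he : IsStarProjection e)
    (hf : IsStarProjection f) (h : ‖e - f‖ < 1) : cstarRank e = cstarRank f := by
  have key : ∀ {e f : CStarMatrix n n ℂ}, IsStarProjection e → IsStarProjection f →
      ‖e - f‖ < 1 → cstarRank e ≤ cstarRank f := by
    intro e f he hf h
    have hi : e * e = e := he.isIdempotentElem
    refine cstarRank_le_of_norm_lt (x := 1) (y := 1) hi ?_
    have e1 : e * 1 * f * 1 * e - e = e * (f - e) * e := by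
      rw [mul_sub, sub_mul, hi, hi, mul_one, mul_one]
    rw [e1]
    calc _ ≤ ‖e‖ * ‖f - e‖ * ‖e‖ := by
          refine (norm_mul_le _ _).trans ?_
          gcongr
          exact norm_mul_le _ _
      _ ≤ 1 * ‖f - e‖ * 1 := by gcongr <;> exact he.norm_le
      _ < 1 := by rw [norm_sub_rev]; simpa using h
  exact le_antisymm (key he hf h) (key hf he (by rwa [norm_sub_rev]))

/-- The projection b is first made exactly orthogonal to a: (1 - a) b (1 - a) is close to b and
almost idempotent, and the projection q near it is annihilated by a. Then q has the rank of b, and a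
+ q has the rank of e. -/
theorem cstarRank_eq_add_of_norm_le {a b e : CStarMatrix n n ℂ} (ha : IsStarProjection a)
    (hb : IsStarProjection b) (he : IsStarProjection e) (hab : ‖a * b‖ ≤ 1 / 100)
    (habe : ‖a + b - e‖ ≤ 1 / 100) : cstarRank e = cstarRank a + cstarRank b := by
  have hia : a * a = a := ha.isIdempotentElem
  have hib : b * b = b := hb.isIdempotentElem
  have hsa : star a = a := ha.isSelfAdjoint
  have hsb : star b = b := hb.isSelfAdjoint
  have hba : ‖b * a‖ ≤ 1 / 100 := by
    rw [← norm_star]; simpa [hsa, hsb] using hab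
  obtain ⟨h, hh⟩ : ∃ h, h = (1 - a) * b * (1 - a) := ⟨_, rfl⟩
  have hah : a * h = 0 := by
    rw [hh, ← mul_assoc, ← mul_assoc, mul_sub a 1 a, hia]; simp
  have hhb : ‖h - b‖ ≤ 3 / 100 := by
    have e1 : h - b = a * b * a - a * b - b * a := by
      rw [hh, sub_mul, sub_mul, mul_sub, mul_sub]; simp only [one_mul, mul_one]; abel
    rw [e1]
    have h1 : ‖a * b * a‖ ≤ 1 / 100 := by
      refine (norm_mul_le _ _).trans ?_
      have := mul_le_mul hab ha.norm_le (norm_nonneg _) (by norm_num)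
      simpa using this
    have h2 := norm_sub_le (a * b * a - a * b) (b * a)
    have h3 := norm_sub_le (a * b * a) (a * b)
    linarith
  have hhn : ‖h‖ ≤ 2 := by
    have := norm_add_le (h - b) b
    rw [sub_add_cancel] at this
    have := hb.norm_le
    linarith
  have hhh : ‖h * h - h‖ ≤ 3 / 20 := by
    have e1 : h * h - h = h * (h - b) + (h - b) * b + (b - h) := by
      rw [mul_sub, sub_mul, hib]; abel
    rw [e1]
    have h1 : ‖h * (h - b)‖ ≤ 6 / 100 := (norm_mul_le _ _).trans (by
      have := mul_le_mul hhn hhb (norm_nonneg _) (by norm_num)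
      linarith)
    have h2 : ‖(h - b) * b‖ ≤ 3 / 100 := (norm_mul_le _ _).trans (by
      have := mul_le_mul hhb hb.norm_le (norm_nonneg _) (by norm_num)
      linarith)
    have h3 := norm_add_le (h * (h - b) + (h - b) * b) (b - h)
    have h4 := norm_add_le (h * (h - b)) ((h - b) * b)
    rw [norm_sub_rev b h] at h3
    linarith
  have hhs : IsSelfAdjoint h := by
    change star h = h
    simp [hh, hsa, hsb, mul_assoc]
  obtain ⟨q, hq, hqh, hq0⟩ := exists_isStarProjection_near hhs (by norm_num) hhh
  have haq := hq0 a hah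
  have hqb : ‖q - b‖ ≤ 33 / 100 := by
    have := norm_add_le (q - h) (h - b)
    rw [sub_add_sub_cancel] at this
    linarith
  rw [← cstarRank_eq_of_norm_sub_lt hq hb (by linarith), ← cstarRank_add ha hq haq]
  refine (cstarRank_eq_of_norm_sub_lt (IsStarProjection.add_of_mul_eq_zero ha hq haq).1 he ?_).symm
  have e1 : a + q - e = (q - b) + (a + b - e) := by abel
  rw [e1]
  have := norm_add_le (q - b) (a + b - e)
  linarith

end MatrixRank

/-! ### Compression by an almost central projection -/

section Compression

variable {B : Type*} [CStarAlgebra B] {P : B}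

theorem norm_compress_le (hP : IsStarProjection P) (a : B) : ‖P * a * P‖ ≤ ‖a‖ :=
  calc _ ≤ ‖P‖ * ‖a‖ * ‖P‖ := by
        refine (norm_mul_le _ _).trans ?_
        gcongr
        exact norm_mul_le _ _
    _ ≤ 1 * ‖a‖ * 1 := by gcongr <;> exact hP.norm_le
    _ = ‖a‖ := by simp

/-- Compression by P is multiplicative up to the commutator of P with the second factor. The bound
is stated for approximants a', b' so that it can be iterated over longer products. -/
theorem norm_mul_sub_compress_le (hP : IsStarProjection P) {a b a' b' : B} {δ δ' ε : ℝ}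
    (ha : ‖a‖ ≤ 1) (hb : ‖b‖ ≤ 1) (ha' : ‖a' - P * a * P‖ ≤ δ) (hb' : ‖b' - P * b * P‖ ≤ δ')
    (hδ' : δ' ≤ 1) (hPb : ‖P * b - b * P‖ ≤ ε) :
    ‖a' * b' - P * (a * b) * P‖ ≤ 2 * δ + δ' + ε := by
  have hPi : P * P = P := hP.isIdempotentElem
  have hδ : 0 ≤ δ := (norm_nonneg _).trans ha'
  have e1 : a' * b' - P * (a * b) * P =
      (a' - P * a * P) * b' + P * a * P * (b' - P * b * P) + P * a * (P * b - b * P) * P := by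
    have : P * a * P * (P * b * P) = P * a * (P * b) * P := by
      simp only [← mul_assoc]; rw [mul_assoc (P * a) P P, hPi]
    rw [sub_mul, mul_sub, this, mul_sub, sub_mul]
    simp only [mul_assoc, hPi]
    abel
  have hbn : ‖b'‖ ≤ 2 := by
    have h1 := norm_add_le (b' - P * b * P) (P * b * P)
    rw [sub_add_cancel] at h1
    have := norm_compress_le hP b
    linarith
  have h1 : ‖(a' - P * a * P) * b'‖ ≤ δ * 2 :=
    (norm_mul_le _ _).trans (mul_le_mul ha' hbn (norm_nonneg _) hδ)
  have h2 : ‖P * a * P * (b' - P * b * P)‖ ≤ 1 * δ' :=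
    (norm_mul_le _ _).trans (mul_le_mul ((norm_compress_le hP a).trans ha) hb' (norm_nonneg _)
      zero_le_one)
  have h3 : ‖P * a * (P * b - b * P) * P‖ ≤ ε := by
    have e2 : P * a * (P * b - b * P) * P = P * (a * (P * b - b * P)) * P := by
      simp only [mul_assoc]
    rw [e2]
    refine (norm_compress_le hP _).trans ((norm_mul_le _ _).trans ?_)
    calc ‖a‖ * ‖P * b - b * P‖ ≤ 1 * ε := mul_le_mul ha hPb (norm_nonneg _) zero_le_one
      _ = ε := one_mul ε
  rw [e1]
  have h4 := norm_add_le ((a' - P * a * P) * b' + P * a * P * (b' - P * b * P))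
    (P * a * (P * b - b * P) * P)
  have h5 := norm_add_le ((a' - P * a * P) * b') (P * a * P * (b' - P * b * P))
  linarith

/-- Approximate compression of a projection that almost commutes with `P`. -/
theorem exists_projection_near_compress (hP : IsStarProjection P)
    {S : NonUnitalStarSubalgebra ℂ B} (hS : IsClosed (S : Set B)) {e : B}
    (he : IsStarProjection e) {ε : ℝ} (hε : ε ≤ 1 / 100) (hPe : ‖P * e - e * P‖ ≤ ε)
    (hd : Metric.infDist (P * e * P) (S : Set B) < ε) :
    ∃ e' ∈ S, IsStarProjection e' ∧ ‖e' - P * e * P‖ ≤ 11 * ε ∧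
      ∃ e'' : B, IsStarProjection e'' ∧ P * e'' = 0 ∧ ‖e - (e' + e'')‖ < 1 := by
  have hs : star e = e := he.isSelfAdjoint
  have hi : e * e = e := he.isIdempotentElem
  have hPs : star P = P := hP.isSelfAdjoint
  have hPi : P * P = P := hP.isIdempotentElem
  have hen := he.norm_le
  obtain ⟨b, hbS, hb⟩ := (Metric.infDist_lt_iff ⟨0, S.zero_mem⟩).1 hd
  rw [dist_comm, dist_eq_norm] at hb
  -- The compression is selfadjoint, so averaging with the adjoint gives a selfadjoint approximant
  -- in S at no loss.
  obtain ⟨h, hh⟩ : ∃ h : S, (h : B) = (1 / 2 : ℂ) • (b + star b) :=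
    ⟨⟨_, SMulMemClass.smul_mem _ (add_mem hbS (star_mem hbS))⟩, rfl⟩
  have hcs : star (P * e * P) = P * e * P := by simp [hs, hPs, mul_assoc]
  have hhc : ‖(h : B) - P * e * P‖ ≤ ε := by
    have e1 : (h : B) - P * e * P =
        (1 / 2 : ℂ) • ((b - P * e * P) + star (b - P * e * P)) := by
      rw [hh, star_sub, hcs]
      have e2 : P * e * P = (1 / 2 : ℂ) • (P * e * P + P * e * P) := by
        rw [← two_smul ℂ, smul_smul]; norm_num
      conv_lhs => rw [e2]
      rw [← smul_sub]
      congr 1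
      abel
    rw [e1, norm_smul]
    have h1 := norm_add_le (b - P * e * P) (star (b - P * e * P))
    rw [norm_star] at h1
    have h2 : ‖(1 / 2 : ℂ)‖ = 1 / 2 := by norm_num
    rw [h2]
    linarith
  have hhs : IsSelfAdjoint h := by
    apply Subtype.ext
    change star (h : B) = h
    rw [hh, star_smul, star_add, star_star, add_comm]
    norm_num
  have hcomp := norm_mul_sub_compress_le hP hen hen (a' := P * e * P) (b' := P * e * P)
    (δ := 0) (δ' := 0) (by simp) (by simp) zero_le_one hPe
  rw [hi] at hcomp
  have hhh : ‖(h : B) * h - h‖ ≤ 5 * ε := by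
    have h1 := norm_mul_sub_compress_le hP hen hen hhc hhc (by linarith) hPe
    rw [hi] at h1
    have h2 := norm_sub_le ((h : B) * h - P * e * P) (h - P * e * P)
    rw [sub_sub_sub_cancel_right] at h2
    linarith
  obtain ⟨q, hq, hqh⟩ : ∃ q : S, IsStarProjection (q : B) ∧ ‖(q : B) - h‖ ≤ 10 * ε := by
    have hSc : IsClosed (S : Set B) := hS
    obtain ⟨q, hq, hqh, -⟩ := exists_isStarProjection_near (S := S) hhs
      (δ := 5 * ε) (by linarith) hhh
    refine ⟨q, ⟨congrArg Subtype.val hq.isIdempotentElem,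
      congrArg Subtype.val hq.isSelfAdjoint⟩, ?_⟩
    have : ‖(q : B) - h‖ ≤ 2 * (5 * ε) := hqh
    linarith
  have hqe : ‖(q : B) - P * e * P‖ ≤ 11 * ε := by
    have := norm_add_le ((q : B) - h) (h - P * e * P)
    rw [sub_add_sub_cancel] at this
    linarith
  refine ⟨q, q.2, hq, hqe, ?_⟩
  -- The complementary corner (1 - P) e (1 - P) is also almost idempotent and yields e''. The
  -- off-diagonal parts of e are commutators with P, so the total error is at most 15ε < 1.
  have hP' : IsStarProjection (1 - P) := hP.one_sub
  have hPe' : ‖(1 - P) * e - e * (1 - P)‖ ≤ ε := by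
    have e1 : (1 - P) * e - e * (1 - P) = -(P * e - e * P) := by
      rw [sub_mul, mul_sub]; simp
    rwa [e1, norm_neg]
  have hcomp' := norm_mul_sub_compress_le hP' hen hen (a' := (1 - P) * e * (1 - P))
    (b' := (1 - P) * e * (1 - P)) (δ := 0) (δ' := 0) (by simp) (by simp) zero_le_one hPe'
  rw [hi] at hcomp'
  have hsa : IsSelfAdjoint ((1 - P) * e * (1 - P)) := by
    change star _ = _
    simp [hs, hPs, mul_assoc]
  obtain ⟨r, hr, hrh, hr0⟩ := exists_isStarProjection_near hsa (δ := ε) (by linarith)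
    (by linarith)
  refine ⟨r, hr, hr0 P ?_, ?_⟩
  · rw [← mul_assoc, ← mul_assoc, mul_sub P 1 P, hPi]; simp
  · have e1 : e - (q + r) = (P * e - e * P) * (1 - P) - (1 - P) * (P * e - e * P)
        - (q - P * e * P) - (r - (1 - P) * e * (1 - P)) := by
      have h1 : (P * e - e * P) * (1 - P) = P * e - P * e * P := by
        rw [mul_sub, mul_one, sub_mul, mul_assoc e, hPi]; abel
      have h2 : (1 - P) * (P * e - e * P) = - e * P + P * e * P := by
        rw [sub_mul, one_mul, mul_sub, ← mul_assoc, hPi, ← mul_assoc, neg_mul]; abel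
      have h3 : (1 - P) * e * (1 - P) = e - P * e - e * P + P * e * P := by
        rw [sub_mul, sub_mul, mul_sub, mul_sub, one_mul, mul_one, mul_one]; abel
      rw [h1, h2, h3, neg_mul]; abel
    rw [e1]
    have h1 : ‖(P * e - e * P) * (1 - P)‖ ≤ ε * 1 :=
      (norm_mul_le _ _).trans (mul_le_mul hPe hP'.norm_le (norm_nonneg _)
        ((norm_nonneg _).trans hPe))
    have h2 : ‖(1 - P) * (P * e - e * P)‖ ≤ 1 * ε :=
      (norm_mul_le _ _).trans (mul_le_mul hP'.norm_le hPe (norm_nonneg _) zero_le_one)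
    have h3 := norm_sub_le ((P * e - e * P) * (1 - P)) ((1 - P) * (P * e - e * P))
    have h4 := norm_sub_le ((P * e - e * P) * (1 - P) - (1 - P) * (P * e - e * P))
      (q - P * e * P)
    have h5 := norm_sub_le ((P * e - e * P) * (1 - P) - (1 - P) * (P * e - e * P)
      - (q - P * e * P)) (r - (1 - P) * e * (1 - P))
    linarith

end Compression

/-! ### Charts by homogeneous subalgebras and ranks of approximate compressions -/

section Charts

open Matrix

/-- A C*-subalgebra of `B` isomorphic to a corner `Q M_R(C(X)) Q`, with `X` a compact Hausdorff
space of finite covering dimension. -/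
structure HomogeneousChart (B : Type*) [CStarAlgebra B] where
  d : ℕ
  X : Type
  [top : TopologicalSpace X]
  [compact : CompactSpace X]
  [t2 : T2Space X]
  dim_le : CoveringDimLE X d
  R : Type
  [fin : Fintype R]
  Q : Matrix R R C(X, ℂ)
  isProj : IsStarProjection Q
  S : NonUnitalStarSubalgebra ℂ B
  isClosed : IsClosed (S : Set B)
  P : S
  isProj_P : IsStarProjection (P : B)
  unit_mul : ∀ s ∈ S, (P : B) * s = s ∧ s * P = s
  π : S →⋆ₙₐ[ℂ] Matrix R R C(X, ℂ)
  injective : Function.Injective π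
  surjective : ∀ T : Matrix R R C(X, ℂ), Q * T = T → T * Q = T → ∃ s, π s = T
  map_unit : π P = Q

attribute [instance] HomogeneousChart.top HomogeneousChart.compact HomogeneousChart.t2
  HomogeneousChart.fin

namespace HomogeneousChart

variable {B : Type*} [CStarAlgebra B] (D : HomogeneousChart B)

/-- Evaluation of the elements of the subalgebra at a point. -/
noncomputable def evalHom (x : D.X) : D.S →⋆ₙₐ[ℂ] CStarMatrix D.R D.R ℂ where
  toFun s := CStarMatrix.ofMatrix (evalMatrix x (D.π s))
  map_smul' c s := by
    rw [map_smul]; ext i j; simp [evalMatrix]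
  map_zero' := by
    rw [map_zero]; ext i j; simp [evalMatrix]
  map_add' s t := by
    rw [map_add, evalMatrix_add]; rfl
  map_mul' s t := by
    rw [map_mul, evalMatrix_mul]; rfl
  map_star' s := by
    rw [map_star]
    exact congrArg CStarMatrix.ofMatrix (evalMatrix_conjTranspose x (D.π s))

open scoped ComplexOrder in
theorem norm_evalHom_le [DecidableEq D.R] (x : D.X) (s : D.S) :
    ‖D.evalHom x s‖ ≤ ‖(s : B)‖ := by
  have hS : IsClosed (D.S : Set B) := D.isClosed
  exact NonUnitalStarAlgHom.norm_apply_le (D.evalHom x) s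

/-- The projection `e'` of the subalgebra is close to the compression of `e`. -/
def IsNear (e : B) (e' : D.S) : Prop :=
  IsStarProjection (e' : B) ∧ ‖(e' : B) - D.P * e * D.P‖ ≤ 11 / 10000

/-- The element `b` is almost in the subalgebra after compression by its unit. -/
def AlmostContains (b : B) : Prop :=
  ‖(D.P : B) * b - b * D.P‖ ≤ 1 / 10000 ∧ Metric.infDist (D.P * b * D.P) (D.S : Set B) < 1 / 10000

variable {D}

theorem AlmostContains.exists_near {b : B} (h : D.AlmostContains b) :
    ∃ b' : D.S, ‖(b' : B) - D.P * b * D.P‖ ≤ 1 / 10000 := by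
  obtain ⟨b', hbS, hb⟩ := (Metric.infDist_lt_iff ⟨0, D.S.zero_mem⟩).1 h.2
  rw [dist_comm, dist_eq_norm] at hb
  exact ⟨⟨b', hbS⟩, hb.le⟩

theorem isStarProjection_of_coe {e' : D.S} (h : IsStarProjection (e' : B)) :
    IsStarProjection e' :=
  ⟨Subtype.ext h.isIdempotentElem, Subtype.ext h.isSelfAdjoint⟩

theorem isStarProjection_evalHom {e' : D.S} (h : IsStarProjection (e' : B)) (x : D.X) :
    IsStarProjection (D.evalHom x e') :=
  (isStarProjection_of_coe h).map (D.evalHom x)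

theorem isStarProjection_π {e' : D.S} (h : IsStarProjection (e' : B)) :
    IsStarProjection (D.π e') :=
  (isStarProjection_of_coe h).map D.π

/-- The identity e = e v f v* e persists approximately for the approximants in the subalgebra.
Evaluation at a point is contractive, so at each point the matrix of e' is close to a product with
the matrix of f' as a factor. -/
theorem rank_le_of_mvn {e f v : B} (he : IsStarProjection e) (hf : IsStarProjection f)
    (h1 : v * star v = e) (h2 : star v * v = f)
    (hPe : ‖(D.P : B) * e - e * D.P‖ ≤ 1 / 10000) (hPf : ‖(D.P : B) * f - f * D.P‖ ≤ 1 / 10000)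
    (hv : D.AlmostContains v) {e' f' : D.S} (he' : D.IsNear e e') (hf' : D.IsNear f f')
    (x : D.X) : (evalMatrix x (D.π e')).rank ≤ (evalMatrix x (D.π f')).rank := by
  classical
  obtain ⟨v', hv'⟩ := hv.exists_near
  have hi : e * e = e := he.isIdempotentElem
  have hPs : star (D.P : B) = D.P := D.isProj_P.isSelfAdjoint
  have hvn : ‖v‖ ≤ 1 := by
    have h3 : ‖v * star v‖ = ‖v‖ * ‖v‖ := CStarRing.norm_self_mul_star
    rw [h1] at h3
    have := he.norm_le
    nlinarith [norm_nonneg v]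
  have hvs : ‖star v‖ ≤ 1 := by rwa [norm_star]
  have hPvs : ‖(D.P : B) * star v - star v * D.P‖ ≤ 1 / 10000 := by
    have e1 : (D.P : B) * star v - star v * D.P = -star (D.P * v - v * D.P) := by
      rw [star_sub, star_mul, star_mul, hPs]; abel
    rw [e1, norm_neg, norm_star]
    exact hv.1
  have hv's : ‖star (v' : B) - D.P * star v * D.P‖ ≤ 1 / 10000 := by
    have e1 : star (v' : B) - D.P * star v * D.P = star ((v' : B) - D.P * v * D.P) := by
      rw [star_sub, star_mul, star_mul, hPs, mul_assoc]
    rw [e1, norm_star]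
    exact hv'
  have prod : ∀ {a b : B}, ‖a‖ ≤ 1 → ‖b‖ ≤ 1 → ‖a * b‖ ≤ 1 := fun {a b} ha hb =>
    (norm_mul_le _ _).trans (mul_le_one₀ ha (norm_nonneg _) hb)
  -- In units of 1/10000 the errors of the successive partial products are 24, 60, 122 and 256;
  -- comparing e' with PeP adds another 11, far below 1.
  have n1 := norm_mul_sub_compress_le D.isProj_P he.norm_le hvn he'.2 hv' (by norm_num) hv.1
  have n2 := norm_mul_sub_compress_le D.isProj_P (prod he.norm_le hvn) hf.norm_le n1 hf'.2
    (by norm_num) hPf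
  have n3 := norm_mul_sub_compress_le D.isProj_P (prod (prod he.norm_le hvn) hf.norm_le) hvs n2
    hv's (by norm_num) hPvs
  have n4 := norm_mul_sub_compress_le D.isProj_P
    (prod (prod (prod he.norm_le hvn) hf.norm_le) hvs) he.norm_le n3 he'.2 (by norm_num) hPe
  have e1 : e * v * f * star v * e = e := by
    have : e * v * f * star v * e = e * ((v * star v) * (v * star v)) * e := by
      rw [← h2]; simp only [mul_assoc]
    rw [this, h1, hi, hi, hi]
  rw [e1] at n4
  have n5 : ‖(e' : B) * v' * f' * star (v' : B) * e' - e'‖ < 1 := by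
    have := norm_sub_le ((e' : B) * v' * f' * star (v' : B) * e' - D.P * e * D.P)
      (e' - D.P * e * D.P)
    rw [sub_sub_sub_cancel_right] at this
    have := he'.2
    linarith
  have n6 := (D.norm_evalHom_le x (e' * v' * f' * star v' * e' - e')).trans_lt n5
  rw [map_sub, map_mul, map_mul, map_mul, map_mul] at n6
  exact cstarRank_le_of_norm_lt (isStarProjection_evalHom he'.1 x).isIdempotentElem n6

theorem rank_eq_of_mvn {e f v : B} (he : IsStarProjection e) (hf : IsStarProjection f)
    (h1 : v * star v = e) (h2 : star v * v = f)
    (hPe : ‖(D.P : B) * e - e * D.P‖ ≤ 1 / 10000) (hPf : ‖(D.P : B) * f - f * D.P‖ ≤ 1 / 10000)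
    (hv : D.AlmostContains v) (hvs : D.AlmostContains (star v)) {e' f' : D.S}
    (he' : D.IsNear e e') (hf' : D.IsNear f f') (x : D.X) :
    (evalMatrix x (D.π e')).rank = (evalMatrix x (D.π f')).rank :=
  le_antisymm (rank_le_of_mvn he hf h1 h2 hPe hPf hv he' hf' x)
    (rank_le_of_mvn (v := star v) hf he (by rwa [star_star]) (by rwa [star_star]) hPf hPe hvs
      hf' he' x)

theorem rank_eq_add_of_orthogonal {a b : B} (ha : IsStarProjection a) (hb : IsStarProjection b)
    (hab : a * b = 0) (hPb : ‖(D.P : B) * b - b * D.P‖ ≤ 1 / 10000)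
    {a' b' e' : D.S} (ha' : D.IsNear a a') (hb' : D.IsNear b b') (he' : D.IsNear (a + b) e')
    (x : D.X) : (evalMatrix x (D.π e')).rank =
      (evalMatrix x (D.π a')).rank + (evalMatrix x (D.π b')).rank := by
  classical
  have n1 := norm_mul_sub_compress_le D.isProj_P ha.norm_le hb.norm_le ha'.2 hb'.2 (by norm_num) hPb
  rw [hab, mul_zero, zero_mul, sub_zero] at n1
  have n2 : ‖(a' : B) + b' - e'‖ ≤ 1 / 100 := by
    have e1 : (a' : B) + b' - e' = (a' - D.P * a * D.P) + (b' - D.P * b * D.P)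
        - (e' - D.P * (a + b) * D.P) := by
      rw [mul_add, add_mul]; abel
    rw [e1]
    have h1 := norm_sub_le (((a' : B) - D.P * a * D.P) + (b' - D.P * b * D.P))
      (e' - D.P * (a + b) * D.P)
    have h2 := norm_add_le ((a' : B) - D.P * a * D.P) (b' - D.P * b * D.P)
    have := ha'.2
    have := hb'.2
    have := he'.2
    linarith
  have m1 := (D.norm_evalHom_le x (a' * b')).trans (n1.trans (by norm_num : _ ≤ (1 / 100 : ℝ)))
  have m2 := (D.norm_evalHom_le x (a' + b' - e')).trans n2
  rw [map_mul] at m1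
  rw [map_sub, map_add] at m2
  exact cstarRank_eq_add_of_norm_le (isStarProjection_evalHom ha'.1 x)
    (isStarProjection_evalHom hb'.1 x) (isStarProjection_evalHom he'.1 x) m1 m2

theorem AlmostContains.exists_isNear {e : B} (h : D.AlmostContains e) (he : IsStarProjection e) :
    ∃ e' : D.S, D.IsNear e e' ∧ ∃ e'' : B, IsStarProjection e'' ∧ (D.P : B) * e'' = 0 ∧
      ‖e - (e' + e'')‖ < 1 := by
  obtain ⟨e', hS, h1, h2, h3⟩ := exists_projection_near_compress D.isProj_P D.isClosed he
    (by norm_num : (1 / 10000 : ℝ) ≤ 1 / 100) h.1 h.2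
  exact ⟨⟨e', hS⟩, ⟨h1, by norm_num at h2 ⊢; exact h2⟩, h3⟩

end HomogeneousChart

end Charts

/-! ### Passage from charts of A to charts of matrix algebras -/

section Amplification

open Matrix
open scoped Kronecker

variable {A : Type*} [CStarAlgebra A]

namespace CStarMatrix

variable {n : Type*} [Fintype n] [DecidableEq n]

/-- The matrix with the single entry `c` at position `(i, j)`. -/
def matrixUnit (i j : n) (c : A) : CStarMatrix n n A := ofMatrix (Matrix.single i j c)

/-- The diagonal matrix with all diagonal entries equal to `p`. -/
def diag (n : Type*) [DecidableEq n] (p : A) : CStarMatrix n n A :=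
  ofMatrix (Matrix.diagonal fun _ => p)

theorem diag_mul_apply (p : A) (M : CStarMatrix n n A) (i j : n) :
    (diag n p * M) i j = p * M i j := Matrix.diagonal_mul _ _ i j

theorem mul_diag_apply (p : A) (M : CStarMatrix n n A) (i j : n) :
    (M * diag n p) i j = M i j * p := Matrix.mul_diagonal _ _ i j

theorem isStarProjection_diag {p : A} (hp : IsStarProjection p) :
    IsStarProjection (diag n p) := by
  refine ⟨?_, ?_⟩
  · refine CStarMatrix.ext fun i j => ?_
    rw [diag_mul_apply]
    by_cases h : i = j
    · subst h
      have : diag n p i i = p := Matrix.diagonal_apply_eq _ i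
      rw [this]; exact hp.isIdempotentElem
    · have : diag n p i j = 0 := Matrix.diagonal_apply_ne _ h
      rw [this, mul_zero]
  · change (Matrix.diagonal fun _ => p)ᴴ = Matrix.diagonal fun _ => p
    rw [Matrix.diagonal_conjTranspose]
    congr 1
    ext i
    exact hp.isSelfAdjoint

end CStarMatrix

/-- The matrices with entries in a `*`-subalgebra. -/
def NonUnitalStarSubalgebra.cstarMatrix (C : NonUnitalStarSubalgebra ℂ A) (n : Type*) [Fintype n] :
    NonUnitalStarSubalgebra ℂ (CStarMatrix n n A) where
  carrier := {M | ∀ i j, M i j ∈ C}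
  add_mem' ha hb i j := add_mem (ha i j) (hb i j)
  zero_mem' i j := zero_mem C
  mul_mem' {a b} ha hb i j := by
    rw [CStarMatrix.mul_apply]
    exact sum_mem fun k _ => mul_mem (ha i k) (hb k j)
  smul_mem' c {a} ha i j := SMulMemClass.smul_mem c (ha i j)
  star_mem' {a} ha i j := by
    rw [CStarMatrix.star_apply]
    exact star_mem (ha j i)

theorem NonUnitalStarSubalgebra.isClosed_cstarMatrix {C : NonUnitalStarSubalgebra ℂ A}
    (hC : IsClosed (C : Set A)) (n : Type*) [Fintype n] :
    IsClosed (C.cstarMatrix n : Set (CStarMatrix n n A)) := by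
  have : (C.cstarMatrix n : Set (CStarMatrix n n A)) =
      ⋂ i, ⋂ j, {M : CStarMatrix n n A | M i j ∈ (C : Set A)} := by
    ext M
    simp only [Set.mem_iInter]
    rfl
  rw [this]
  refine isClosed_iInter fun i => isClosed_iInter fun j => hC.preimage ?_
  have h : Continuous fun M : CStarMatrix n n A => CStarMatrix.ofMatrixL.symm M :=
    CStarMatrix.ofMatrixL.symm.continuous
  exact (continuous_apply j).comp ((continuous_apply i).comp h)

variable [PartialOrder A] [StarOrderedRing A]

namespace CStarMatrix

variable {n : Type*} [Fintype n] [DecidableEq n]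

/-- The embedding at a diagonal position is a *-homomorphism, hence contractive. The C*-identity
reduces the other positions to this case. -/
theorem norm_matrixUnit_le (i j : n) (c : A) : ‖matrixUnit i j c‖ ≤ ‖c‖ := by
  have h1 : ∀ (k : n) (a : A), ‖matrixUnit k k a‖ ≤ ‖a‖ := by
    intro k a
    let φ : A →⋆ₙₐ[ℂ] CStarMatrix n n A :=
      { toFun := matrixUnit k k
        map_smul' := fun r x => congrArg ofMatrix (Matrix.smul_single r k k x).symm
        map_zero' := congrArg ofMatrix (Matrix.single_zero k k)
        map_add' := fun x y => congrArg ofMatrix (Matrix.single_add k k x y)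
        map_mul' := fun x y =>
          congrArg ofMatrix (Matrix.single_mul_single_same (c := x) (d := y) k k k).symm
        map_star' := fun x => congrArg ofMatrix (Matrix.conjTranspose_single k k x).symm }
    exact NonUnitalStarAlgHom.norm_apply_le φ a
  have h2 : star (matrixUnit i j c) * matrixUnit i j c = matrixUnit j j (star c * c) := by
    change (Matrix.single i j c)ᴴ * Matrix.single i j c = _
    rw [Matrix.conjTranspose_single, Matrix.single_mul_single_same]
    rfl
  have h3 : ‖matrixUnit i j c‖ * ‖matrixUnit i j c‖ ≤ ‖c‖ * ‖c‖ := by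
    rw [← CStarRing.norm_star_mul_self, h2, ← CStarRing.norm_star_mul_self]
    exact h1 j _
  exact abs_le_of_sq_le_sq' (by nlinarith) (norm_nonneg c) |>.2

theorem norm_le_of_entries_le {M : CStarMatrix n n A} {ε : ℝ} (h : ∀ i j, ‖M i j‖ ≤ ε) :
    ‖M‖ ≤ (Fintype.card n : ℝ) * (Fintype.card n) * ε := by
  have e : M = ∑ i, ∑ j, matrixUnit i j (M i j) := Matrix.matrix_eq_sum_single M
  rw [e]
  calc ‖∑ i, ∑ j, matrixUnit i j (M i j)‖ ≤ ∑ i : n, ∑ j : n, ε := by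
        refine (norm_sum_le _ _).trans (Finset.sum_le_sum fun i _ => ?_)
        refine (norm_sum_le _ _).trans (Finset.sum_le_sum fun j _ => ?_)
        exact (norm_matrixUnit_le i j _).trans (h i j)
    _ = _ := by simp [mul_assoc]

end CStarMatrix

theorem IsStarProjection.one_kronecker {A : Type*} [CommRing A] [StarRing A] {R : Type*}
    [Fintype R] {Q : Matrix R R A} (hQ : IsStarProjection Q) (n : Type*) [Fintype n]
    [DecidableEq n] : IsStarProjection ((1 : Matrix n n A) ⊗ₖ Q) := by
  have hi : Q * Q = Q := hQ.isIdempotentElem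
  refine ⟨?_, ?_⟩
  · change (1 ⊗ₖ Q) * (1 ⊗ₖ Q) = _
    rw [← Matrix.mul_kronecker_mul, hi, Matrix.one_mul]
  · change (1 ⊗ₖ Q)ᴴ = _
    rw [Matrix.conjTranspose_kronecker, hQ.conjTranspose_eq, Matrix.conjTranspose_one]

theorem rank_evalMatrix_one_kronecker {X : Type*} [TopologicalSpace X] {R : Type*} [Fintype R]
    {Q : Matrix R R C(X, ℂ)} (hQ : IsStarProjection Q) (n : Type*) [Fintype n] [DecidableEq n]
    (x : X) : (evalMatrix x ((1 : Matrix n n C(X, ℂ)) ⊗ₖ Q)).rank =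
      Fintype.card n * (evalMatrix x Q).rank := by
  have h1 := trace_eq_rank_of_isIdempotentElem (hQ.evalMatrix x).isIdempotentElem
  have h2 := trace_eq_rank_of_isIdempotentElem
    ((hQ.one_kronecker n).evalMatrix x).isIdempotentElem
  have h3 : evalMatrix x ((1 : Matrix n n C(X, ℂ)) ⊗ₖ Q) =
      (1 : Matrix n n ℂ) ⊗ₖ evalMatrix x Q := by
    rw [← evalMatrix_one x]
    ext ⟨i, k⟩ ⟨j, l⟩
    simp [evalMatrix]
  rw [h3, Matrix.trace_kronecker, h1, Matrix.trace_one] at h2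
  rw [h3]
  exact_mod_cast h2.symm

namespace HomogeneousChart

/-- The amplification of a chart of `A` to the matrices over `A`. -/
noncomputable def amplify (D : HomogeneousChart A) (N : ℕ) :
    HomogeneousChart (CStarMatrix (Fin N) (Fin N) A) where
  d := D.d
  X := D.X
  dim_le := D.dim_le
  R := Fin N × D.R
  Q := 1 ⊗ₖ D.Q
  isProj := D.isProj.one_kronecker _
  S := D.S.cstarMatrix (Fin N)
  isClosed := NonUnitalStarSubalgebra.isClosed_cstarMatrix D.isClosed _
  P := ⟨CStarMatrix.diag (Fin N) (D.P : A), fun i j => by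
    by_cases h : i = j
    · subst h
      have : CStarMatrix.diag (Fin N) (D.P : A) i i = D.P := Matrix.diagonal_apply_eq _ i
      rw [this]; exact D.P.2
    · have : CStarMatrix.diag (Fin N) (D.P : A) i j = 0 := Matrix.diagonal_apply_ne _ h
      rw [this]; exact zero_mem _⟩
  isProj_P := CStarMatrix.isStarProjection_diag D.isProj_P
  unit_mul s hs := by
    constructor
    · refine CStarMatrix.ext fun i j => ?_
      rw [CStarMatrix.diag_mul_apply, (D.unit_mul _ (hs i j)).1]
    · refine CStarMatrix.ext fun i j => ?_
      rw [CStarMatrix.mul_diag_apply, (D.unit_mul _ (hs i j)).2]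
  π :=
    { toFun := fun M a b => D.π ⟨M.1 a.1 b.1, M.2 a.1 b.1⟩ a.2 b.2
      map_smul' := fun c M => by
        ext1 a b
        exact congrFun (congrFun (map_smul D.π c ⟨M.1 a.1 b.1, M.2 a.1 b.1⟩) a.2) b.2
      map_zero' := by
        ext1 a b
        exact congrFun (congrFun (map_zero D.π) a.2) b.2
      map_add' := fun M M' => by
        ext1 a b
        exact congrFun (congrFun (map_add D.π ⟨M.1 a.1 b.1, M.2 a.1 b.1⟩
          ⟨M'.1 a.1 b.1, M'.2 a.1 b.1⟩) a.2) b.2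
      map_mul' := fun M M' => by
        ext1 a b
        have e : (⟨(M * M').1 a.1 b.1, (M * M').2 a.1 b.1⟩ : D.S) =
            ∑ k, ⟨M.1 a.1 k, M.2 a.1 k⟩ * ⟨M'.1 k b.1, M'.2 k b.1⟩ := by
          apply Subtype.ext
          rw [AddSubmonoidClass.coe_finsetSum]
          exact CStarMatrix.mul_apply
        change D.π ⟨(M * M').1 a.1 b.1, (M * M').2 a.1 b.1⟩ a.2 b.2 =
          ∑ c : Fin N × D.R, D.π ⟨M.1 a.1 c.1, M.2 a.1 c.1⟩ a.2 c.2 *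
            D.π ⟨M'.1 c.1 b.1, M'.2 c.1 b.1⟩ c.2 b.2
        rw [e, map_sum, Matrix.sum_apply, Fintype.sum_prod_type]
        refine Finset.sum_congr rfl fun k _ => ?_
        rw [map_mul, Matrix.mul_apply]
      map_star' := fun M => by
        ext1 a b
        exact congrFun (congrFun (map_star D.π ⟨M.1 b.1 a.1, M.2 b.1 a.1⟩) a.2) b.2 }
  injective M M' h := by
    apply Subtype.ext
    refine CStarMatrix.ext fun i j => ?_
    have : (⟨M.1 i j, M.2 i j⟩ : D.S) = ⟨M'.1 i j, M'.2 i j⟩ := by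
      apply D.injective
      ext1 k l
      exact congrFun (congrFun h (i, k)) (j, l)
    exact congrArg Subtype.val this
  surjective T h1 h2 := by
    have key : ∀ i j, ∃ s : D.S, D.π s = fun k l => T (i, k) (j, l) := by
      intro i j
      refine D.surjective _ ?_ ?_
      · ext1 k l
        have := congrFun (congrFun h1 (i, k)) (j, l)
        simp only [Matrix.mul_apply, Fintype.sum_prod_type, Matrix.kroneckerMap_apply,
          Matrix.one_apply, ite_mul, one_mul, zero_mul, Finset.sum_ite_irrel,
          Finset.sum_const_zero, Finset.sum_ite_eq, Finset.mem_univ, if_true] at this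
        exact this
      · ext1 k l
        have := congrFun (congrFun h2 (i, k)) (j, l)
        simp only [Matrix.mul_apply, Fintype.sum_prod_type, Matrix.kroneckerMap_apply,
          Matrix.one_apply, ite_mul, mul_ite, one_mul, zero_mul, mul_zero, Finset.sum_ite_irrel,
          Finset.sum_const_zero, Finset.sum_ite_eq', Finset.mem_univ, if_true] at this
        exact this
    choose s hs using key
    refine ⟨⟨CStarMatrix.ofMatrix fun i j => (s i j : A), fun i j => (s i j).2⟩, ?_⟩
    ext1 a b
    exact congrFun (congrFun (hs a.1 b.1) a.2) b.2
  map_unit := by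
    ext1 ⟨i, k⟩ ⟨j, l⟩
    rw [Matrix.kroneckerMap_apply]
    by_cases h : i = j
    · subst h
      rw [Matrix.one_apply_eq, one_mul, ← D.map_unit]
      refine congrFun (congrFun (congrArg D.π (Subtype.ext ?_)) k) l
      exact Matrix.diagonal_apply_eq _ i
    · rw [Matrix.one_apply_ne h, zero_mul]
      have e : (⟨CStarMatrix.diag (Fin N) (D.P : A) i j, by
          have : CStarMatrix.diag (Fin N) (D.P : A) i j = 0 := Matrix.diagonal_apply_ne _ h
          rw [this]; exact zero_mem _⟩ : D.S) = 0 :=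
        Subtype.ext (Matrix.diagonal_apply_ne _ h)
      have e2 := congrFun (congrFun ((congrArg D.π e).trans (map_zero D.π)) k) l
      exact e2

theorem almostContains_amplify {D : HomogeneousChart A} {N : ℕ}
    {b : CStarMatrix (Fin N) (Fin N) A}
    (h1 : ∀ i j, ‖(D.P : A) * b i j - b i j * D.P‖ < 1 / (10000 * (N * N + 1)))
    (h2 : ∀ i j, Metric.infDist (D.P * b i j * D.P) (D.S : Set A) < 1 / (10000 * (N * N + 1))) :
    (D.amplify N).AlmostContains b := by
  have hlt : (N : ℝ) * N * (1 / (10000 * (N * N + 1))) < 1 / 10000 := by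
    have : (0 : ℝ) < N * N + 1 := by positivity
    rw [mul_one_div, div_lt_div_iff₀ (by positivity) (by norm_num)]
    nlinarith
  constructor
  · have := CStarMatrix.norm_le_of_entries_le
      (M := ((D.amplify N).P : CStarMatrix (Fin N) (Fin N) A) * b -
        b * ((D.amplify N).P : CStarMatrix (Fin N) (Fin N) A))
      (ε := 1 / (10000 * (N * N + 1))) (fun i j => by
        change ‖(CStarMatrix.diag (Fin N) (D.P : A) * b) i j -
          (b * CStarMatrix.diag (Fin N) (D.P : A)) i j‖ ≤ _
        rw [CStarMatrix.diag_mul_apply, CStarMatrix.mul_diag_apply]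
        exact (h1 i j).le)
    rw [Fintype.card_fin] at this
    exact this.trans hlt.le
  · have h3 : ∀ i j, ∃ c : D.S, ‖(D.P : A) * b i j * D.P - c‖ < 1 / (10000 * (N * N + 1)) := by
      intro i j
      obtain ⟨c, hc, hd⟩ := (Metric.infDist_lt_iff ⟨0, D.S.zero_mem⟩).1 (h2 i j)
      rw [dist_eq_norm] at hd
      exact ⟨⟨c, hc⟩, hd⟩
    choose c hc using h3
    refine (Metric.infDist_le_dist_of_mem
      (s := ((D.amplify N).S : Set (CStarMatrix (Fin N) (Fin N) A))) (y := CStarMatrix.ofMatrix fun i j => (c i j : A))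
      (fun i j => (c i j).2)).trans_lt ?_
    rw [dist_eq_norm]
    have := CStarMatrix.norm_le_of_entries_le
      (M := ((D.amplify N).P : CStarMatrix (Fin N) (Fin N) A) * b *
        ((D.amplify N).P : CStarMatrix (Fin N) (Fin N) A) -
        CStarMatrix.ofMatrix fun i j => (c i j : A))
      (ε := 1 / (10000 * (N * N + 1))) (fun i j => by
        change ‖(CStarMatrix.diag (Fin N) (D.P : A) * b * CStarMatrix.diag (Fin N) (D.P : A)) i j -
          (c i j : A)‖ ≤ _
        rw [CStarMatrix.mul_diag_apply, CStarMatrix.diag_mul_apply]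
        exact (hc i j).le)
    rw [Fintype.card_fin] at this
    exact this.trans_lt hlt

end HomogeneousChart

/-- Covering dimension is monotone for closed subspaces. -/
theorem CoveringDimLE.of_isClosed {Y : Type*} [TopologicalSpace Y] {d : ℕ}
    (hY : CoveringDimLE Y d) {X : Set Y} (hX : IsClosed X) : CoveringDimLE X d := by
  intro 𝒰 hf ho hc
  have hext : ∀ U : Set X, ∃ V : Set Y, IsOpen U → IsOpen V ∧ (↑) ⁻¹' V = U := by
    intro U
    by_cases hU : IsOpen U
    · obtain ⟨V, hV, h⟩ := isOpen_induced_iff.1 hU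
      exact ⟨V, fun _ => ⟨hV, h⟩⟩
    · exact ⟨∅, fun h => absurd h hU⟩
  choose V hV using hext
  obtain ⟨𝒱, h1, h2, h3, h4⟩ := hY (insert Xᶜ (V '' 𝒰)) ((hf.image _).insert _) (by
      rintro _ (rfl | ⟨U, hU, rfl⟩)
      · exact hX.isOpen_compl
      · exact (hV U (ho U hU)).1) (by
      refine Set.eq_univ_of_forall fun y => ?_
      by_cases hy : y ∈ X
      · obtain ⟨U, hU, hyU⟩ : (⟨y, hy⟩ : X) ∈ ⋃₀ 𝒰 := hc ▸ Set.mem_univ _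
        refine ⟨V U, Or.inr ⟨U, hU, rfl⟩, ?_⟩
        rw [← (hV U (ho U hU)).2] at hyU
        exact hyU
      · exact ⟨Xᶜ, Or.inl rfl, hy⟩)
  -- A member contained in the complement of X restricts to the empty set. Empty members are removed
  -- because the given cover of X may have no element to contain them, namely when X is empty.
  refine ⟨((fun W : Set Y => ((↑) ⁻¹' W : Set X)) '' 𝒱) \ {∅}, ?_, ?_, ?_, ?_⟩
  · rintro _ ⟨⟨W, hW, rfl⟩, -⟩
    exact (h1 W hW).preimage continuous_subtype_val
  · refine Set.eq_univ_of_forall fun x => ?_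
    obtain ⟨W, hW, hxW⟩ : (x : Y) ∈ ⋃₀ 𝒱 := h2 ▸ Set.mem_univ _
    exact ⟨_, ⟨⟨W, hW, rfl⟩, fun h => (Set.eq_empty_iff_forall_notMem.1 h) x hxW⟩, hxW⟩
  · rintro _ ⟨⟨W, hW, rfl⟩, hne⟩
    obtain ⟨U, hU, hWU⟩ := h3 W hW
    rcases hU with rfl | ⟨U, hU, rfl⟩
    · refine absurd (Set.eq_empty_iff_forall_notMem.2 fun x hx => ?_) hne
      exact hWU hx x.2
    · refine ⟨U, hU, fun x hx => ?_⟩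
      rw [← (hV U (ho U hU)).2]
      exact hWU hx
  · intro x
    refine le_trans ?_ (h4 x)
    refine le_trans (Set.encard_le_encard ?_)
      (Set.encard_image_le (fun W : Set Y => ((↑) ⁻¹' W : Set X)) {V ∈ 𝒱 | (x : Y) ∈ V})
    rintro _ ⟨⟨⟨W, hW, rfl⟩, -⟩, hx⟩
    exact ⟨W, ⟨hW, hx⟩, rfl⟩

/-- The chart given by an isomorphism of a subalgebra with an algebra of the class `I_d`. -/
noncomputable def HomogeneousData.chart {d : ℕ} (D : HomogeneousData d) {p : A}
    {C : NonUnitalStarSubalgebra ℂ A} (hp : IsStarProjection p) (hC : IsClosed (C : Set A))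
    (hpC : p ∈ C) (hunit : ∀ c ∈ C, p * c = c ∧ c * p = c) (Φ : C ≃⋆ₐ[ℂ] D.algebra) :
    HomogeneousChart A :=
  have : T2Space D.Y := D.isFiniteCW.1
  have : CompactSpace D.X := isCompact_iff_compactSpace.1 D.isCompact
  { d := d
    X := D.X
    dim_le := D.dim_le.of_isClosed D.isCompact.isClosed
    R := Fin D.r
    Q := D.P
    isProj := D.isProj.restrictMatrix D.X
    S := C
    isClosed := hC
    P := ⟨p, hpC⟩
    isProj_P := hp
    unit_mul := hunit
    π :=
      { toFun := fun c => (Φ c : Matrix (Fin D.r) (Fin D.r) C(D.X, ℂ))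
        map_smul' := fun c s => congrArg Subtype.val (map_smul Φ c s)
        map_zero' := congrArg Subtype.val (map_zero Φ)
        map_add' := fun s t => congrArg Subtype.val (map_add Φ s t)
        map_mul' := fun s t => congrArg Subtype.val (map_mul Φ s t)
        map_star' := fun s => congrArg Subtype.val (map_star Φ s) }
    injective := fun s t h => Φ.injective (Subtype.ext h)
    surjective := fun T h1 h2 => ⟨Φ.symm ⟨T, h1, h2⟩,
      congrArg Subtype.val (Φ.apply_symm_apply ⟨T, h1, h2⟩)⟩
    map_unit := by
      have hi : D.P * D.P = D.P := (D.isProj.restrictMatrix D.X).isIdempotentElem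
      let q : D.algebra := ⟨D.P, hi, hi⟩
      have h1 : q * Φ ⟨p, hpC⟩ = Φ ⟨p, hpC⟩ := Subtype.ext (Φ ⟨p, hpC⟩).2.1
      have h2 : q * Φ ⟨p, hpC⟩ = q := by
        conv_lhs => rw [← Φ.apply_symm_apply q]
        rw [← map_mul]
        have : Φ.symm q * ⟨p, hpC⟩ = Φ.symm q := Subtype.ext (hunit _ (Φ.symm q).2).2
        rw [this, Φ.apply_symm_apply]
      exact congrArg Subtype.val (h1.symm.trans h2) }

theorem InClassC1.exists_chart (hC : InClassC1 A) {N : ℕ} (hN : N ≠ 0)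
    (F : Finset (CStarMatrix (Fin N) (Fin N) A)) (K : ℕ) {a : A} (ha : 0 ≤ a) (ha0 : a ≠ 0) :
    ∃ (p : A) (D : HomogeneousChart (CStarMatrix (Fin N) (Fin N) A)), IsStarProjection p ∧
      p ≠ 0 ∧ (D.P : CStarMatrix (Fin N) (Fin N) A) = CStarMatrix.diag (Fin N) p ∧
      (∀ b ∈ F, D.AlmostContains b) ∧
      (∀ x, K * (D.d + 1) ≤ (evalMatrix x D.Q).rank) ∧ CuntzLE (1 - p) a := by
  classical
  let F' : Finset A := F.biUnion fun b =>
    Finset.univ.image fun ij : Fin N × Fin N => b ij.1 ij.2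
  have hF' : ∀ b ∈ F, ∀ i j, b i j ∈ F' := fun b hb i j =>
    Finset.mem_biUnion.2 ⟨b, hb, Finset.mem_image.2 ⟨(i, j), Finset.mem_univ _, rfl⟩⟩
  -- With g = 1 the bound η / (g d + 1) equals 1 / (K + 1), which gives (d + 1)(K + 1) < rank. The
  -- tolerance is scaled by N² because the norm of an N × N matrix is estimated by the sum of its
  -- entries.
  obtain ⟨p, C, d, D, hp, hp0, hCc, hpC, hunit, ⟨Φ⟩, h1, h2, h3, h4⟩ :=
    hC F' (1 / (10000 * (N * N + 1))) (2 / (K + 1)) (by positivity) (by positivity) a ha ha0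
  refine ⟨p, (D.chart hp hCc hpC hunit Φ).amplify N, hp, hp0, rfl, fun b hb => ?_, fun x => ?_, h4⟩
  · exact HomogeneousChart.almostContains_amplify (fun i j => h1 _ (hF' b hb i j))
      (fun i j => h2 _ (hF' b hb i j))
  · have e := rank_evalMatrix_one_kronecker (D.isProj.restrictMatrix D.X) (Fin N) x
    change _ ≤ (evalMatrix x ((1 : Matrix (Fin N) (Fin N) C(D.X, ℂ)) ⊗ₖ D.P)).rank
    have e' : (evalMatrix x ((1 : Matrix (Fin N) (Fin N) C(D.X, ℂ)) ⊗ₖ D.P)).rank =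
      N * D.rankAt x := e.trans (by rw [Fintype.card_fin]; rfl)
    rw [e']
    obtain ⟨h5, h6⟩ := h3 x
    have h7 : K * (d + 1) ≤ D.rankAt x := by
      have h8 : (0 : ℝ) < D.rankAt x := by exact_mod_cast h5
      rw [div_lt_iff₀ h8] at h6
      have h9 : (2 : ℝ) / (K + 1) / (((1 : ℕ) : ℝ) + 1) = 1 / (K + 1) := by
        push_cast; field_simp; norm_num
      rw [h9, one_div, inv_mul_eq_div, lt_div_iff₀ (by positivity)] at h6
      have h10 : (d + 1) * (K + 1) < D.rankAt x := by exact_mod_cast h6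
      nlinarith
    change K * (d + 1) ≤ _
    calc K * (d + 1) ≤ 1 * D.rankAt x := by rwa [one_mul]
      _ ≤ N * D.rankAt x := Nat.mul_le_mul_right _ (Nat.one_le_iff_ne_zero.2 hN)

end Amplification

/-! ### Classes of diagonal and block diagonal projections -/

section SumsOfProjections

open Matrix

namespace MvNSemigroup

variable {A : Type*} [Ring A] [StarRing A] {m n : Type*} [Fintype m] [Fintype n]

theorem cl_sum {ι : Type*} (s : Finset ι) (e : ι → Matrix m m A)
    (he : ∀ i, IsStarProjection (e i)) (h : ∀ i j, i ≠ j → e i * e j = 0) :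
    ∃ hs : IsStarProjection (∑ i ∈ s, e i),
      cl (∑ i ∈ s, e i) hs = ∑ i ∈ s, cl (e i) (he i) := by
  classical
  induction s using Finset.induction_on with
  | empty => exact ⟨isStarProjection_zero, (cl_eq_zero_iff _).2 rfl⟩
  | insert a s ha ih =>
    obtain ⟨hs, hcl⟩ := ih
    have h0 : e a * ∑ i ∈ s, e i = 0 := by
      rw [Matrix.mul_sum]
      exact Finset.sum_eq_zero fun i hi => h a i fun e => ha (e ▸ hi)
    have h1 := (IsStarProjection.add_of_mul_eq_zero (he a) hs h0).1
    have h2 := cl_add (he a) hs h0 h1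
    have e1 : ∑ i ∈ insert a s, e i = e a + ∑ i ∈ s, e i := Finset.sum_insert ha
    have h3 : IsStarProjection (∑ i ∈ insert a s, e i) := by rw [e1]; exact h1
    exact ⟨h3, (cl_congr h3 h1 e1).trans (h2.trans (by rw [hcl, Finset.sum_insert ha]))⟩

/-- The block diagonal matrix is an orthogonal sum of copies of g, the copy in block i being carried
there by `v i`. -/
theorem exists_cl_blockDiagonal {g : Matrix n n A} (hg : IsStarProjection g) (κ : Type*)
    [Fintype κ] [DecidableEq κ] :
    ∃ h : IsStarProjection (Matrix.blockDiagonal fun _ : κ => g),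
      cl (Matrix.blockDiagonal fun _ : κ => g) h = Fintype.card κ • cl g hg := by
  have hi : g * g = g := hg.isIdempotentElem
  let v : κ → Matrix (n × κ) n A := fun i => Matrix.of fun a l => if a.2 = i then g a.1 l else 0
  have hv1 : ∀ i, (v i)ᴴ * v i = g := by
    intro i
    have e : (v i)ᴴ * v i = gᴴ * g := by
      ext l l'
      simp only [Matrix.mul_apply, Matrix.conjTranspose_apply, v, Matrix.of_apply,
        Fintype.sum_prod_type]
      refine Finset.sum_congr rfl fun k _ => ?_
      simp
    rw [e, hg.conjTranspose_eq, hi]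
  have hv2 : ∀ i j, i ≠ j → (v i)ᴴ * v j = 0 := by
    intro i j hij
    ext l l'
    simp only [Matrix.mul_apply, Matrix.conjTranspose_apply, v, Matrix.of_apply,
        Fintype.sum_prod_type]
    refine Finset.sum_eq_zero fun k _ => Finset.sum_eq_zero fun c _ => ?_
    by_cases h : c = i
    · subst h; simp [hij]
    · simp [h]
  have hM : ∀ i, IsStarProjection (v i * g * (v i)ᴴ) := fun i =>
    isStarProjection_conj hg (hv1 i) hi
  obtain ⟨hs, hcl⟩ := cl_sum Finset.univ (fun i => v i * g * (v i)ᴴ) hM (by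
    intro i j hij
    calc v i * g * (v i)ᴴ * (v j * g * (v j)ᴴ) = v i * g * ((v i)ᴴ * v j) * (g * (v j)ᴴ) := by
          simp only [Matrix.mul_assoc]
      _ = 0 := by rw [hv2 i j hij]; simp)
  have e : ∑ i, v i * g * (v i)ᴴ = Matrix.blockDiagonal fun _ : κ => g := by
    have hvg : ∀ i, v i * g = v i := by
      intro i
      ext a l
      simp only [Matrix.mul_apply, v, Matrix.of_apply]
      by_cases h : a.2 = i
      · simp only [h, if_true]
        rw [← Matrix.mul_apply, hi]
      · simp [h]
    ext ⟨l, i⟩ ⟨l', j⟩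
    rw [Matrix.sum_apply]
    simp only [hvg, Matrix.mul_apply, Matrix.conjTranspose_apply, v, Matrix.of_apply,
      Matrix.blockDiagonal_apply]
    by_cases h : i = j
    · subst h
      have h1 : (g * gᴴ) l l' = g l l' := by rw [hg.conjTranspose_eq, hi]
      rw [Matrix.mul_apply] at h1
      simp only [Matrix.conjTranspose_apply] at h1
      rw [Finset.sum_eq_single i]
      · simpa using h1
      · intro c _ hc; simp [hc.symm]
      · simp
    · rw [if_neg h]
      refine Finset.sum_eq_zero fun c _ => Finset.sum_eq_zero fun k _ => ?_
      by_cases hc : i = c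
      · subst hc; simp [Ne.symm h]
      · simp [hc]
  refine ⟨e ▸ hs, ?_⟩
  rw [cl_congr _ hs e.symm, hcl, Finset.sum_congr rfl fun i _ => cl_conj hg (hv1 i) hi]
  simp

/-- The class of a projection of `A`. -/
noncomputable def clOne (p : A) (hp : IsStarProjection p) : MvNSemigroup A :=
  cl (Matrix.diagonal fun _ : Fin 1 => p) ⟨by
    change Matrix.diagonal _ * Matrix.diagonal _ = _
    rw [Matrix.diagonal_mul_diagonal]
    congr 1; ext i; exact hp.isIdempotentElem, by
    change (Matrix.diagonal _)ᴴ = _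
    rw [Matrix.diagonal_conjTranspose]
    congr 1; ext i; exact hp.isSelfAdjoint⟩

theorem cl_single [DecidableEq n] {p : A} (hp : IsStarProjection p) (i : n) :
    ∃ h : IsStarProjection (Matrix.single i i p), cl (Matrix.single i i p) h = clOne p hp := by
  have hi : p * p = p := hp.isIdempotentElem
  have hs : star p = p := hp.isSelfAdjoint
  have h : IsStarProjection (Matrix.single i i p) := by
    refine ⟨?_, ?_⟩
    · change Matrix.single i i p * Matrix.single i i p = _
      rw [Matrix.single_mul_single_same, hi]
    · change (Matrix.single i i p)ᴴ = _
      rw [Matrix.conjTranspose_single, hs]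
  refine ⟨h, ?_⟩
  rw [clOne, cl_eq_cl]
  refine ⟨Matrix.single i 0 p, ?_, ?_⟩
  · rw [Matrix.conjTranspose_single, hs, Matrix.single_mul_single_same, hi]
  · rw [Matrix.conjTranspose_single, hs, Matrix.single_mul_single_same, hi]
    ext a b
    fin_cases a; fin_cases b
    simp

theorem cl_diagonal [DecidableEq n] {p : A} (hp : IsStarProjection p)
    (h : IsStarProjection (Matrix.diagonal fun _ : n => p)) :
    cl (Matrix.diagonal fun _ : n => p) h = Fintype.card n • clOne p hp := by
  obtain ⟨hs, hcl⟩ := cl_sum Finset.univ (fun i : n => Matrix.single i i p)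
    (fun i => (cl_single hp i).choose) (fun i j hij => by
      rw [Matrix.single_mul_single_of_ne _ _ _ _ hij])
  have e : Matrix.diagonal (fun _ : n => p) = ∑ i : n, Matrix.single i i p := by
    ext a b
    rw [Matrix.sum_apply]
    by_cases hab : a = b
    · subst hab
      rw [Matrix.diagonal_apply_eq, Finset.sum_eq_single a]
      · simp
      · intro c _ hc; simp [hc]
      · simp
    · rw [Matrix.diagonal_apply_ne _ hab]
      refine (Finset.sum_eq_zero fun c _ => ?_).symm
      rw [Matrix.single_apply, if_neg]
      rintro ⟨rfl, rfl⟩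
      exact hab rfl
  rw [cl_congr _ hs e, hcl, Finset.sum_congr rfl fun i _ => (cl_single hp i).choose_spec]
  simp

end MvNSemigroup

end SumsOfProjections

/-! ### Classes in matrix C*-algebras and Cuntz comparison of projections -/

section CStarClasses

open Matrix MvNSemigroup

variable {A : Type*} [CStarAlgebra A]

/-- The class of a projection in the C*-algebra of matrices over `A`. -/
noncomputable def cstarCl {n : Type*} [Fintype n] (e : CStarMatrix n n A)
    (he : IsStarProjection e) : MvNSemigroup A :=
  cl (CStarMatrix.ofMatrix.symm e) he

theorem cstarCl_eq_iff {n : Type*} [Fintype n] {e f : CStarMatrix n n A}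
    {he : IsStarProjection e} {hf : IsStarProjection f} :
    cstarCl e he = cstarCl f hf ↔ ∃ v : CStarMatrix n n A, v * star v = e ∧ star v * v = f :=
  cl_eq_cl

theorem cstarCl_add {n : Type*} [Fintype n] {e f : CStarMatrix n n A}
    (he : IsStarProjection e) (hf : IsStarProjection f) (h : e * f = 0)
    (hef : IsStarProjection (e + f)) :
    cstarCl (e + f) hef = cstarCl e he + cstarCl f hf :=
  cl_add he hf h hef

theorem cstarCl_eq_zero_iff {n : Type*} [Fintype n] {e : CStarMatrix n n A}
    (he : IsStarProjection e) : cstarCl e he = 0 ↔ e = 0 :=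
  cl_eq_zero_iff he

theorem exists_add_eq_of_cstarCl_eq_add {n : Type*} [Fintype n] {e : CStarMatrix n n A}
    (he : IsStarProjection e) {α β : MvNSemigroup A} (h : cstarCl e he = α + β) :
    ∃ (e₁ e₂ : CStarMatrix n n A) (h₁ : IsStarProjection e₁) (h₂ : IsStarProjection e₂),
      e₁ + e₂ = e ∧ e₁ * e₂ = 0 ∧ cstarCl e₁ h₁ = α ∧ cstarCl e₂ h₂ = β :=
  exists_add_eq_of_cl_eq_add he h

variable [PartialOrder A] [StarOrderedRing A]

/-- There is v with vv* = e and vf = v; then v*v is a subprojection of f equivalent to e. -/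
theorem exists_cstarCl_eq_add_of_norm_lt {n : Type*} [Fintype n] [DecidableEq n]
    {e f x : CStarMatrix n n A} (he : IsStarProjection e) (hf : IsStarProjection f)
    (h : ‖e - star x * f * x‖ < 1) : ∃ γ, cstarCl f hf = cstarCl e he + γ := by
  obtain ⟨v, hv1, hv2⟩ := exists_mul_star_eq_of_norm_lt he hf h
  have hs' : star f = f := hf.isSelfAdjoint
  have hp : IsStarProjection (star v * v) := by
    have hi : e * e = e := he.isIdempotentElem
    refine ⟨?_, ?_⟩
    · have hev : (e * v - v) * star (e * v - v) = 0 := by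
        have : (e * v - v) * star (e * v - v) =
            e * (v * star v) * star e - e * (v * star v) - (v * star v) * star e + v * star v := by
          rw [star_sub, star_mul]; noncomm_ring
        rw [this, hv1, he.isSelfAdjoint.star_eq, hi, hi]; abel
      have hev' : e * v = v := sub_eq_zero.1 (CStarRing.mul_star_self_eq_zero_iff _ |>.1 hev)
      change star v * v * (star v * v) = star v * v
      rw [mul_assoc, ← mul_assoc v, hv1, hev']
    · change star _ = _
      simp
  have h1 : cstarCl e he = cstarCl (star v * v) hp := cstarCl_eq_iff.2 ⟨v, hv1, rfl⟩
  rw [h1]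
  refine cl_of_mul_eq hp hf ?_
  have h2 : f * star v = star v := by
    have := congrArg star hv2
    rwa [star_mul, hs'] at this
  change f * (star v * v) = star v * v
  rw [← mul_assoc, h2]

/-- Conjugating g by the matrix with the single entry x at (i, i) leaves only the entry x* gᵢᵢ x,
which is within distance 1 of p for a late term of the Cuntz sequence. A single term suffices
because p is a projection. -/
theorem exists_eq_clOne_add_of_cuntzLE {n : Type*} [Fintype n] [DecidableEq n] {p : A}
    (hp : IsStarProjection p) {g : CStarMatrix n n A} (hg : IsStarProjection g) (i : n)
    (h : CuntzLE p (g i i)) : ∃ γ, cstarCl g hg = clOne p hp + γ := by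
  obtain ⟨x, hx⟩ := h
  obtain ⟨k, hk⟩ := (Metric.tendsto_atTop.1 hx) 1 one_pos
  have hk := hk k le_rfl
  rw [dist_comm, dist_eq_norm] at hk
  obtain ⟨h1, h2⟩ := cl_single hp i
  rw [← h2]
  refine exists_cstarCl_eq_add_of_norm_lt (x := CStarMatrix.matrixUnit i i (x k)) h1 hg ?_
  have e : CStarMatrix.ofMatrix (Matrix.single i i p) -
      star (CStarMatrix.matrixUnit i i (x k)) * g * CStarMatrix.matrixUnit i i (x k) =
      CStarMatrix.matrixUnit i i (p - star (x k) * g i i * x k) := by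
    change Matrix.single i i p - (Matrix.single i i (x k))ᴴ * CStarMatrix.ofMatrix.symm g *
      Matrix.single i i (x k) = Matrix.single i i (p - star (x k) * g i i * x k)
    rw [Matrix.conjTranspose_single]
    have : Matrix.single i i (star (x k)) * CStarMatrix.ofMatrix.symm g * Matrix.single i i (x k)
        = Matrix.single i i (star (x k) * g i i * x k) := by
      ext a b
      by_cases hb : b = i
      · subst hb
        rw [Matrix.mul_single_apply_same]
        by_cases ha : a = b
        · subst ha
          rw [Matrix.single_mul_apply_same, Matrix.single_apply_same]
          rfl
        · rw [Matrix.single_mul_apply_of_ne _ _ _ _ _ ha, zero_mul, Matrix.single_apply, if_neg]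
          rintro ⟨h, -⟩
          exact ha h.symm
      · rw [Matrix.mul_single_apply_of_ne _ _ _ _ _ hb, Matrix.single_apply, if_neg]
        rintro ⟨-, h⟩
        exact hb h.symm
    rw [this]
    ext a b
    by_cases hab : i = a ∧ i = b
    · obtain ⟨rfl, rfl⟩ := hab
      simp only [Matrix.sub_apply, Matrix.single_apply_same]
    · simp only [Matrix.sub_apply, Matrix.single_apply, if_neg hab, sub_zero]
  exact (le_of_eq (congrArg _ e)).trans_lt ((CStarMatrix.norm_matrixUnit_le i i _).trans_lt hk)

end CStarClasses

/-! ### Nonzero classes are order units -/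

section Simplicity

open Matrix MvNSemigroup

variable {A : Type*} [CStarAlgebra A]

/-- In a simple unital C*-algebra, every nonzero element generates `A` as an ideal, without taking
the closure. -/
theorem IsSimpleCStar.exists_sum_eq_one (hA : IsSimpleCStar A) {a : A} (ha : a ≠ 0) :
    ∃ (ι : Type) (_ : Fintype ι) (x y : ι → A), ∑ i, x i * a * y i = 1 := by
  let T : Set A := {z | ∃ (ι : Type) (_ : Fintype ι) (x y : ι → A), ∑ i, x i * a * y i = z}
  have hT0 : (0 : A) ∈ T := ⟨Empty, inferInstance, Empty.elim, Empty.elim, by simp⟩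
  have hTadd : ∀ {z w}, z ∈ T → w ∈ T → z + w ∈ T := by
    rintro _ _ ⟨ι, _, x, y, rfl⟩ ⟨κ, _, x', y', rfl⟩
    exact ⟨ι ⊕ κ, inferInstance, Sum.elim x x', Sum.elim y y', by simp⟩
  have hTl : ∀ {c z}, z ∈ T → c * z ∈ T := by
    rintro c _ ⟨ι, _, x, y, rfl⟩
    exact ⟨ι, inferInstance, fun i => c * x i, y, by simp [Finset.mul_sum, mul_assoc]⟩
  have hTr : ∀ {z c}, z ∈ T → z * c ∈ T := by
    rintro _ c ⟨ι, _, x, y, rfl⟩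
    exact ⟨ι, inferInstance, x, fun i => y i * c, by simp [Finset.sum_mul, mul_assoc]⟩
  have haT : a ∈ T := ⟨Unit, inferInstance, fun _ => 1, fun _ => 1, by simp⟩
  let I : TwoSidedIdeal A := TwoSidedIdeal.mk' (closure T) (subset_closure hT0)
    (fun hx hy => map_mem_closure₂ continuous_add hx hy fun _ h _ h' => hTadd h h')
    (fun hx => map_mem_closure continuous_neg hx fun z hz => by
      rw [← neg_one_mul]; exact hTl hz)
    (fun {c z} hz => map_mem_closure (continuous_const_mul c) hz fun _ h => hTl h)
    (fun {z c} hz => map_mem_closure (f := fun w => w * c) (by fun_prop) hz fun _ h => hTr h)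
  have hI : (I : Set A) = closure T := by
    ext z
    exact TwoSidedIdeal.mem_mk' _ _ _ _ _ _ z
  have hmem : ∀ z, z ∈ I ↔ z ∈ closure T := fun z => by rw [← hI]; rfl
  rcases hA.2 I (by rw [hI]; exact isClosed_closure) with h | h
  · have h1 : a ∈ I := (hmem a).2 (subset_closure haT)
    rw [h] at h1
    exact absurd h1 ha
  · have h1 : (1 : A) ∈ I := by rw [h]; trivial
    -- The algebraic ideal is dense, so it contains an element within distance 1 of the unit; that
    -- element is invertible, and multiplying by its inverse gives 1 exactly.
    obtain ⟨z, hz, hd⟩ := Metric.mem_closure_iff.1 ((hmem 1).1 h1) 1 one_pos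
    rw [dist_eq_norm] at hd
    let u := Units.oneSub (1 - z) hd
    have hu : (u : A) = z := by
      change 1 - (1 - z) = z
      abel
    have h2 : z * (↑u⁻¹ : A) = 1 := by rw [← hu, Units.mul_inv]
    exact h2 ▸ hTr hz

variable [PartialOrder A] [StarOrderedRing A]

/-- From Σ xᵢ a yᵢ = 1, positivity of Σ (xᵢ* - yᵢ)* a (xᵢ* - yᵢ) gives h = Σ (xᵢ a xᵢ* + yᵢ* a yᵢ) ≥
2. Hence h is invertible, and conjugating by the inverse square root of its multiple t h, with t =
1/‖h‖, produces 1. -/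
theorem IsSimpleCStar.exists_sum_star_eq_one (hA : IsSimpleCStar A) {a : A} (ha : a ≠ 0)
    (ha0 : 0 ≤ a) : ∃ (ι : Type) (_ : Fintype ι) (z : ι → A), ∑ i, star (z i) * a * z i = 1 := by
  have hnt := hA.1
  obtain ⟨ι, _, x, y, hxy⟩ := hA.exists_sum_eq_one ha
  have hsa : star a = a := ha0.isSelfAdjoint
  obtain ⟨h, hh⟩ : ∃ h, h = ∑ i, (x i * a * star (x i) + star (y i) * a * y i) := ⟨_, rfl⟩
  have hle : (2 : A) ≤ h := by
    have h1 : ∑ i, (star (y i) * a * star (x i)) = 1 := by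
      have := congrArg star hxy
      rw [star_one, star_sum] at this
      rw [← this]
      exact Finset.sum_congr rfl fun i _ => by simp [hsa, mul_assoc]
    have h2 : h - 2 = ∑ i, star (star (x i) - y i) * a * (star (x i) - y i) := by
      have : (2 : A) = ∑ i, (x i * a * y i + star (y i) * a * star (x i)) := by
        rw [Finset.sum_add_distrib, hxy, h1]; norm_num
      rw [this, hh, ← Finset.sum_sub_distrib]
      refine Finset.sum_congr rfl fun i _ => ?_
      rw [star_sub, star_star]; noncomm_ring
    rw [← sub_nonneg, h2]
    exact Finset.sum_nonneg fun i _ => star_left_conjugate_nonneg ha0 _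
  have h20 : (0 : A) ≤ 2 := by
    have : (2 : A) = 1 + 1 := by norm_num
    rw [this]; exact add_nonneg zero_le_one zero_le_one
  have hpos : 0 ≤ h := h20.trans hle
  have hh0 : h ≠ 0 := by
    rintro rfl
    have h3 : (2 : A) = 0 := le_antisymm hle h20
    have : (1 : A) = 0 := by
      calc (1 : A) = (2⁻¹ : ℂ) • (2 : A) := by
            rw [show (2 : A) = (2 : ℂ) • (1 : A) by rw [two_smul]; norm_num, smul_smul]; norm_num
        _ = 0 := by rw [h3, smul_zero]
    exact one_ne_zero this
  have hn : 0 < ‖h‖ := norm_pos_iff.2 hh0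
  obtain ⟨t, ht⟩ : ∃ t : ℝ, t = ‖h‖⁻¹ := ⟨_, rfl⟩
  have ht0 : 0 < t := by rw [ht]; positivity
  have h5 : ‖1 - t • h‖ < 1 := by
    have h6 : t • h ≤ 1 := by
      have h7 : h ≤ algebraMap ℝ A ‖h‖ := IsSelfAdjoint.le_algebraMap_norm_self hpos.isSelfAdjoint
      have h8 := smul_le_smul_of_nonneg_left h7 ht0.le
      rwa [Algebra.algebraMap_eq_smul_one, smul_smul, ht, inv_mul_cancel₀ hn.ne', one_smul,
        ← ht] at h8
    have h9 : 1 - t • h ≤ algebraMap ℝ A (1 - t) := by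
      have h10 : t • (1 : A) ≤ t • h := by
        refine smul_le_smul_of_nonneg_left (le_trans ?_ hle) ht0.le
        have : (2 : A) = 1 + 1 := by norm_num
        rw [this]; exact le_add_of_nonneg_right zero_le_one
      rw [map_sub, map_one, Algebra.algebraMap_eq_smul_one]
      exact sub_le_sub_left h10 1
    have h11 := CStarAlgebra.norm_le_norm_of_nonneg_of_le (sub_nonneg.2 h6) h9
    have ht1 : t ≤ 1 := by
      by_contra hlt
      have h12 : (1 - t) • (1 : A) ≥ 0 := by
        rw [← Algebra.algebraMap_eq_smul_one]; exact (sub_nonneg.2 h6).trans h9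
      have h13 : (1 - t) • (1 : A) ≤ 0 :=
        smul_nonpos_of_nonpos_of_nonneg (by linarith) zero_le_one
      have h14 := le_antisymm h13 h12
      rw [smul_eq_zero] at h14
      rcases h14 with h14 | h14
      · linarith
      · exact one_ne_zero h14
    rw [norm_algebraMap', Real.norm_of_nonneg (by linarith)] at h11
    linarith
  have hthsa : IsSelfAdjoint (t • h) := by
    change star (t • h) = t • h
    rw [star_smul, hpos.isSelfAdjoint.star_eq]; simp
  obtain ⟨s, hs, hshs, -⟩ := exists_inv_sqrt_of_norm_lt hthsa h5
  refine ⟨ι ⊕ ι, inferInstance, Sum.elim (fun i => (Real.sqrt t : ℂ) • (star (x i) * s))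
    (fun i => (Real.sqrt t : ℂ) • (y i * s)), ?_⟩
  rw [Fintype.sum_sum_type]
  have hsq : ∀ w : A, star ((Real.sqrt t : ℂ) • (w * s)) * a * ((Real.sqrt t : ℂ) • (w * s)) =
      s * (t • (star w * a * w)) * s := by
    intro w
    have e1 : (t : ℝ) • (star w * a * w) = ((Real.sqrt t : ℂ) * (Real.sqrt t : ℂ)) •
        (star w * a * w) := by
      rw [← Complex.ofReal_mul, Real.mul_self_sqrt ht0.le]; rfl
    rw [e1, star_smul, star_mul, hs]
    simp only [Complex.star_def, Complex.conj_ofReal, smul_mul_assoc, mul_smul_comm, smul_smul,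
      mul_assoc]
  simp only [Sum.elim_inl, Sum.elim_inr, hsq, star_star]
  rw [← Finset.sum_mul, ← Finset.mul_sum, ← Finset.sum_mul, ← Finset.mul_sum, ← add_mul, ← mul_add,
    ← Finset.smul_sum, ← Finset.smul_sum, ← smul_add, ← Finset.sum_add_distrib, ← hh, hshs]

/-- A diagonal entry of a projection is the sum of the squares of its column, so if all of them
vanish the projection vanishes. -/
theorem exists_diag_ne_zero {n : Type*} [Fintype n] {g : Matrix n n A}
    (hg : IsStarProjection g) (h0 : g ≠ 0) :
    ∃ i, g i i ≠ 0 ∧ 0 ≤ g i i ∧ g i i = ∑ l, star (g l i) * g l i := by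
  have hi : gᴴ * g = g := by
    rw [hg.conjTranspose_eq]; exact hg.isIdempotentElem
  have hd : ∀ i, g i i = ∑ l, star (g l i) * g l i := by
    intro i
    conv_lhs => rw [← hi]
    simp [Matrix.mul_apply]
  obtain ⟨i, hi0⟩ : ∃ i, g i i ≠ 0 := by
    by_contra! hall
    apply h0
    ext l i
    have h1 := hd i
    rw [hall i] at h1
    have h2 := (Finset.sum_eq_zero_iff_of_nonneg
      (fun l _ => star_mul_self_nonneg (g l i))).1 h1.symm l (Finset.mem_univ l)
    exact (CStarRing.star_mul_self_eq_zero_iff _).1 h2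
  refine ⟨i, hi0, ?_, hd i⟩
  rw [hd i]
  exact Finset.sum_nonneg fun l _ => star_mul_self_nonneg _

/-- In a simple C*-algebra, every nonzero class is an order unit. -/
theorem IsSimpleCStar.exists_nsmul_eq_unit_add (hA : IsSimpleCStar A) {α : MvNSemigroup A}
    (hα : α ≠ 0) : ∃ (k : ℕ) (β : MvNSemigroup A), k • α = unit A + β := by
  classical
  obtain ⟨n, g, hg, rfl⟩ := exists_cl_eq α
  have hg0 : g ≠ 0 := fun h => hα ((cl_eq_zero_iff hg).2 h)
  obtain ⟨j, hj0, hjpos, hjsum⟩ := exists_diag_ne_zero hg hg0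
  obtain ⟨κ, _, z, hz⟩ := hA.exists_sum_star_eq_one hj0 hjpos
  obtain ⟨hE, hcl⟩ := exists_cl_blockDiagonal hg κ
  have hi : g * g = g := hg.isIdempotentElem
  -- The column with blocks (column j of g) · zᵢ lies under the block diagonal of copies of g, and
  -- v*v = Σ zᵢ* gⱼⱼ zᵢ = 1.
  obtain ⟨h1, h2⟩ := unit_split hE (v := Matrix.of fun a _ => g a.1 j * z a.2) (by
      ext a b
      fin_cases a; fin_cases b
      simp only [Matrix.mul_apply, Matrix.conjTranspose_apply, Matrix.of_apply, star_mul,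
        Fintype.sum_prod_type]
      rw [Finset.sum_comm]
      simp only [Matrix.one_apply_eq]
      rw [← hz]
      refine Finset.sum_congr rfl fun i _ => ?_
      rw [hjsum, Finset.mul_sum, Finset.sum_mul]
      exact Finset.sum_congr rfl fun l _ => by simp only [mul_assoc]) (by
      ext ⟨l, i⟩ b
      simp only [Matrix.mul_apply, Matrix.of_apply, Matrix.blockDiagonal_apply, Fintype.sum_prod_type, ite_mul,
        zero_mul, Finset.sum_ite_eq, Finset.mem_univ, if_true, ← mul_assoc]
      rw [← Finset.sum_mul, ← Matrix.mul_apply, hi])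
  exact ⟨Fintype.card κ, _, by rw [← hcl, h2, add_comm]⟩

end Simplicity

/-! ### Pushing bundle classes of a chart into V(A) -/

section Pushforward

open Matrix MvNSemigroup

namespace HomogeneousChart

variable {A : Type*} [CStarAlgebra A] [PartialOrder A] [StarOrderedRing A] {n : Type*}
  [Fintype n] [DecidableEq n]
  (D : HomogeneousChart (CStarMatrix n n A))

/-- The classes of projections of matrix algebras over `C(X)` that come from the subalgebra. -/
def IsRep (w : MvNSemigroup C(D.X, ℂ)) : Prop :=
  ∃ (s : D.S) (hs : IsStarProjection (s : CStarMatrix n n A)),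
    cl (D.π s) (isStarProjection_π hs) = w

open Classical in
/-- The class in `V(A)` of a projection of the subalgebra with given class in `V(C(X))`. -/
noncomputable def push (w : MvNSemigroup C(D.X, ℂ)) : MvNSemigroup A :=
  if h : D.IsRep w then cstarCl (h.choose : CStarMatrix n n A) h.choose_spec.choose else 0

variable {D}

theorem Q_mul_π (s : D.S) : D.Q * D.π s = D.π s := by
  rw [← D.map_unit, ← map_mul]
  exact congrArg D.π (Subtype.ext (D.unit_mul s s.2).1)

theorem π_mul_Q (s : D.S) : D.π s * D.Q = D.π s := by
  rw [← D.map_unit, ← map_mul]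
  exact congrArg D.π (Subtype.ext (D.unit_mul s s.2).2)

/-- This makes `push` independent of the chosen representative. A partial isometry between the two
images, cut down by them on both sides, lies in the corner of Q and therefore lifts to the
subalgebra. -/
theorem cstarCl_eq_of_cl_π_eq {s t : D.S} (hs : IsStarProjection (s : CStarMatrix n n A))
    (ht : IsStarProjection (t : CStarMatrix n n A))
    (h : cl (D.π s) (isStarProjection_π hs) = cl (D.π t) (isStarProjection_π ht)) :
    cstarCl (s : CStarMatrix n n A) hs = cstarCl (t : CStarMatrix n n A) ht := by
  obtain ⟨v, hv1, hv2⟩ := cl_eq_cl.1 h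
  have hsi : D.π s * D.π s = D.π s := (isStarProjection_π hs).isIdempotentElem
  have hti : D.π t * D.π t = D.π t := (isStarProjection_π ht).isIdempotentElem
  have hss : (D.π s)ᴴ = D.π s := (isStarProjection_π hs).conjTranspose_eq
  have hts : (D.π t)ᴴ = D.π t := (isStarProjection_π ht).conjTranspose_eq
  obtain ⟨u, hu⟩ := D.surjective (D.π s * v * D.π t)
    (by rw [← Matrix.mul_assoc, ← Matrix.mul_assoc, Q_mul_π])
    (by rw [Matrix.mul_assoc, π_mul_Q])
  have h1 : u * star u = s := by
    apply D.injective
    rw [map_mul, map_star, hu]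
    change _ * (D.π s * v * D.π t)ᴴ = _
    rw [conjTranspose_mul, conjTranspose_mul, hss, hts]
    calc D.π s * v * D.π t * (D.π t * (vᴴ * D.π s))
        = D.π s * v * (D.π t * D.π t) * vᴴ * D.π s := by simp only [Matrix.mul_assoc]
      _ = D.π s * (v * vᴴ) * (v * vᴴ) * D.π s := by
          rw [hti, ← hv2]; simp only [Matrix.mul_assoc]
      _ = D.π s := by rw [hv1, hsi, hsi, hsi]
  have h2 : star u * u = t := by
    apply D.injective
    rw [map_mul, map_star, hu]
    change (D.π s * v * D.π t)ᴴ * _ = _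
    rw [conjTranspose_mul, conjTranspose_mul, hss, hts]
    calc D.π t * (vᴴ * D.π s) * (D.π s * v * D.π t)
        = D.π t * vᴴ * (D.π s * D.π s) * v * D.π t := by simp only [Matrix.mul_assoc]
      _ = D.π t * (vᴴ * v) * (vᴴ * v) * D.π t := by
          rw [hsi, ← hv1]; simp only [Matrix.mul_assoc]
      _ = D.π t := by rw [hv2, hti, hti, hti]
  exact cstarCl_eq_iff.2 ⟨u, congrArg Subtype.val h1, congrArg Subtype.val h2⟩

theorem push_cl {s : D.S} (hs : IsStarProjection (s : CStarMatrix n n A)) :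
    D.push (cl (D.π s) (isStarProjection_π hs)) = cstarCl (s : CStarMatrix n n A) hs := by
  have h : D.IsRep (cl (D.π s) (isStarProjection_π hs)) := ⟨s, hs, rfl⟩
  rw [push, dif_pos h]
  exact cstarCl_eq_of_cl_π_eq _ _ h.choose_spec.choose_spec

theorem exists_lift {T : Matrix D.R D.R C(D.X, ℂ)} (hT : IsStarProjection T) {s : D.S}
    (h : D.π s * T = T) : ∃ t : D.S, IsStarProjection (t : CStarMatrix n n A) ∧ D.π t = T := by
  have h1 : D.Q * T = T := by rw [← h, ← Matrix.mul_assoc, Q_mul_π]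
  have h2 : T * D.Q = T := by
    have := congrArg Matrix.conjTranspose h1
    rwa [conjTranspose_mul, hT.conjTranspose_eq, D.isProj.conjTranspose_eq] at this
  obtain ⟨t, ht⟩ := D.surjective T h1 h2
  refine ⟨t, ⟨?_, ?_⟩, ht⟩
  · have : t * t = t := D.injective (by rw [map_mul, ht]; exact hT.isIdempotentElem)
    exact congrArg Subtype.val this
  · have : star t = t := D.injective (by rw [map_star, ht]; exact hT.isSelfAdjoint)
    exact congrArg Subtype.val this

/-- A decomposition of the class of π(s) is realized by orthogonal subprojections of π(s). These lie
in the corner of Q and lift to orthogonal projections with sum s. -/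
theorem IsRep.of_add {w₁ w₂ : MvNSemigroup C(D.X, ℂ)} (h : D.IsRep (w₁ + w₂)) :
    D.IsRep w₁ ∧ D.IsRep w₂ ∧ D.push (w₁ + w₂) = D.push w₁ + D.push w₂ := by
  obtain ⟨s, hs, hw⟩ := h
  obtain ⟨e₁, e₂, h₁, h₂, hadd, hmul, hc₁, hc₂⟩ := exists_add_eq_of_cl_eq_add _ hw
  have hmul' : e₂ * e₁ = 0 := by
    have := congrArg Matrix.conjTranspose hmul
    rwa [conjTranspose_mul, h₁.conjTranspose_eq, h₂.conjTranspose_eq, conjTranspose_zero] at this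
  have hi₁ : e₁ * e₁ = e₁ := h₁.isIdempotentElem
  have hi₂ : e₂ * e₂ = e₂ := h₂.isIdempotentElem
  obtain ⟨s₁, hs₁, rfl⟩ := exists_lift h₁ (s := s)
    (by rw [← hadd, Matrix.add_mul, hmul', add_zero, hi₁])
  obtain ⟨s₂, hs₂, rfl⟩ := exists_lift h₂ (s := s)
    (by rw [← hadd, Matrix.add_mul, hmul, zero_add, hi₂])
  have e : s₁ + s₂ = s := D.injective (by rw [map_add, hadd])
  have e0 : s₁ * s₂ = 0 := D.injective (by rw [map_mul, hmul, map_zero])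
  subst e
  subst hc₁
  subst hc₂
  refine ⟨⟨s₁, hs₁, rfl⟩, ⟨s₂, hs₂, rfl⟩, ?_⟩
  rw [← hw, push_cl, push_cl, push_cl]
  exact cstarCl_add hs₁ hs₂ (congrArg Subtype.val e0) hs

theorem IsRep.eq_zero_of_push {w : MvNSemigroup C(D.X, ℂ)} (h : D.IsRep w) (h0 : D.push w = 0) :
    w = 0 := by
  obtain ⟨s, hs, rfl⟩ := h
  rw [push_cl hs, cstarCl_eq_zero_iff hs] at h0
  have : s = 0 := Subtype.ext h0
  rw [cl_eq_zero_iff, this, map_zero]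

theorem IsRep.push_nsmul {w : MvNSemigroup C(D.X, ℂ)} {k : ℕ} (hk : k ≠ 0) (h : D.IsRep (k • w)) :
    D.IsRep w ∧ D.push (k • w) = k • D.push w := by
  induction k with
  | zero => exact absurd rfl hk
  | succ k ih =>
    by_cases hk0 : k = 0
    · subst hk0
      simp only [zero_add, one_smul] at h ⊢
      exact ⟨h, trivial⟩
    · rw [succ_nsmul] at h ⊢
      obtain ⟨h1, h2, h3⟩ := h.of_add
      exact ⟨h2, by rw [h3, (ih hk0 h1).2, succ_nsmul]⟩

theorem nonempty_of_unit_ne_zero (h : (D.P : CStarMatrix n n A) ≠ 0) : Nonempty D.X := by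
  by_contra hX
  rw [not_nonempty_iff] at hX
  apply h
  have : D.P = 0 := D.injective (by
    rw [map_zero, D.map_unit]
    ext i j x
    exact hX.elim x)
  rw [this]
  rfl

end HomogeneousChart

end Pushforward

/-! ### Localization of finitely many classes in a chart -/

section Localization

open Matrix MvNSemigroup HomogeneousChart

variable {A : Type*} [CStarAlgebra A] [PartialOrder A] [StarOrderedRing A]

/-- Finitely many classes in `V(A)`, up to a small remainder, come from a homogeneous algebra, with
additive ranks. -/
theorem InClassC1.exists_chart_of_represented (hC : InClassC1 A) {N : ℕ} (hN : N ≠ 0)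
    (G : Finset (MvNSemigroup A))
    (hG : ∀ α ∈ G, ∃ (e : CStarMatrix (Fin N) (Fin N) A) (he : IsStarProjection e),
      cstarCl e he = α) (K : ℕ) {a : A} (ha : 0 ≤ a) (ha0 : a ≠ 0) :
    ∃ (p : A) (hp : IsStarProjection p) (D : HomogeneousChart (CStarMatrix (Fin N) (Fin N) A))
      (w : MvNSemigroup A → MvNSemigroup C(D.X, ℂ)) (ω : MvNSemigroup A → MvNSemigroup A),
      CuntzLE (1 - p) a ∧ Nonempty D.X ∧
      (∀ α ∈ G, D.IsRep (w α) ∧ α = D.push (w α) + ω α ∧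
        ∃ δ, N • clOne (1 - p) hp.one_sub = ω α + δ) ∧
      (∀ α β, α ∈ G → β ∈ G → α + β ∈ G → ∀ x, rk (w (α + β)) x = rk (w α) x + rk (w β) x) ∧
      (N • unit A ∈ G → ∀ x, K * (D.d + 1) ≤ rk (w (N • unit A)) x) := by
  classical
  have hE : ∀ α, ∃ (e : CStarMatrix (Fin N) (Fin N) A) (he : IsStarProjection e),
      α ∈ G → cstarCl e he = α := by
    intro α
    by_cases h : α ∈ G
    · obtain ⟨e, he, h'⟩ := hG α h
      exact ⟨e, he, fun _ => h'⟩
    · exact ⟨0, isStarProjection_zero, fun h' => absurd h' h⟩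
  choose e he hcl using hE
  -- The representatives of α, β and α + β are chosen independently. The representative of the sum
  -- is therefore cut into orthogonal pieces b, c, and these pieces together with the partial
  -- isometries to `e α` and `e β` enter the finite set to be approximated; this is what makes the
  -- ranks additive.
  have hS : ∀ α β, ∃ (b c v u : CStarMatrix (Fin N) (Fin N) A), α ∈ G → β ∈ G → α + β ∈ G →
      IsStarProjection b ∧ IsStarProjection c ∧ b + c = e (α + β) ∧ b * c = 0 ∧
      v * star v = b ∧ star v * v = e α ∧ u * star u = c ∧ star u * u = e β := by
    intro α β
    by_cases h : α ∈ G ∧ β ∈ G ∧ α + β ∈ G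
    · obtain ⟨b, c, hb, hc, h1, h2, h3, h4⟩ :=
        exists_add_eq_of_cstarCl_eq_add (he (α + β)) (hcl _ h.2.2)
      obtain ⟨v, hv1, hv2⟩ := cstarCl_eq_iff.1 (h3.trans (hcl α h.1).symm)
      obtain ⟨u, hu1, hu2⟩ := cstarCl_eq_iff.1 (h4.trans (hcl β h.2.1).symm)
      exact ⟨b, c, v, u, fun _ _ _ => ⟨hb, hc, h1, h2, hv1, hv2, hu1, hu2⟩⟩
    · exact ⟨0, 0, 0, 0, fun h1 h2 h3 => absurd ⟨h1, h2, h3⟩ h⟩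
  choose b c v u hbc using hS
  have hone : IsStarProjection (1 : CStarMatrix (Fin N) (Fin N) A) := .one _
  have hone' : cstarCl (1 : CStarMatrix (Fin N) (Fin N) A) hone = N • unit A := cl_one N
  obtain ⟨v₀, hv₀⟩ : ∃ v₀ : CStarMatrix (Fin N) (Fin N) A, N • unit A ∈ G →
      v₀ * star v₀ = e (N • unit A) ∧ star v₀ * v₀ = 1 := by
    by_cases h : N • unit A ∈ G
    · obtain ⟨v, hv⟩ := cstarCl_eq_iff.1 ((hcl _ h).trans hone'.symm)
      exact ⟨v, fun _ => hv⟩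
    · exact ⟨0, fun h' => absurd h' h⟩
  let f : MvNSemigroup A × MvNSemigroup A → Finset (CStarMatrix (Fin N) (Fin N) A) := fun q =>
    {b q.1 q.2, c q.1 q.2, v q.1 q.2, u q.1 q.2, star (v q.1 q.2), star (u q.1 q.2)}
  let F : Finset (CStarMatrix (Fin N) (Fin N) A) :=
    (G.image e ∪ (G ×ˢ G).biUnion f) ∪ {v₀, star v₀}
  obtain ⟨p, D, hp, hp0, hP, hF, hK, hpa⟩ := hC.exists_chart hN F K ha ha0
  have hFe : ∀ α ∈ G, D.AlmostContains (e α) := fun α hα => hF _ (Finset.mem_union_left _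
    (Finset.mem_union_left _ (Finset.mem_image_of_mem _ hα)))
  have hFf : ∀ α ∈ G, ∀ β ∈ G, ∀ x ∈ f (α, β), D.AlmostContains x := fun α hα β hβ x hx =>
    hF _ (Finset.mem_union_left _ (Finset.mem_union_right _
      (Finset.mem_biUnion.2 ⟨_, Finset.mem_product.2 ⟨hα, hβ⟩, hx⟩)))
  have hP0 : (D.P : CStarMatrix (Fin N) (Fin N) A) ≠ 0 := by
    intro h
    rw [hP] at h
    have h1 := congrFun (congrFun h ⟨0, Nat.pos_of_ne_zero hN⟩) ⟨0, Nat.pos_of_ne_zero hN⟩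
    apply hp0
    change Matrix.diagonal (fun _ => p) _ _ = 0 at h1
    rwa [Matrix.diagonal_apply_eq] at h1
  have hdiag : (1 : CStarMatrix (Fin N) (Fin N) A) - (D.P : CStarMatrix (Fin N) (Fin N) A)
      = CStarMatrix.ofMatrix (Matrix.diagonal fun _ => 1 - p) := by
    rw [hP]
    change (1 : Matrix (Fin N) (Fin N) A) - Matrix.diagonal (fun _ => p) = _
    rw [← Matrix.diagonal_one]
    exact Matrix.diagonal_sub _ _
  have h1P : IsStarProjection (1 - (D.P : CStarMatrix (Fin N) (Fin N) A)) := D.isProj_P.one_sub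
  have hclP : cstarCl _ h1P = N • clOne (1 - p) hp.one_sub := by
    have h2 : IsStarProjection (Matrix.diagonal fun _ : Fin N => 1 - p) := by
      have := h1P
      rw [hdiag] at this
      exact this
    have := cl_diagonal hp.one_sub h2
    rw [Fintype.card_fin] at this
    rw [← this]
    exact cl_congr _ _ hdiag
  have hW : ∀ α, ∃ (s : D.S) (_ : IsStarProjection (s : CStarMatrix (Fin N) (Fin N) A))
      (o : MvNSemigroup A), α ∈ G → D.IsNear (e α) s ∧
        α = cstarCl (s : CStarMatrix (Fin N) (Fin N) A) ‹_› + o ∧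
        ∃ δ, N • clOne (1 - p) hp.one_sub = o + δ := by
    intro α
    by_cases hα : α ∈ G
    -- Up to equivalence `e α` is an orthogonal sum s + t with s in the subalgebra and t under 1 -
    -- P. The class of t is the remainder, so it lies under N copies of 1 - p.
    · obtain ⟨s, hs, t, ht, hPt, hn⟩ := (hFe α hα).exists_isNear (he α)
      have hst : (s : CStarMatrix (Fin N) (Fin N) A) * t = 0 := by
        rw [← (D.unit_mul s s.2).2, mul_assoc, hPt, mul_zero]
      have hadd := (IsStarProjection.add_of_mul_eq_zero hs.1 ht hst).1
      obtain ⟨x, hx⟩ := exists_mvn_of_norm_sub_lt (he α) hadd hn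
      refine ⟨s, hs.1, cstarCl t ht, fun _ => ⟨hs, ?_, ?_⟩⟩
      · rw [← cstarCl_add hs.1 ht hst hadd, ← hcl α hα]
        exact cstarCl_eq_iff.2 ⟨x, hx⟩
      · rw [← hclP]
        refine cl_of_mul_eq ht h1P ?_
        change (1 - (D.P : CStarMatrix (Fin N) (Fin N) A)) * t = t
        rw [sub_mul, one_mul, hPt, sub_zero]
    · refine ⟨0, isStarProjection_zero, 0, fun h => absurd h hα⟩
  choose s hs ω hsω using hW
  have hrk : ∀ α x, rk (cl (D.π (s α)) (isStarProjection_π (hs α))) x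
      = (evalMatrix x (D.π (s α))).rank := fun α x => rk_cl _ x
  refine ⟨p, hp, D, fun α => cl (D.π (s α)) (isStarProjection_π (hs α)), ω, hpa,
    nonempty_of_unit_ne_zero hP0, fun α hα => ⟨⟨s α, hs α, rfl⟩, ?_, (hsω α hα).2.2⟩, ?_, ?_⟩
  · rw [push_cl]
    exact (hsω α hα).2.1
  · intro α β hα hβ hαβ x
    obtain ⟨hb, hc, h1, h2, h3, h4, h5, h6⟩ := hbc α β hα hβ hαβ
    have hF' := hFf α hα β hβ
    have hFb := hF' (b α β) (by simp [f])
    have hFc := hF' (c α β) (by simp [f])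
    obtain ⟨b', hb', -⟩ := hFb.exists_isNear hb
    obtain ⟨c', hc', -⟩ := hFc.exists_isNear hc
    simp only [hrk]
    rw [rank_eq_add_of_orthogonal hb hc h2 hFc.1 hb' hc' (h1 ▸ (hsω _ hαβ).1) x,
      rank_eq_of_mvn hb (he α) h3 h4 hFb.1 (hFe α hα).1 (hF' _ (by simp [f]))
        (hF' _ (by simp [f])) hb' (hsω α hα).1 x,
      rank_eq_of_mvn hc (he β) h5 h6 hFc.1 (hFe β hβ).1 (hF' _ (by simp [f]))
        (hF' _ (by simp [f])) hc' (hsω β hβ).1 x]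
  · intro h x
    simp only [hrk]
    obtain ⟨h1, h2⟩ := hv₀ h
    have hnear : D.IsNear 1 D.P := by
      refine ⟨D.isProj_P, ?_⟩
      have : (D.P : CStarMatrix (Fin N) (Fin N) A) * D.P = D.P := D.isProj_P.isIdempotentElem
      rw [mul_one, this, sub_self, norm_zero]
      norm_num
    rw [rank_eq_of_mvn (he _) hone h1 h2 (hFe _ h).1 (by simp) (hF _ (by simp [F]))
      (hF _ (by simp [F])) (hsω _ h).1 hnear x, D.map_unit]
    exact hK x

end Localization

/-! ### Local models with small remainders and large ranks -/

section LocalModels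

open Matrix MvNSemigroup HomogeneousChart

variable {A : Type*} [CStarAlgebra A] [PartialOrder A] [StarOrderedRing A]

/-- Additivity is available only inside G, so every intermediate multiple, 0 included, has to belong
to G. -/
theorem eq_mul_of_add_on_multiples {V : Type*} [AddCommMonoid V] {G : Finset V} {f : V → ℕ}
    (hf : ∀ α β, α ∈ G → β ∈ G → α + β ∈ G → f (α + β) = f α + f β) {α : V} :
    ∀ k, (∀ j ≤ k, j • α ∈ G) → f (k • α) = k * f α
  | 0, h => by
    have h0 : (0 : V) ∈ G := by simpa using h 0 le_rfl
    have := hf 0 0 h0 h0 (by simpa using h0)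
    rw [add_zero] at this
    rw [zero_smul, zero_mul]
    omega
  | k + 1, h => by
    have h1 : α ∈ G := by simpa using h 1 (by omega)
    have h2 := h (k + 1) le_rfl
    rw [succ_nsmul] at h2 ⊢
    rw [hf _ _ (h k (by omega)) h1 h2,
      eq_mul_of_add_on_multiples hf k fun j hj => h j (by omega), Nat.succ_mul]

/-- A homogeneous algebra that models the finite set `G` of classes, up to remainders `ω`, with
ranks that are additive on `G` and at least `K (d + 1)` on its nonzero elements. -/
structure LocalModel (A : Type*) [CStarAlgebra A] [PartialOrder A] [StarOrderedRing A] (N : ℕ)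
    (G : Finset (MvNSemigroup A)) (K : ℕ) where
  D : HomogeneousChart (CStarMatrix (Fin N) (Fin N) A)
  w : MvNSemigroup A → MvNSemigroup C(D.X, ℂ)
  ω : MvNSemigroup A → MvNSemigroup A
  nonempty : Nonempty D.X
  isRep : ∀ α ∈ G, D.IsRep (w α)
  eq_add : ∀ α ∈ G, α = D.push (w α) + ω α
  rk_add : ∀ x α β, α ∈ G → β ∈ G → α + β ∈ G → rk (w (α + β)) x = rk (w α) x + rk (w β) x
  le_rk : ∀ α ∈ G, α ≠ 0 → ∀ x, K * (D.d + 1) ≤ rk (w α) x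

/-- The matrix size N depends only on G and is fixed before a, so that a may later be taken small
relative to N. The lower bound on ranks comes from k α = [1] + β: the rank of α is at least 1/k
times that of the unit. -/
theorem InClassC1.exists_localModel_of_nonneg (hA : IsSimpleCStar A) (hC : InClassC1 A)
    (G : Finset (MvNSemigroup A)) (K : ℕ) :
    ∃ N ≠ 0, ∀ a : A, 0 ≤ a → a ≠ 0 → ∃ (p : A) (hp : IsStarProjection p),
      CuntzLE (1 - p) a ∧ ∃ L : LocalModel A N G K,
        ∀ α ∈ G, ∃ δ, N • clOne (1 - p) hp.one_sub = L.ω α + δ := by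
  classical
  have hk : ∀ α : MvNSemigroup A, ∃ (k : ℕ) (β : MvNSemigroup A), α ≠ 0 → k • α = unit A + β := by
    intro α
    by_cases h : α = 0
    · exact ⟨0, 0, fun h' => absurd h h'⟩
    · obtain ⟨k, β, h'⟩ := hA.exists_nsmul_eq_unit_add h
      exact ⟨k, β, fun _ => h'⟩
  choose k β hkβ using hk
  let G₁ : Finset (MvNSemigroup A) :=
    (G ∪ G.image β) ∪ G.biUnion fun α => (Finset.range (k α + 1)).image fun j => j • α
  choose n₀ hn₀ using fun α : MvNSemigroup A => exists_cl_eq_of_le α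
  obtain ⟨N, hN⟩ : ∃ N, N = 1 + ∑ α ∈ G₁, n₀ α := ⟨_, rfl⟩
  have hN0 : N ≠ 0 := by omega
  let G₂ : Finset (MvNSemigroup A) := G₁ ∪ (Finset.range (N + 1)).image fun j => j • unit A
  have hrep : ∀ α ∈ G₂, ∃ (e : CStarMatrix (Fin N) (Fin N) A) (he : IsStarProjection e),
      cstarCl e he = α := by
    intro α hα
    rcases Finset.mem_union.1 hα with h | h
    · have h1 : n₀ α ≤ ∑ α ∈ G₁, n₀ α :=
        Finset.single_le_sum (f := n₀) (fun _ _ => Nat.zero_le _) h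
      exact hn₀ α N (by omega)
    · obtain ⟨j, hj, rfl⟩ := Finset.mem_image.1 h
      have hj : j ≤ N := Nat.lt_succ_iff.1 (Finset.mem_range.1 hj)
      have h1 := cl_one (A := A) N
      rw [← Nat.add_sub_cancel' hj, add_smul, Nat.add_sub_cancel' hj] at h1
      obtain ⟨e₁, -, h₁, -, -, -, h2, -⟩ := exists_add_eq_of_cl_eq_add _ h1
      exact ⟨e₁, h₁, h2⟩
  obtain ⟨M, hM⟩ : ∃ M, M = 1 + ∑ α ∈ G, k α := ⟨_, rfl⟩
  refine ⟨N, hN0, fun a ha ha0 => ?_⟩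
  -- The factor N is lost in passing from N[1] to [1], and the factor M, a common bound for the
  -- multiples k, in passing from [1] to the elements of G.
  obtain ⟨p, hp, D, w, ω, hpa, hX, h1, h2, h3⟩ :=
    hC.exists_chart_of_represented hN0 G₂ hrep (N * (M * K)) ha ha0
  have hu : ∀ j ≤ N, j • unit A ∈ G₂ := fun j hj => Finset.mem_union_right _
    (Finset.mem_image_of_mem _ (Finset.mem_range.2 (by omega)))
  have hu1 : unit A ∈ G₂ := by simpa using hu 1 (by omega)
  have hGG : ∀ α ∈ G, α ∈ G₂ := fun α hα => Finset.mem_union_left _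
    (Finset.mem_union_left _ (Finset.mem_union_left _ hα))
  have hGβ : ∀ α ∈ G, β α ∈ G₂ := fun α hα => Finset.mem_union_left _
    (Finset.mem_union_left _ (Finset.mem_union_right _ (Finset.mem_image_of_mem _ hα)))
  have hGk : ∀ α ∈ G, ∀ j ≤ k α, j • α ∈ G₂ := fun α hα j hj => Finset.mem_union_left _
    (Finset.mem_union_right _ (Finset.mem_biUnion.2 ⟨α, hα,
      Finset.mem_image.2 ⟨j, Finset.mem_range.2 (by omega), rfl⟩⟩))
  have hunit : ∀ x, M * K * (D.d + 1) ≤ rk (w (unit A)) x := by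
    intro x
    have h4 := h3 (hu N le_rfl) x
    rw [eq_mul_of_add_on_multiples (f := fun α => rk (w α) x)
      (fun α β hα hβ hαβ => h2 α β hα hβ hαβ x) N hu, mul_assoc] at h4
    exact Nat.le_of_mul_le_mul_left h4 (Nat.pos_of_ne_zero hN0)
  refine ⟨p, hp, hpa, ⟨D, w, ω, hX, fun α hα => (h1 α (hGG α hα)).1,
    fun α hα => (h1 α (hGG α hα)).2.1,
    fun x α β hα hβ hαβ => h2 α β (hGG α hα) (hGG β hβ) (hGG _ hαβ) x, fun α hα hα0 x => ?_⟩,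
    fun α hα => (h1 α (hGG α hα)).2.2⟩
  have h4 := hunit x
  have h5 := eq_mul_of_add_on_multiples (f := fun α => rk (w α) x)
      (fun α β hα hβ hαβ => h2 α β hα hβ hαβ x) (k α) (hGk α hα)
  have h6 := hGk α hα (k α) le_rfl
  rw [hkβ α hα0] at h5 h6
  have h7 := h2 _ _ hu1 (hGβ α hα) h6 x
  have h8 : k α ≤ M := by
    have : k α ≤ ∑ α ∈ G, k α := Finset.single_le_sum (f := k) (fun _ _ => Nat.zero_le _) hα
    omega
  have h9 : M * (K * (D.d + 1)) ≤ M * rk (w α) x := by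
    calc M * (K * (D.d + 1)) = M * K * (D.d + 1) := by ring
      _ ≤ k α * rk (w α) x := by
          omega
      _ ≤ M * rk (w α) x := Nat.mul_le_mul_right _ h8
  exact Nat.le_of_mul_le_mul_left h9 (by omega)

/-- In a local model both classes have rank large enough to contain the trivial bundle of rank n +
1, and φ is the class pushed from its trivial line. -/
theorem InClassC1.exists_nsmul_le (hA : IsSimpleCStar A) (hC : InClassC1 A)
    {σ τ : MvNSemigroup A} (hσ : σ ≠ 0) (hτ : τ ≠ 0) (n : ℕ) :
    ∃ φ ≠ 0, (∃ δ, σ = (n + 1) • φ + δ) ∧ ∃ δ, τ = (n + 1) • φ + δ := by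
  classical
  have := hA.1
  obtain ⟨N, -, hN⟩ := hC.exists_localModel_of_nonneg hA {σ, τ} (n + 1)
  -- Only large ranks are needed here; the size of the remainders plays no role, so a = 1 will do.
  obtain ⟨p, hp, -, L, -⟩ := hN 1 zero_le_one one_ne_zero
  have key : ∀ α ∈ ({σ, τ} : Finset (MvNSemigroup A)), α ≠ 0 →
      L.D.IsRep ((n + 1) • unit C(L.D.X, ℂ)) ∧
      ∃ δ, α = L.D.push ((n + 1) • unit C(L.D.X, ℂ)) + δ := by
    intro α hα hα0
    obtain ⟨β, hβ⟩ := exists_eq_add_nsmul_unit L.D.dim_le (n + 1) (α := L.w α) (fun x => by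
      have := L.le_rk α hα hα0 x
      nlinarith)
    have h1 := L.isRep α hα
    have h2 := L.eq_add α hα
    rw [hβ] at h1 h2
    obtain ⟨h3, h4, h5⟩ := h1.of_add
    refine ⟨h4, L.D.push β + L.ω α, ?_⟩
    exact (h2.trans (congrArg (· + L.ω α) h5)).trans (by abel)
  obtain ⟨hr, h1⟩ := key σ (by simp) hσ
  obtain ⟨-, h2⟩ := key τ (by simp) hτ
  obtain ⟨hr', h3⟩ := hr.push_nsmul (Nat.succ_ne_zero n)
  rw [h3] at h1 h2
  refine ⟨L.D.push (unit C(L.D.X, ℂ)), fun h0 => ?_, h1, h2⟩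
  obtain ⟨x⟩ := L.nonempty
  have h4 := rk_unit x
  rw [hr'.eq_zero_of_push h0, map_zero] at h4
  exact zero_ne_one h4

/-- Choose φ ≠ 0 with (N + 1) φ ≤ γ and take for a a nonzero diagonal entry of a projection
representing φ. Then [1 - p] ≤ φ, so each remainder lies under N[1 - p] ≤ Nφ ≤ γ. -/
theorem InClassC1.exists_localModel (hA : IsSimpleCStar A) (hC : InClassC1 A)
    (G : Finset (MvNSemigroup A)) (K : ℕ) {γ : MvNSemigroup A} (hγ : γ ≠ 0) :
    ∃ (N : ℕ) (L : LocalModel A N G K), ∀ α ∈ G, ∃ δ, γ = L.ω α + δ := by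
  obtain ⟨N, hN0, hN⟩ := hC.exists_localModel_of_nonneg hA G K
  obtain ⟨φ, hφ, ⟨δ, hδ⟩, -⟩ := hC.exists_nsmul_le hA hγ hγ N
  obtain ⟨n, g, hg, rfl⟩ := exists_cl_eq φ
  obtain ⟨i, hi0, hi, -⟩ := exists_diag_ne_zero hg fun h => hφ ((cl_eq_zero_iff hg).2 h)
  obtain ⟨p, hp, hpa, L, hL⟩ := hN _ hi hi0
  obtain ⟨ε, hε⟩ := exists_eq_clOne_add_of_cuntzLE hp.one_sub (g := CStarMatrix.ofMatrix g) hg i hpa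
  replace hε : cl g hg = clOne (1 - p) hp.one_sub + ε := hε
  refine ⟨N, L, fun α hα => ?_⟩
  obtain ⟨η, hη⟩ := hL α hα
  refine ⟨η + N • ε + cl g hg + δ, ?_⟩
  rw [hδ, succ_nsmul]
  nth_rewrite 1 [hε]
  rw [nsmul_add, hη]
  abel

end LocalModels

/-! ### Properness, Riesz decomposition and unperforation in V(A) -/

section Consequences

open MvNSemigroup HomogeneousChart

variable {A : Type*} [CStarAlgebra A] [PartialOrder A] [StarOrderedRing A]

/-- In a local model the rank of r cancels, so τ would have rank 0, although nonzero classes have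
rank at least d + 1. -/
theorem InClassC1.eq_zero_of_add_eq (hA : IsSimpleCStar A) (hC : InClassC1 A)
    {τ r : MvNSemigroup A} (h : τ + r = r) : τ = 0 := by
  classical
  by_contra hτ
  obtain ⟨N, L, -⟩ := hC.exists_localModel hA {τ, r} 1 hτ
  obtain ⟨x⟩ := L.nonempty
  have h1 := L.rk_add x τ r (by simp) (by simp) (by simp [h])
  have h2 := L.le_rk τ (by simp) hτ x
  rw [h] at h1
  omega

/-- Riesz decomposition in `V(A)`. -/
theorem InClassC1.exists_decomposition (hA : IsSimpleCStar A) (hC : InClassC1 A)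
    {ξ ζ a b r : MvNSemigroup A} (h : ξ + ζ + r = a + b + r) (hξ : ξ ≠ 0) (hζ : ζ ≠ 0)
    (ha : a ≠ 0) (hb : b ≠ 0) :
    ∃ x₁ x₂ y₁ y₂, ξ = x₁ + x₂ ∧ a = x₁ + y₁ ∧ b = x₂ + y₂ := by
  classical
  -- Two copies of φ are found under both a and ζ: one is split off from each as room for a
  -- remainder, the other ensures that a' and ζ' remain nonzero.
  obtain ⟨φ, hφ, ⟨δ, hδ⟩, ε, hε⟩ := hC.exists_nsmul_le hA ha hζ 1
  obtain ⟨a', ha'⟩ : ∃ a', a' = φ + δ := ⟨_, rfl⟩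
  obtain ⟨ζ', hζ'⟩ : ∃ ζ', ζ' = φ + ε := ⟨_, rfl⟩
  have ha0 : a' ≠ 0 := fun h0 => hφ (eq_zero_of_add_eq_zero (ha' ▸ h0))
  have hζ0 : ζ' ≠ 0 := fun h0 => hφ (eq_zero_of_add_eq_zero (hζ' ▸ h0))
  have haa : a = φ + a' := by rw [hδ, ha', two_nsmul, add_assoc]
  have hζζ : ζ = φ + ζ' := by rw [hε, hζ', two_nsmul, add_assoc]
  obtain ⟨r', hr'⟩ : ∃ r', r' = φ + r := ⟨_, rfl⟩
  have h' : ξ + ζ' + r' = a' + b + r' := by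
    calc ξ + ζ' + r' = ξ + (φ + ζ') + r := by rw [hr']; abel
      _ = φ + a' + b + r := by rw [← hζζ, h, haa]
      _ = a' + b + r' := by rw [hr']; abel
  obtain ⟨N, L, hL⟩ := hC.exists_localModel hA
    {ξ, ζ', a', b, r', ξ + ζ', a' + b, ξ + ζ' + r', a' + b + r'} 2 hφ
  obtain ⟨μ, ν, μ', ν', h1, h2, h3⟩ := exists_decomposition_of_rk L.D.dim_le
    (ξ := L.w ξ) (ζ := L.w ζ') (α := L.w a') (β := L.w b) (fun x => by
      have e1 := L.rk_add x ξ ζ' (by simp) (by simp) (by simp)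
      have e2 := L.rk_add x (ξ + ζ') r' (by simp) (by simp) (by simp)
      have e3 := L.rk_add x a' b (by simp) (by simp) (by simp)
      have e4 := L.rk_add x (a' + b) r' (by simp) (by simp) (by simp)
      have e5 : rk (L.w (ξ + ζ' + r')) x = rk (L.w (a' + b + r')) x :=
        congrArg (fun y => rk (L.w y) x) h'
      omega)
    (L.le_rk ξ (by simp) hξ) (L.le_rk ζ' (by simp) hζ0) (L.le_rk a' (by simp) ha0)
    (L.le_rk b (by simp) hb)
  have push_add : ∀ α ∈ ({ξ, ζ', a', b, r', ξ + ζ', a' + b, ξ + ζ' + r', a' + b + r'} :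
      Finset (MvNSemigroup A)), ∀ σ τ, L.w α = σ + τ → α = L.D.push σ + L.D.push τ + L.ω α := by
    intro α hα σ τ hw
    have h4 := L.isRep α hα
    rw [hw] at h4
    rw [← h4.of_add.2.2, ← hw]
    exact L.eq_add α hα
  have e1 := push_add ξ (by simp) _ _ h1
  have e2 := push_add a' (by simp) _ _ h2
  have e3 := push_add b (by simp) _ _ h3
  obtain ⟨η, hη⟩ := hL ξ (by simp)
  -- The remainder of ξ is assigned to the first summand and absorbed by the copy of φ split off
  -- from a. The remainders of a' and b lie on the larger side and go into the complements.
  refine ⟨L.D.push μ + L.ω ξ, L.D.push ν, η + L.D.push μ' + L.ω a', L.D.push ν' + L.ω b, ?_, ?_, ?_⟩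
  · exact e1.trans (by abel)
  · rw [haa]
    exact (congrArg₂ (· + ·) hη e2).trans (by abel)
  · exact e3.trans (by abel)

/-- Weak unperforation in `V(A)`. -/
theorem InClassC1.exists_eq_add_of_nsmul (hA : IsSimpleCStar A) (hC : InClassC1 A)
    {p q s r : MvNSemigroup A} {n : ℕ} (hn : 1 ≤ n) (h : n • p + r = n • q + s + r)
    (hs : s ≠ 0) : ∃ t, p = q + t := by
  classical
  have hp : p ≠ 0 := by
    rintro rfl
    rw [smul_zero, zero_add] at h
    have h1 := hC.eq_zero_of_add_eq hA h.symm
    rw [add_comm] at h1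
    exact hs (eq_zero_of_add_eq_zero h1)
  -- One copy of φ is taken from p to absorb the remainder of q. This costs n copies in the
  -- relation, which are taken from s, and a further copy keeps s' nonzero.
  obtain ⟨φ, hφ, ⟨δ, hδ⟩, ε, hε⟩ := hC.exists_nsmul_le hA hs hp n
  obtain ⟨s', hs'⟩ : ∃ s', s' = φ + δ := ⟨_, rfl⟩
  obtain ⟨p', hp'⟩ : ∃ p', p' = n • φ + ε := ⟨_, rfl⟩
  have hs0 : s' ≠ 0 := fun h0 => hφ (eq_zero_of_add_eq_zero (hs' ▸ h0))
  have hss : s = n • φ + s' := by rw [hδ, hs', succ_nsmul, add_assoc]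
  have hpp : p = φ + p' := by rw [hε, hp', succ_nsmul]; abel
  obtain ⟨r', hr'⟩ : ∃ r', r' = n • φ + r := ⟨_, rfl⟩
  have h' : n • p' + r' = n • q + s' + r' := by
    calc n • p' + r' = n • (φ + p') + r := by rw [hr', nsmul_add]; abel
      _ = n • q + (n • φ + s') + r := by rw [← hpp, h, hss]
      _ = n • q + s' + r' := by rw [hr']; abel
  let G : Finset (MvNSemigroup A) := ((Finset.range (n + 1)).image (fun j => j • p') ∪
    (Finset.range (n + 1)).image fun j => j • q) ∪ {s', r', n • q + s', n • q + s' + r'}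
  -- With K = n the rank of s' is at least n(d + 1), so division by n leaves a gap of d + 1 between
  -- the ranks of q and p'.
  obtain ⟨N, L, hL⟩ := hC.exists_localModel hA G n hφ
  have hGp : ∀ j ≤ n, j • p' ∈ G := fun j hj => Finset.mem_union_left _ (Finset.mem_union_left _
    (Finset.mem_image.2 ⟨j, Finset.mem_range.2 (by omega), rfl⟩))
  have hGq : ∀ j ≤ n, j • q ∈ G := fun j hj => Finset.mem_union_left _ (Finset.mem_union_right _
    (Finset.mem_image.2 ⟨j, Finset.mem_range.2 (by omega), rfl⟩))
  have hGs : s' ∈ G := Finset.mem_union_right _ (by simp)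
  have hGr : r' ∈ G := Finset.mem_union_right _ (by simp)
  have hGqs : n • q + s' ∈ G := Finset.mem_union_right _ (by simp)
  have hGqr : n • q + s' + r' ∈ G := Finset.mem_union_right _ (by simp)
  have hp1 : p' ∈ G := by simpa using hGp 1 hn
  have hq1 : q ∈ G := by simpa using hGq 1 hn
  obtain ⟨t, ht⟩ := exists_eq_add_of_rk_le L.D.dim_le (α := L.w q) (β := L.w p') (fun x => by
    have e1 := L.rk_add x (n • p') r' (hGp n le_rfl) hGr (h' ▸ hGqr)
    have e2 := L.rk_add x (n • q + s') r' hGqs hGr hGqr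
    have e3 := L.rk_add x (n • q) s' (hGq n le_rfl) hGs hGqs
    have e4 : rk (L.w (n • p')) x = n * rk (L.w p') x :=
      eq_mul_of_add_on_multiples (f := fun α => rk (L.w α) x) (L.rk_add x) n hGp
    have e5 : rk (L.w (n • q)) x = n * rk (L.w q) x :=
      eq_mul_of_add_on_multiples (f := fun α => rk (L.w α) x) (L.rk_add x) n hGq
    have e6 := L.le_rk s' hGs hs0 x
    have e7 : rk (L.w (n • p' + r')) x = rk (L.w (n • q + s' + r')) x :=
      congrArg (fun y => rk (L.w y) x) h'
    have e8 : n * (rk (L.w q) x + (L.D.d + 1)) ≤ n * rk (L.w p') x := by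
      rw [Nat.mul_add]
      omega
    exact Nat.le_of_mul_le_mul_left e8 hn)
  have e1 := L.eq_add p' hp1
  have e2 := L.eq_add q hq1
  have h4 := L.isRep p' hp1
  rw [ht] at h4 e1
  replace e1 := e1.trans (by rw [h4.of_add.2.2])
  obtain ⟨η, hη⟩ := hL q hq1
  refine ⟨η + L.D.push t + L.ω p', ?_⟩
  rw [hpp]
  refine (congrArg₂ (· + ·) hη e1).trans ?_
  exact (by abel : _ = L.D.push (L.w q) + L.ω q + (η + L.D.push t + L.ω p')).trans
    (congrArg (· + (η + L.D.push t + L.ω p')) e2.symm)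

end Consequences

/-! ### Elements of K₀ as differences of classes -/

section GrothendieckGroup

open Algebra

variable {A : Type*} [Ring A] [StarRing A]

theorem K0.of_eq_of_iff {α β : MvNSemigroup A} :
    GrothendieckAddGroup.of α = GrothendieckAddGroup.of β ↔ ∃ r, α + r = β + r := by
  refine ((AddLocalization.addMonoidOf (⊤ : AddSubmonoid (MvNSemigroup A))).eq_iff_exists).trans
    ⟨?_, ?_⟩
  · rintro ⟨c, hc⟩
    exact ⟨c, by rw [add_comm, hc, add_comm]⟩
  · rintro ⟨r, hr⟩
    exact ⟨⟨r, trivial⟩, by rw [add_comm, hr, add_comm]⟩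

theorem K0.exists_eq_sub (x : K0 A) :
    ∃ p q : MvNSemigroup A, x = GrothendieckAddGroup.of p - GrothendieckAddGroup.of q := by
  obtain ⟨⟨p, q⟩, h⟩ := (AddLocalization.addMonoidOf (⊤ : AddSubmonoid (MvNSemigroup A))).surj x
  exact ⟨p, q, eq_sub_of_add_eq h⟩

theorem K0.of_mem_positiveCone (α : MvNSemigroup A) :
    GrothendieckAddGroup.of α ∈ K0.positiveCone A := ⟨α, rfl⟩

end GrothendieckGroup

/-! ### The ordered group K₀(A) -/

section OrderedKTheory

open Algebra MvNSemigroup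

variable {A : Type*} [CStarAlgebra A] [PartialOrder A] [StarOrderedRing A]

theorem InClassC1.isOrderedGroupCone (hA : IsSimpleCStar A) (hC : InClassC1 A) :
    IsOrderedGroupCone (K0.positiveCone A) where
  eq_zero := by
    rintro _ ⟨α, rfl⟩ ⟨β, hβ⟩
    have h : GrothendieckAddGroup.of (α + β) = GrothendieckAddGroup.of (0 : MvNSemigroup A) := by
      rw [map_add, hβ, map_zero, add_neg_cancel]
    obtain ⟨r, hr⟩ := K0.of_eq_of_iff.1 h
    rw [zero_add] at hr
    rw [eq_zero_of_add_eq_zero (hC.eq_zero_of_add_eq hA hr), map_zero]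
  generates x := by
    obtain ⟨p, q, h⟩ := K0.exists_eq_sub x
    exact ⟨_, K0.of_mem_positiveCone p, _, K0.of_mem_positiveCone q, h⟩

theorem InClassC1.isRieszGroup (hA : IsSimpleCStar A) (hC : InClassC1 A) :
    IsRieszGroup (K0.positiveCone A) where
  toIsOrderedGroupCone := hC.isOrderedGroupCone hA
  decomposition := by
    rintro _ ⟨ξ, rfl⟩ _ ⟨a, rfl⟩ _ ⟨b, rfl⟩ ⟨ζ, h⟩
    have mem := K0.of_mem_positiveCone (A := A)
    -- The decomposition in V(A) needs all four classes nonzero, since only nonzero classes have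
    -- large rank. The degenerate cases are settled directly in K₀.
    by_cases hξ : ξ = 0
    · refine ⟨0, zero_mem _, 0, zero_mem _, by rw [hξ, map_zero, add_zero], ?_, ?_⟩
      · rw [sub_zero]; exact mem a
      · rw [sub_zero]; exact mem b
    by_cases hζ : ζ = 0
    · rw [hζ, map_zero] at h
      refine ⟨_, mem a, _, mem b, (sub_eq_zero.1 h.symm).symm, ?_, ?_⟩
      · rw [sub_self]; exact zero_mem _
      · rw [sub_self]; exact zero_mem _
    by_cases ha : a = 0
    · rw [ha, map_zero, zero_add] at h
      refine ⟨0, zero_mem _, _, mem ξ, (zero_add _).symm, ?_, ?_⟩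
      · rw [sub_zero]; exact mem a
      · exact ⟨ζ, h⟩
    by_cases hb : b = 0
    · rw [hb, map_zero, add_zero] at h
      refine ⟨_, mem ξ, 0, zero_mem _, (add_zero _).symm, ?_, ?_⟩
      · exact ⟨ζ, h⟩
      · rw [sub_zero]; exact mem b
    have h' : GrothendieckAddGroup.of (ξ + ζ) = GrothendieckAddGroup.of (a + b) := by
      rw [map_add, map_add]
      refine (congrArg (GrothendieckAddGroup.of ξ + ·) h).trans ?_
      exact add_sub_cancel _ _
    obtain ⟨r, hr⟩ := K0.of_eq_of_iff.1 h'
    obtain ⟨x₁, x₂, y₁, y₂, rfl, rfl, rfl⟩ := hC.exists_decomposition hA hr hξ hζ ha hb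
    refine ⟨_, mem x₁, _, mem x₂, map_add _ _ _, ?_, ?_⟩
    · rw [map_add, add_sub_cancel_left]; exact mem y₁
    · rw [map_add, add_sub_cancel_left]; exact mem y₂

theorem InClassC1.isWeaklyUnperforated (hA : IsSimpleCStar A) (hC : InClassC1 A) :
    IsWeaklyUnperforated (K0.positiveCone A) := by
  rintro x n hn ⟨s, hs⟩ hx
  obtain ⟨p, q, rfl⟩ := K0.exists_eq_sub x
  have h : GrothendieckAddGroup.of (n • p) = GrothendieckAddGroup.of (n • q + s) := by
    rw [map_add, hs, map_nsmul, map_nsmul, ← nsmul_add, add_sub_cancel]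
  obtain ⟨r, hr⟩ := K0.of_eq_of_iff.1 h
  have hs0 : s ≠ 0 := by
    rintro rfl
    exact hx (by rw [← hs, map_zero])
  obtain ⟨t, rfl⟩ := hC.exists_eq_add_of_nsmul hA hn hr hs0
  refine ⟨?_, fun h0 => hx (by rw [h0, smul_zero])⟩
  rw [map_add, add_sub_cancel_left]
  exact K0.of_mem_positiveCone t

end OrderedKTheory

theorem mainTheorem8 (A : Type*) [CStarAlgebra A] [PartialOrder A] [StarOrderedRing A]
    [TopologicalSpace.SeparableSpace A] (hsimple : IsSimpleCStar A) (hC : InClassC1 A) :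
    IsRieszGroup (K0.positiveCone A) ∧ IsWeaklyUnperforated (K0.positiveCone A) :=
  ⟨hC.isRieszGroup hsimple, hC.isWeaklyUnperforated hsimple⟩
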